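/- Let $M$ be a complete (connected, smooth, second countable) Riemannian manifold without boundary, with Riemannian distance, Riemannian measure $\mu$ and gradient $\nabla$; functions are real valued and $L_p=L_p(M,\mu)$. Let $1\le q<\infty$ and let $V\in RH_{q,\mathrm{loc}}$, that is: $V\ge 0$ is locally integrable and there are $C<\infty$ and $r_0>0$ such that $$\Big(\frac1{\mu(B)}\int_B V^q\,d\mu\Big)^{1/q}\le \frac{C}{\mu(B)}\int_B V\,d\mu$$ for every open ball $B$ of radius $0<r<r_0$. Let $1\le p<q$. Let $E^1_{p,V}$ be the space of $C^\infty$ functions $f$ on $M$ such that $f$, $|\nabla f|$ and $Vf$ belong to $L_p$, with the norm $$\|f\|_{p}+\|\,|\nabla f|\,\|_{p}+\|Vf\|_{p},$$ and let $W^1_{p,V}$ be the completion of $E^1_{p,V}$ for this norm. Let $$H^1_{p,V}=\{f\in L_p:\ |\nabla f|\in L_p \text{ and } Vf\in L_p\},$$ with $\nabla f$ the gradient in the sense of distributions, equipped with the same norm. Then the space $C_0^\infty(M)$ of smooth functions with compact support is contained and dense in $H^1_{p,V}$. Hence $W^1_{p,V}=H^1_{p,V}$: there is a linear isometric isomorphism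 of $W^1_{p,V}$ onto $H^1_{p,V}$ which sends every $f\in E^1_{p,V}$ to (the class of) $f$. -/

import Mathlib

open scoped Manifold ContDiff Bundle ENNReal NNReal Topology
open MeasureTheory Set Bundle
noncomputable section
namespace RiemannianSobolev
set_option linter.unusedSectionVars false
section
variable {n : ℕ} {M : Type*} [MetricSpace M] [ChartedSpace (EuclideanSpace ℝ (Fin n)) M]

/-- The coordinate vector field `∂ᵢ` of the chart around `x₀`, at the point with coordinates `u`. -/
def coordVec (x₀ : M) (i : Fin n) (u : EuclideanSpace ℝ (Fin n)) :
    TangentSpace (𝓡 n) ((extChartAt (𝓡 n) x₀).symm u) :=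
  mfderiv 𝓘(ℝ, EuclideanSpace ℝ (Fin n)) (𝓡 n) (extChartAt (𝓡 n) x₀).symm u
    (EuclideanSpace.single i 1 : EuclideanSpace ℝ (Fin n))

instance finiteDimensional_tangentSpace (x : M) : FiniteDimensional ℝ (TangentSpace (𝓡 n) x) :=
  inferInstanceAs (FiniteDimensional ℝ (EuclideanSpace ℝ (Fin n)))

variable [RiemannianBundle (fun x : M ↦ TangentSpace (𝓡 n) x)]

/-- The matrix `g_{ij} = ⟨∂ᵢ, ∂ⱼ⟩` of the Riemannian metric in the chart around `x₀`. -/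
def gram (x₀ : M) (u : EuclideanSpace ℝ (Fin n)) : Matrix (Fin n) (Fin n) ℝ :=
  Matrix.gram ℝ fun i ↦ coordVec x₀ i u

variable (n) in
/-- The Riemannian gradient of `f`: the vector field with `⟨∇f, X⟩ = df(X)`. -/
def grad (f : M → ℝ) (x : M) : TangentSpace (𝓡 n) x :=
  haveI : CompleteSpace (TangentSpace (𝓡 n) x) := FiniteDimensional.complete ℝ _
  (InnerProductSpace.toDual ℝ (TangentSpace (𝓡 n) x)).symm (mfderiv (𝓡 n) 𝓘(ℝ, ℝ) f x)

/-- The Riemannian volume density `√(det g_{ij})` in the chart around `x₀`. -/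
def volDensity (x₀ : M) (u : EuclideanSpace ℝ (Fin n)) : ℝ≥0∞ :=
  ENNReal.ofReal (Real.sqrt (gram x₀ u).det)

section
variable [MeasurableSpace M]

variable (n) in
/-- The Riemannian measure of the domain of the chart around `x₀`: `√(det g_{ij}) du`, transported
to the manifold by the inverse of the chart. -/
def chartMeasure (x₀ : M) : Measure M :=
  (((volume : Measure (EuclideanSpace ℝ (Fin n))).restrict
    (extChartAt (𝓡 n) x₀).target).withDensity (volDensity x₀)).map (extChartAt (𝓡 n) x₀).symm

variable (n M) in
theorem riemannianMeasure_aux : (inferInstance : MeasurableSpace M) ≤ (OuterMeasure.boundedBy (fun s : Set M ↦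
      ⨅ (x₀ : M) (_ : s ⊆ (extChartAt (𝓡 n) x₀).source), chartMeasure n x₀ s)).caratheodory := by
  intro s hs
  refine OuterMeasure.boundedBy_caratheodory fun t ↦ ?_
  refine le_iInf₂ fun x₀ hx₀ ↦ ?_
  refine (add_le_add (iInf₂_le x₀ (inter_subset_left.trans hx₀))
    (iInf₂_le x₀ (sdiff_subset.trans hx₀))).trans ?_
  rw [measure_inter_add_sdiff t hs]

variable (n M) in
/-- The Riemannian measure `μ` of `M`, glued from the chart measures. It is the Borel measure that
equals `√(det g_{ij}) du` in each chart, see `riemannianMeasure_restrict_source`. -/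
def riemannianMeasure : Measure M :=
  (OuterMeasure.boundedBy (fun s : Set M ↦
    ⨅ (x₀ : M) (_ : s ⊆ (extChartAt (𝓡 n) x₀).source),
      chartMeasure n x₀ s)).toMeasure (riemannianMeasure_aux n M)

end

variable [IsManifold (𝓡 n) ∞ M]
  [IsContMDiffRiemannianBundle (𝓡 n) ∞ (EuclideanSpace ℝ (Fin n)) (fun x : M ↦ TangentSpace (𝓡 n) x)]

theorem continuousOn_gram (x₀ : M) : ContinuousOn (gram x₀) (extChartAt (𝓡 n) x₀).target := by
  have hc : ∀ i, ContinuousOn (fun u ↦ (⟨(extChartAt (𝓡 n) x₀).symm u, coordVec x₀ i u⟩ :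
      TangentBundle (𝓡 n) M)) (extChartAt (𝓡 n) x₀).target := by
    intro i
    have h1 := (contMDiffOn_extChartAt_symm (I := 𝓡 n) (n := ∞) x₀).continuousOn_tangentMapWithin
      (by simp) (isOpen_extChartAt_target x₀).uniqueMDiffOn
    have h2 : Continuous (fun u : EuclideanSpace ℝ (Fin n) ↦ (⟨u, EuclideanSpace.single i 1⟩ :
        TangentBundle 𝓘(ℝ, EuclideanSpace ℝ (Fin n)) (EuclideanSpace ℝ (Fin n)))) := by
      have := (tangentBundleModelSpaceHomeomorph
        𝓘(ℝ, EuclideanSpace ℝ (Fin n))).symm.continuous.comp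
        (Continuous.prodMk continuous_id (continuous_const
          (y := (EuclideanSpace.single i 1 : EuclideanSpace ℝ (Fin n)))))
      exact this
    refine (h1.comp h2.continuousOn (fun u hu ↦ hu)).congr (fun u hu ↦ ?_)
    simp only [Function.comp, tangentMapWithin, coordVec]
    rw [mfderivWithin_of_isOpen (isOpen_extChartAt_target x₀) hu]
  have : IsContinuousRiemannianBundle (EuclideanSpace ℝ (Fin n))
      (fun x : M ↦ TangentSpace (𝓡 n) x) := by
    obtain ⟨g, hg, hg'⟩ := IsContMDiffRiemannianBundle.exists_contMDiff (IB := 𝓡 n) (n := ∞)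
      (F := EuclideanSpace ℝ (Fin n)) (E := fun x : M ↦ TangentSpace (𝓡 n) x)
    exact ⟨g, hg.continuous, hg'⟩
  refine continuousOn_pi.2 fun i ↦ continuousOn_pi.2 fun j ↦ ?_
  exact ContinuousOn.inner_bundle (F := EuclideanSpace ℝ (Fin n)) (hc i) (hc j)

/-- Transformation of `det g_{ij}` under a change of charts. -/
theorem gram_transition (x y : M) {u : EuclideanSpace ℝ (Fin n)}
    (hu : u ∈ (extChartAt (𝓡 n) y).target) (hx : (extChartAt (𝓡 n) y).symm u ∈ (extChartAt (𝓡 n) x).source) :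
    DifferentiableAt ℝ (extChartAt (𝓡 n) x ∘ (extChartAt (𝓡 n) y).symm) u ∧
    (gram y u).det = (fderiv ℝ (extChartAt (𝓡 n) x ∘ (extChartAt (𝓡 n) y).symm) u).det ^ 2 *
      (gram x (extChartAt (𝓡 n) x ((extChartAt (𝓡 n) y).symm u))).det := by
  set T := extChartAt (𝓡 n) x ∘ (extChartAt (𝓡 n) y).symm with hT
  have hTd : DifferentiableAt ℝ T u := by
    have h1 := (mdifferentiableAt_extChartAt (I := 𝓡 n) (x := x) (by simpa using hx)).comp u
      ((contMDiffOn_extChartAt_symm (I := 𝓡 n) (n := ∞) y).mdifferentiableOn (by simp) u hu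
        |>.mdifferentiableAt ((isOpen_extChartAt_target y).mem_nhds hu))
    exact h1.differentiableAt
  refine ⟨hTd, ?_⟩
  have hTu : T u ∈ (extChartAt (𝓡 n) x).target := (extChartAt (𝓡 n) x).map_source hx
  have hback : (extChartAt (𝓡 n) x).symm (T u) = (extChartAt (𝓡 n) y).symm u :=
    (extChartAt (𝓡 n) x).left_inv hx
  let D (z : M) (w : EuclideanSpace ℝ (Fin n)) :
      EuclideanSpace ℝ (Fin n) →L[ℝ] EuclideanSpace ℝ (Fin n) :=
    mfderiv 𝓘(ℝ, EuclideanSpace ℝ (Fin n)) (𝓡 n) (extChartAt (𝓡 n) z).symm w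
  have hD : D y u = (D x (T u)).comp (fderiv ℝ T u) := by
    have h1 : HasMFDerivAt 𝓘(ℝ, EuclideanSpace ℝ (Fin n)) (𝓡 n) (extChartAt (𝓡 n) x).symm (T u)
        (D x (T u)) := 
      ((contMDiffOn_extChartAt_symm (I := 𝓡 n) (n := ∞) x).mdifferentiableOn (by simp) _ hTu
        |>.mdifferentiableAt ((isOpen_extChartAt_target x).mem_nhds hTu)).hasMFDerivAt
    have h2 := h1.comp u hTd.hasFDerivAt.hasMFDerivAt
    refine HasMFDerivAt.mfderiv (h2.congr_of_eventuallyEq ?_)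
    have h3 : ContinuousAt (extChartAt (𝓡 n) y).symm u := continuousAt_extChartAt_symm'' hu
    filter_upwards [h3.preimage_mem_nhds ((isOpen_extChartAt_source x).mem_nhds hx)] with v hv
    exact ((extChartAt (𝓡 n) x).left_inv hv).symm
  let Q (p : M) (v w : EuclideanSpace ℝ (Fin n)) : ℝ :=
    @inner ℝ (TangentSpace (𝓡 n) p) _ v w
  have hg (z : M) (w : EuclideanSpace ℝ (Fin n)) (i j : Fin n) :
      gram z w i j = Q ((extChartAt (𝓡 n) z).symm w) (D z w (EuclideanSpace.single i 1))
        (D z w (EuclideanSpace.single j 1)) := rfl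
  let A : Matrix (Fin n) (Fin n) ℝ := Matrix.of fun k i ↦
    (fderiv ℝ T u (EuclideanSpace.single i 1)) k
  have hexp (v : EuclideanSpace ℝ (Fin n)) : v = ∑ k, v k • EuclideanSpace.single k (1:ℝ) := by
    ext l
    simp [Finset.sum_apply, Pi.single_apply]
  have hQ (p : M) (S : EuclideanSpace ℝ (Fin n) →L[ℝ] EuclideanSpace ℝ (Fin n))
      (v w : EuclideanSpace ℝ (Fin n)) :
      Q p (S v) (S w) = ∑ k, ∑ l, v k * w l * Q p (S (EuclideanSpace.single k 1))
        (S (EuclideanSpace.single l 1)) := by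
    let B : TangentSpace (𝓡 n) p → TangentSpace (𝓡 n) p → ℝ := fun a b ↦ inner ℝ a b
    have e1 : S v = ∑ k, v k • S (EuclideanSpace.single k 1) := by
      conv_lhs => rw [hexp v]
      simp
    have e2 : S w = ∑ k, w k • S (EuclideanSpace.single k 1) := by
      conv_lhs => rw [hexp w]
      simp
    rw [e1, e2]
    let s : Fin n → TangentSpace (𝓡 n) p := fun k ↦ S (EuclideanSpace.single k 1)
    change inner ℝ (∑ k, v k • s k) (∑ l, w l • s l) = ∑ k, ∑ l, v k * w l * inner ℝ (s k) (s l)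
    simp only [sum_inner, inner_sum, real_inner_smul_left, real_inner_smul_right]
    rw [Finset.sum_comm]
    refine Finset.sum_congr rfl fun k _ ↦ Finset.sum_congr rfl fun l _ ↦ ?_
    ring
  have hmat : gram y u = A.transpose * gram x (T u) * A := by
    ext i j
    rw [hg, hD, ContinuousLinearMap.comp_apply, ContinuousLinearMap.comp_apply, hQ,
      Matrix.mul_apply, Finset.sum_comm]
    refine Finset.sum_congr rfl fun l _ ↦ ?_
    rw [Matrix.mul_apply, Finset.sum_mul]
    refine Finset.sum_congr rfl fun k _ ↦ ?_
    rw [hg, hback]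
    simp only [A, Matrix.transpose_apply, Matrix.of_apply]
    ring
  have hA : A.det = (fderiv ℝ T u).det := by
    rw [ContinuousLinearMap.det, ← LinearMap.det_toMatrix (EuclideanSpace.basisFun (Fin n) ℝ).toBasis]
    congr 1
  change _ = _ * (gram x (T u)).det
  rw [hmat, Matrix.det_mul, Matrix.det_mul, Matrix.det_transpose, hA]
  ring

theorem linearIndependent_coordVec (x₀ : M) {u : EuclideanSpace ℝ (Fin n)}
    (hu : u ∈ (extChartAt (𝓡 n) x₀).target) :
    LinearIndependent ℝ (fun i ↦ coordVec x₀ i u) := by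
  have h := isInvertible_mfderivWithin_extChartAt_symm (I := 𝓡 n) hu
  rw [ModelWithCorners.range_eq_univ, mfderivWithin_univ] at h
  obtain ⟨L, hL⟩ := h
  have h1 : LinearIndependent ℝ
      (fun i ↦ (EuclideanSpace.basisFun (Fin n) ℝ).toBasis i) := Module.Basis.linearIndependent _
  have h2 := h1.map' L.toLinearEquiv.toLinearMap L.toLinearEquiv.ker
  have h3 : (fun i ↦ coordVec x₀ i u) = L.toLinearEquiv.toLinearMap ∘
      fun i ↦ (EuclideanSpace.basisFun (Fin n) ℝ).toBasis i := by
    ext1 i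
    simp only [coordVec, Function.comp, ← hL]
    simp only [OrthonormalBasis.coe_toBasis, EuclideanSpace.basisFun_apply]
    rfl
  rw [h3]
  exact h2

theorem det_gram_pos (x₀ : M) {u : EuclideanSpace ℝ (Fin n)}
    (hu : u ∈ (extChartAt (𝓡 n) x₀).target) : 0 < (gram x₀ u).det := by
  have h1 : (gram x₀ u).det ≠ 0 :=
    (Matrix.det_gram_ne_zero_iff_linearIndependent (𝕜 := ℝ)).2 (linearIndependent_coordVec x₀ hu)
  have h2 : 0 ≤ (gram x₀ u).det := (Matrix.posSemidef_gram ℝ (fun i ↦ coordVec x₀ i u)).det_nonneg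
  exact lt_of_le_of_ne h2 h1.symm

theorem aemeasurable_volDensity (x₀ : M) : AEMeasurable (volDensity x₀)
    ((volume : Measure (EuclideanSpace ℝ (Fin n))).restrict (extChartAt (𝓡 n) x₀).target) := by
  have h : ContinuousOn (fun u ↦ Real.sqrt (gram x₀ u).det) (extChartAt (𝓡 n) x₀).target :=
    (Real.continuous_sqrt.comp (continuous_id.matrix_det)).comp_continuousOn
      (continuousOn_gram x₀)
  exact (h.aemeasurable (isOpen_extChartAt_target x₀).measurableSet).ennreal_ofReal

variable [MeasurableSpace M] [BorelSpace M]

theorem aemeasurable_chart_symm (x₀ : M) : AEMeasurable (extChartAt (𝓡 n) x₀).symm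
    (((volume : Measure (EuclideanSpace ℝ (Fin n))).restrict
    (extChartAt (𝓡 n) x₀).target).withDensity (volDensity x₀)) :=
  ((continuousOn_extChartAt_symm x₀).aemeasurable
    (isOpen_extChartAt_target x₀).measurableSet).mono_ac (withDensity_absolutelyContinuous _ _)

theorem image_chart_eq (x₀ : M) {s : Set M} (hs : s ⊆ (extChartAt (𝓡 n) x₀).source) :
    (extChartAt (𝓡 n) x₀) '' s = (extChartAt (𝓡 n) x₀).target ∩ (extChartAt (𝓡 n) x₀).symm ⁻¹' s :=
  (extChartAt (𝓡 n) x₀).image_eq_target_inter_inv_preimage hs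

theorem measurableSet_image_chart (x₀ : M) {s : Set M} (hs : MeasurableSet s)
    (hs' : s ⊆ (extChartAt (𝓡 n) x₀).source) : MeasurableSet ((extChartAt (𝓡 n) x₀) '' s) := by
  rw [image_chart_eq x₀ hs']
  classical
  have h := (continuousOn_extChartAt_symm (I := 𝓡 n) x₀).measurable_piecewise
    (continuousOn_const (c := x₀)) (isOpen_extChartAt_target x₀).measurableSet
  have h2 := (isOpen_extChartAt_target (I := 𝓡 n) x₀).measurableSet.inter (h hs)
  have h3 : (extChartAt (𝓡 n) x₀).target ∩ (extChartAt (𝓡 n) x₀).symm ⁻¹' s =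
      (extChartAt (𝓡 n) x₀).target ∩ ((extChartAt (𝓡 n) x₀).target.piecewise
        (extChartAt (𝓡 n) x₀).symm (fun _ ↦ x₀)) ⁻¹' s := by
    refine Set.ext fun u ↦ and_congr_right fun hu ↦ ?_
    rw [mem_preimage, mem_preimage, Set.piecewise_eq_of_mem _ _ _ hu]
  rw [h3]
  exact h2

theorem chartMeasure_apply (x₀ : M) {s : Set M} (hs : MeasurableSet s)
    (hs' : s ⊆ (extChartAt (𝓡 n) x₀).source) :
    chartMeasure n x₀ s = ∫⁻ u in (extChartAt (𝓡 n) x₀) '' s, volDensity x₀ u := by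
  have hi := measurableSet_image_chart x₀ hs hs'
  rw [chartMeasure, Measure.map_apply_of_aemeasurable (aemeasurable_chart_symm x₀) hs,
    withDensity_apply', Measure.restrict_restrict' (isOpen_extChartAt_target x₀).measurableSet,
    image_chart_eq x₀ hs', inter_comm]

theorem chartMeasure_compl_source (x₀ : M) :
    chartMeasure n x₀ (extChartAt (𝓡 n) x₀).sourceᶜ = 0 := by
  rw [chartMeasure, Measure.map_apply_of_aemeasurable (aemeasurable_chart_symm x₀)
    (isOpen_extChartAt_source x₀).measurableSet.compl]
  refine withDensity_absolutelyContinuous _ _ ?_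
  refine measure_mono_null (t := (extChartAt (𝓡 n) x₀).targetᶜ) (fun u hu hu' ↦ hu
    ((extChartAt (𝓡 n) x₀).map_target hu')) ?_
  rw [Measure.restrict_apply (isOpen_extChartAt_target x₀).measurableSet.compl]
  simp

theorem chartMeasure_eq_of_subset (x y : M) {s : Set M} (hs : MeasurableSet s)
    (hx : s ⊆ (extChartAt (𝓡 n) x).source) (hy : s ⊆ (extChartAt (𝓡 n) y).source) :
    chartMeasure n x s = chartMeasure n y s := by
  rw [chartMeasure_apply x hs hx, chartMeasure_apply y hs hy]
  set T := extChartAt (𝓡 n) x ∘ (extChartAt (𝓡 n) y).symm with hT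
  have him : extChartAt (𝓡 n) x '' s = T '' (extChartAt (𝓡 n) y '' s) := by
    rw [hT, image_comp]
    congr 1
    rw [(extChartAt (𝓡 n) y).symm_image_image_of_subset_source hy]
  have key : ∀ u ∈ extChartAt (𝓡 n) y '' s, DifferentiableAt ℝ T u ∧
      (gram y u).det = (fderiv ℝ T u).det ^ 2 * (gram x (T u)).det := by
    rintro _ ⟨p, hp, rfl⟩
    exact gram_transition x y ((extChartAt (𝓡 n) y).map_source (hy hp))
      (by rw [(extChartAt (𝓡 n) y).left_inv (hy hp)]; exact hx hp)
  rw [him, lintegral_image_eq_lintegral_abs_det_fderiv_mul volume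
    (measurableSet_image_chart y hs hy)
    (fun u hu ↦ (key u hu).1.hasFDerivAt.hasFDerivWithinAt) ?_]
  · refine setLIntegral_congr_fun (measurableSet_image_chart y hs hy) fun u hu ↦ ?_
    simp only [volDensity]
    rw [(key u hu).2, Real.sqrt_mul (sq_nonneg _), Real.sqrt_sq_eq_abs,
      ENNReal.ofReal_mul (abs_nonneg _)]
  · rintro _ ⟨p, hp, rfl⟩ _ ⟨p', hp', rfl⟩ h
    simp only [hT, Function.comp, (extChartAt (𝓡 n) y).left_inv (hy hp),
      (extChartAt (𝓡 n) y).left_inv (hy hp')] at h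
    rw [(extChartAt (𝓡 n) x).injOn (hx hp) (hx hp') h]

theorem chartMeasure_le (x : M) : chartMeasure n x ≤ riemannianMeasure n M := by
  refine Measure.le_iff'.2 fun s ↦ ?_
  refine le_trans ?_ (le_toMeasure_apply _ _ s)
  refine (OuterMeasure.le_boundedBy (μ := (chartMeasure n x).toOuterMeasure)).2 (fun t ↦ ?_) s
  refine le_iInf₂ fun y hy ↦ ?_
  rw [Measure.toOuterMeasure_apply]
  have hO := ((isOpen_extChartAt_source (I := 𝓡 n) x).inter
    (isOpen_extChartAt_source (I := 𝓡 n) y)).measurableSet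
  set O := (extChartAt (𝓡 n) x).source ∩ (extChartAt (𝓡 n) y).source
  have hr : (chartMeasure n x).restrict O = (chartMeasure n y).restrict O := by
    refine Measure.ext fun s hs ↦ ?_
    rw [Measure.restrict_apply hs, Measure.restrict_apply hs]
    exact chartMeasure_eq_of_subset x y (hs.inter hO) (fun p hp ↦ hp.2.1) (fun p hp ↦ hp.2.2)
  calc chartMeasure n x t ≤ chartMeasure n x ((t ∩ O) ∪ (extChartAt (𝓡 n) x).sourceᶜ) := by
        refine measure_mono fun p hp ↦ ?_
        by_cases h : p ∈ (extChartAt (𝓡 n) x).source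
        · exact Or.inl ⟨hp, h, hy hp⟩
        · exact Or.inr h
    _ ≤ chartMeasure n x (t ∩ O) + 0 := by
        rw [← chartMeasure_compl_source (n := n) x]
        exact measure_union_le _ _
    _ = (chartMeasure n y).restrict O t := by
        rw [add_zero, ← hr, Measure.restrict_apply' hO]
    _ ≤ chartMeasure n y t := Measure.restrict_apply_le _ _

theorem riemannianMeasure_restrict_source_le (x : M) :
    (riemannianMeasure n M).restrict (extChartAt (𝓡 n) x).source ≤ chartMeasure n x := by
  refine Measure.le_iff.2 fun s hs ↦ ?_
  rw [Measure.restrict_apply hs, riemannianMeasure, toMeasure_apply _ _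
    (hs.inter (isOpen_extChartAt_source x).measurableSet)]
  refine (OuterMeasure.boundedBy_le _).trans ((iInf₂_le x inter_subset_right).trans
    (measure_mono inter_subset_left))

/-- In each chart, the Riemannian measure is `√(det g_{ij}) du`. -/
theorem riemannianMeasure_restrict_source (x : M) :
    (riemannianMeasure n M).restrict (extChartAt (𝓡 n) x).source = chartMeasure n x := by
  refine le_antisymm (riemannianMeasure_restrict_source_le x) ?_
  have h : (chartMeasure n x).restrict (extChartAt (𝓡 n) x).source = chartMeasure n x :=
    Measure.restrict_eq_self_of_ae_mem (measure_eq_zero_iff_ae_notMem.1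
      (chartMeasure_compl_source x) |>.mono fun _ hy ↦ not_not.1 hy)
  rw [← h]
  exact Measure.restrict_mono subset_rfl (chartMeasure_le x)

end

section
variable {n : ℕ} {M : Type*} [MetricSpace M] [ChartedSpace (EuclideanSpace ℝ (Fin n)) M]
variable [RiemannianBundle (fun x : M ↦ TangentSpace (𝓡 n) x)]


theorem norm_sq_eq_gram {F : Type*} [NormedAddCommGroup F] [InnerProductSpace ℝ F]
    [FiniteDimensional ℝ F] (hF : Module.finrank ℝ F = n) {v : Fin n → F}
    (hv : LinearIndependent ℝ v) (x : F) :
    ‖x‖ ^ 2 = (fun i ↦ inner ℝ x (v i)) ⬝ᵥ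
      (Matrix.mulVec (Matrix.gram ℝ v)⁻¹ (fun i ↦ inner ℝ x (v i))) := by
  have hdet : IsUnit (Matrix.gram ℝ v).det :=
    ((Matrix.det_gram_ne_zero_iff_linearIndependent (𝕜 := ℝ)).2 hv).isUnit
  have hspan := hv.span_eq_top_of_card_eq_finrank' (by simp [hF])
  obtain ⟨w, hw⟩ := (Submodule.mem_span_range_iff_exists_fun ℝ).1
    (hspan ▸ Submodule.mem_top : x ∈ Submodule.span ℝ (Set.range v))
  have hd : (fun i ↦ inner ℝ x (v i)) = Matrix.mulVec (Matrix.gram ℝ v) w := by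
    ext i
    rw [← hw, sum_inner, Matrix.mulVec, dotProduct]
    refine Finset.sum_congr rfl fun j _ ↦ ?_
    rw [real_inner_smul_left, Matrix.gram_apply, real_inner_comm, mul_comm]
  have h1 : Matrix.mulVec (Matrix.gram ℝ v)⁻¹ (fun i ↦ inner ℝ x (v i)) = w := by
    rw [hd, Matrix.mulVec_mulVec, Matrix.nonsing_inv_mul _ hdet, Matrix.one_mulVec]
  rw [h1, ← real_inner_self_eq_norm_sq, dotProduct]
  nth_rewrite 2 [← hw]
  rw [inner_sum]
  refine Finset.sum_congr rfl fun j _ ↦ ?_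
  rw [real_inner_smul_right, mul_comm]

/-- The covariant component `⟨G, ∂ᵢ⟩` of the vector field `G` in the chart around `x₀`. -/
def coordComp (G : ∀ x : M, TangentSpace (𝓡 n) x) (x₀ : M) (i : Fin n)
    (u : EuclideanSpace ℝ (Fin n)) : ℝ :=
  inner ℝ (G ((extChartAt (𝓡 n) x₀).symm u)) (coordVec x₀ i u)

theorem coordComp_add (G G' : ∀ x : M, TangentSpace (𝓡 n) x) (x₀ : M) (i : Fin n) :
    coordComp (fun x ↦ G x + G' x) x₀ i = coordComp G x₀ i + coordComp G' x₀ i := by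
  funext u; exact inner_add_left _ _ _

theorem coordComp_smul (c : ℝ) (G : ∀ x : M, TangentSpace (𝓡 n) x) (x₀ : M) (i : Fin n) :
    coordComp (fun x ↦ c • G x) x₀ i = c • coordComp G x₀ i := by
  funext u; exact real_inner_smul_left _ _ _

/-- The vector field `G` is the distributional gradient of `f`: in each chart, the functions `f` and
`⟨G, ∂ᵢ⟩` are locally integrable and `⟨G, ∂ᵢ⟩` is the weak partial derivative `∂ᵢ f`. -/
structure IsWeakGradient (f : M → ℝ) (G : ∀ x : M, TangentSpace (𝓡 n) x) : Prop where
  locallyIntegrableOn : ∀ x₀ : M, LocallyIntegrableOn (f ∘ (extChartAt (𝓡 n) x₀).symm)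
    (extChartAt (𝓡 n) x₀).target
  locallyIntegrableOn_comp : ∀ (x₀ : M) (i : Fin n), LocallyIntegrableOn (coordComp G x₀ i)
    (extChartAt (𝓡 n) x₀).target
  integral_eq : ∀ (x₀ : M) (i : Fin n) (ψ : EuclideanSpace ℝ (Fin n) → ℝ), ContDiff ℝ ∞ ψ →
    HasCompactSupport ψ → tsupport ψ ⊆ (extChartAt (𝓡 n) x₀).target →
    ∫ u, f ((extChartAt (𝓡 n) x₀).symm u) * fderiv ℝ ψ u (EuclideanSpace.single i 1) =
      -∫ u, coordComp G x₀ i u * ψ u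

theorem integrable_mul_test {U : Set (EuclideanSpace ℝ (Fin n))}
    {h ψ : EuclideanSpace ℝ (Fin n) → ℝ} (hh : LocallyIntegrableOn h U) (hψ : Continuous ψ)
    (hc : HasCompactSupport ψ) (hs : tsupport ψ ⊆ U) : Integrable (fun u ↦ h u * ψ u) := by
  have h1 : IntegrableOn h (tsupport ψ) := hh.integrableOn_compact_subset hs hc
  have h2 : IntegrableOn (fun u ↦ h u * ψ u) (tsupport ψ) :=
    h1.mul_continuousOn hψ.continuousOn hc
  refine (integrableOn_iff_integrable_of_support_subset fun u hu ↦ ?_).1 h2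
  exact subset_tsupport ψ fun h0 ↦ hu (by simp [h0])

variable {f f' : M → ℝ} {G G' : ∀ x : M, TangentSpace (𝓡 n) x}

theorem tsupport_fderiv_apply (ψ : EuclideanSpace ℝ (Fin n) → ℝ) (v : EuclideanSpace ℝ (Fin n)) :
    tsupport (fun u ↦ fderiv ℝ ψ u v) ⊆ tsupport ψ :=
  tsupport_fderiv_apply_subset ℝ v

theorem IsWeakGradient.integrable_left (h : IsWeakGradient f G) (x₀ : M)
    {ψ : EuclideanSpace ℝ (Fin n) → ℝ} (hψ : ContDiff ℝ ∞ ψ) (hc : HasCompactSupport ψ)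
    (hs : tsupport ψ ⊆ (extChartAt (𝓡 n) x₀).target) (v : EuclideanSpace ℝ (Fin n)) :
    Integrable fun u ↦ f ((extChartAt (𝓡 n) x₀).symm u) * fderiv ℝ ψ u v :=
  integrable_mul_test (h.locallyIntegrableOn x₀)
    ((hψ.continuous_fderiv (by simp)).clm_apply continuous_const)
    (hc.fderiv_apply (𝕜 := ℝ) v)
    ((tsupport_fderiv_apply ψ v).trans hs)

theorem IsWeakGradient.integrable_right (h : IsWeakGradient f G) (x₀ : M) (i : Fin n)
    {ψ : EuclideanSpace ℝ (Fin n) → ℝ} (hψ : ContDiff ℝ ∞ ψ) (hc : HasCompactSupport ψ)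
    (hs : tsupport ψ ⊆ (extChartAt (𝓡 n) x₀).target) :
    Integrable fun u ↦ coordComp G x₀ i u * ψ u :=
  integrable_mul_test (h.locallyIntegrableOn_comp x₀ i)
    hψ.continuous hc hs

theorem IsWeakGradient.add (h : IsWeakGradient f G) (h' : IsWeakGradient f' G') :
    IsWeakGradient (fun x ↦ f x + f' x) (fun x ↦ G x + G' x) where
  locallyIntegrableOn x₀ := (h.locallyIntegrableOn x₀).add (h'.locallyIntegrableOn x₀)
  locallyIntegrableOn_comp x₀ i := by
    rw [coordComp_add]
    exact (h.locallyIntegrableOn_comp x₀ i).add (h'.locallyIntegrableOn_comp x₀ i)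
  integral_eq x₀ i ψ hψ hc hs := by
    simp only [coordComp_add, Pi.add_apply, add_mul]
    rw [integral_add (h.integrable_left x₀ hψ hc hs _) (h'.integrable_left x₀ hψ hc hs _),
      integral_add (h.integrable_right x₀ i hψ hc hs) (h'.integrable_right x₀ i hψ hc hs),
      h.integral_eq x₀ i ψ hψ hc hs, h'.integral_eq x₀ i ψ hψ hc hs]
    ring

theorem IsWeakGradient.smul (h : IsWeakGradient f G) (c : ℝ) :
    IsWeakGradient (fun x ↦ c * f x) (fun x ↦ c • G x) where
  locallyIntegrableOn x₀ := (h.locallyIntegrableOn x₀).smul c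
  locallyIntegrableOn_comp x₀ i := by
    rw [coordComp_smul]
    exact (h.locallyIntegrableOn_comp x₀ i).smul c
  integral_eq x₀ i ψ hψ hc hs := by
    simp only [coordComp_smul, Pi.smul_apply, smul_eq_mul, mul_assoc]
    rw [integral_const_mul, integral_const_mul, h.integral_eq x₀ i ψ hψ hc hs]
    ring

variable [IsManifold (𝓡 n) ∞ M]
  [IsContMDiffRiemannianBundle (𝓡 n) ∞ (EuclideanSpace ℝ (Fin n)) (fun x : M ↦ TangentSpace (𝓡 n) x)]

theorem norm_sq_eq_chart (G : ∀ x : M, TangentSpace (𝓡 n) x) (x₀ : M)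
    {u : EuclideanSpace ℝ (Fin n)} (hu : u ∈ (extChartAt (𝓡 n) x₀).target) :
    ‖G ((extChartAt (𝓡 n) x₀).symm u)‖ ^ 2 = (fun i ↦ coordComp G x₀ i u) ⬝ᵥ
      (Matrix.mulVec (gram x₀ u)⁻¹ (fun i ↦ coordComp G x₀ i u)) :=
  norm_sq_eq_gram (F := TangentSpace (𝓡 n) ((extChartAt (𝓡 n) x₀).symm u))
    ((show Module.finrank ℝ (EuclideanSpace ℝ (Fin n)) = n by simp))
    (linearIndependent_coordVec x₀ hu) _

variable [MeasurableSpace M] [BorelSpace M]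

theorem ae_chart_of_ae {P : M → Prop} (h : ∀ᵐ y ∂riemannianMeasure n M, P y) (x₀ : M) :
    ∀ᵐ u ∂(volume : Measure (EuclideanSpace ℝ (Fin n))).restrict (extChartAt (𝓡 n) x₀).target,
      P ((extChartAt (𝓡 n) x₀).symm u) := by
  have h1 := ae_of_ae_map (aemeasurable_chart_symm x₀)
    ((Measure.absolutelyContinuous_of_le (chartMeasure_le (n := n) x₀)).ae_le h)
  rw [ae_withDensity_iff' (aemeasurable_volDensity x₀)] at h1
  filter_upwards [h1, ae_restrict_mem (isOpen_extChartAt_target x₀).measurableSet] with u hu hu'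
  refine hu ?_
  simpa [volDensity] using det_gram_pos x₀ hu'

theorem ae_source_of_ae_chart {P : M → Prop} (x₀ : M)
    (h : ∀ᵐ u ∂(volume : Measure (EuclideanSpace ℝ (Fin n))).restrict (extChartAt (𝓡 n) x₀).target,
      P ((extChartAt (𝓡 n) x₀).symm u)) :
    ∀ᵐ y ∂(riemannianMeasure n M).restrict (extChartAt (𝓡 n) x₀).source, P y := by
  have hs := (isOpen_extChartAt_source (I := 𝓡 n) x₀).measurableSet
  set N := toMeasurable ((volume : Measure (EuclideanSpace ℝ (Fin n))).restrict
    (extChartAt (𝓡 n) x₀).target) {u | ¬ P ((extChartAt (𝓡 n) x₀).symm u)}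
  have hN : (volume : Measure (EuclideanSpace ℝ (Fin n))).restrict
    (extChartAt (𝓡 n) x₀).target N = 0 := by
    rw [measure_toMeasurable]; exact h
  have hNm : MeasurableSet N := measurableSet_toMeasurable _ _
  have hSm : MeasurableSet ((extChartAt (𝓡 n) x₀).source ∩ extChartAt (𝓡 n) x₀ ⁻¹' N) := by
    classical
    have h1 := (continuousOn_extChartAt (I := 𝓡 n) x₀).measurable_piecewise
      (continuousOn_const (c := (0 : EuclideanSpace ℝ (Fin n)))) hs
    have h2 := hs.inter (h1 hNm)
    convert h2 using 1
    refine Set.ext fun u ↦ and_congr_right fun hu ↦ ?_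
    rw [mem_preimage, mem_preimage, Set.piecewise_eq_of_mem _ _ _ hu]
  rw [ae_restrict_iff' hs]
  refine measure_mono_null (t := (extChartAt (𝓡 n) x₀).source ∩ extChartAt (𝓡 n) x₀ ⁻¹' N) ?_ ?_
  · intro y hy
    simp only [mem_compl_iff, mem_ofPred_eq, Classical.not_imp] at hy
    refine ⟨hy.1, subset_toMeasurable _ _ ?_⟩
    simpa only [mem_ofPred_eq, (extChartAt (𝓡 n) x₀).left_inv hy.1] using hy.2
  · have h3 := riemannianMeasure_restrict_source_le (n := n) x₀
      ((extChartAt (𝓡 n) x₀).source ∩ extChartAt (𝓡 n) x₀ ⁻¹' N)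
    rw [Measure.restrict_apply hSm, inter_eq_left.2 inter_subset_left] at h3
    refine le_antisymm (h3.trans ?_) bot_le
    rw [chartMeasure, Measure.map_apply_of_aemeasurable (aemeasurable_chart_symm x₀) hSm]
    refine (withDensity_absolutelyContinuous _ _ (?_ : (volume.restrict _) _ = 0)).le
    rw [Measure.restrict_apply' (isOpen_extChartAt_target x₀).measurableSet] at hN ⊢
    refine measure_mono_null ?_ hN
    rintro u ⟨hu1, hu2⟩
    have h4 := hu1.2
    rw [mem_preimage, (extChartAt (𝓡 n) x₀).right_inv hu2] at h4
    exact ⟨h4, hu2⟩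

theorem exists_countable_cover [SecondCountableTopology M] : ∃ s : Set M, s.Countable ∧
    ⋃ x ∈ s, (extChartAt (𝓡 n) x).source = univ :=
  TopologicalSpace.countable_cover_nhds fun x ↦ extChartAt_source_mem_nhds x

theorem ae_of_ae_chart [SecondCountableTopology M] {P : M → Prop}
    (h : ∀ x₀ : M, ∀ᵐ u ∂(volume : Measure (EuclideanSpace ℝ (Fin n))).restrict
      (extChartAt (𝓡 n) x₀).target, P ((extChartAt (𝓡 n) x₀).symm u)) :
    ∀ᵐ y ∂riemannianMeasure n M, P y := by
  obtain ⟨s, hs, hs'⟩ := exists_countable_cover (n := n) (M := M)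
  rw [← Measure.restrict_univ (μ := riemannianMeasure n M), ← hs',
    ae_restrict_biUnion_iff _ hs]
  exact fun x _ ↦ ae_source_of_ae_chart x (h x)

theorem aestronglyMeasurable_of_chart [SecondCountableTopology M] {k : M → ℝ}
    (h : ∀ x₀ : M, AEMeasurable (k ∘ (extChartAt (𝓡 n) x₀).symm)
      ((volume : Measure (EuclideanSpace ℝ (Fin n))).restrict (extChartAt (𝓡 n) x₀).target)) :
    AEStronglyMeasurable k (riemannianMeasure n M) := by
  obtain ⟨s, hs, hs'⟩ := exists_countable_cover (n := n) (M := M)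
  rw [← Measure.restrict_univ (μ := riemannianMeasure n M), ← hs', aestronglyMeasurable_iff_aemeasurable]
  have := hs.to_subtype
  rw [biUnion_eq_iUnion, aemeasurable_iUnion_iff]
  rintro ⟨x, -⟩
  obtain ⟨k', hk', hkk'⟩ := h x
  have h1 : ∀ᵐ y ∂(riemannianMeasure n M).restrict (extChartAt (𝓡 n) x).source,
      k y = k' (extChartAt (𝓡 n) x y) := by
    refine ae_source_of_ae_chart x ?_
    filter_upwards [hkk', ae_restrict_mem (isOpen_extChartAt_target x).measurableSet] with u hu hu'
    rw [(extChartAt (𝓡 n) x).right_inv hu']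
    exact hu
  exact (hk'.comp_aemeasurable ((continuousOn_extChartAt x).aemeasurable
    (isOpen_extChartAt_source x).measurableSet)).congr (h1.mono fun y hy ↦ hy.symm)

theorem aestronglyMeasurable_norm [SecondCountableTopology M]
    (h : ∀ (x₀ : M) (i : Fin n), AEMeasurable (coordComp G x₀ i)
      ((volume : Measure (EuclideanSpace ℝ (Fin n))).restrict (extChartAt (𝓡 n) x₀).target)) :
    AEStronglyMeasurable (fun x ↦ ‖G x‖) (riemannianMeasure n M) := by
  refine aestronglyMeasurable_of_chart fun x₀ ↦ ?_
  have hm := (isOpen_extChartAt_target (I := 𝓡 n) x₀).measurableSet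
  have hinv (i j : Fin n) : AEMeasurable (fun u ↦ (gram x₀ u)⁻¹ i j)
      ((volume : Measure (EuclideanSpace ℝ (Fin n))).restrict (extChartAt (𝓡 n) x₀).target) := by
    refine ContinuousOn.aemeasurable ?_ hm
    have h1 : ContinuousOn (fun u ↦ (gram x₀ u).det⁻¹ * (gram x₀ u).adjugate i j)
        (extChartAt (𝓡 n) x₀).target :=
      ((continuous_id.matrix_det.comp_continuousOn (continuousOn_gram x₀)).inv₀
        fun u hu ↦ (det_gram_pos x₀ hu).ne').mul
        ((continuous_id.matrix_adjugate.matrix_elem i j).comp_continuousOn (continuousOn_gram x₀))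
    refine h1.congr fun u hu ↦ ?_
    simp [Matrix.inv_def]
  have h2 : AEMeasurable (fun u ↦ Real.sqrt ((fun i ↦ coordComp G x₀ i u) ⬝ᵥ
      (Matrix.mulVec (gram x₀ u)⁻¹ (fun i ↦ coordComp G x₀ i u))))
      ((volume : Measure (EuclideanSpace ℝ (Fin n))).restrict (extChartAt (𝓡 n) x₀).target) := by
    simp only [dotProduct, Matrix.mulVec]
    refine Real.continuous_sqrt.measurable.comp_aemeasurable ?_
    refine Finset.aemeasurable_fun_sum _ fun i _ ↦ (h x₀ i).mul ?_
    exact Finset.aemeasurable_fun_sum _ fun j _ ↦ (hinv i j).mul (h x₀ j)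
  refine h2.congr ?_
  filter_upwards [ae_restrict_mem hm] with u hu
  rw [← norm_sq_eq_chart G x₀ hu, Real.sqrt_sq (norm_nonneg _)]
  rfl

theorem IsWeakGradient.aestronglyMeasurable_norm [SecondCountableTopology M]
    (h : IsWeakGradient f G) : AEStronglyMeasurable (fun x ↦ ‖G x‖) (riemannianMeasure n M) :=
  RiemannianSobolev.aestronglyMeasurable_norm fun x₀ i ↦
    (h.locallyIntegrableOn_comp x₀ i).aestronglyMeasurable.aemeasurable

theorem IsWeakGradient.congr (h : IsWeakGradient f G) (hf : f =ᵐ[riemannianMeasure n M] f') :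
    IsWeakGradient f' G := by
  have h1 (x₀ : M) := ae_chart_of_ae hf x₀
  refine ⟨fun x₀ ↦ ?_, h.locallyIntegrableOn_comp, fun x₀ i ψ hψ hc hs ↦ ?_⟩
  · intro u hu
    obtain ⟨s, hs, hs'⟩ := h.locallyIntegrableOn x₀ u hu
    refine ⟨s ∩ (extChartAt (𝓡 n) x₀).target, Filter.inter_mem hs self_mem_nhdsWithin, ?_⟩
    refine (hs'.mono_set inter_subset_left).congr ?_
    exact ae_restrict_of_ae_restrict_of_subset inter_subset_right (h1 x₀)
  · rw [← h.integral_eq x₀ i ψ hψ hc hs]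
    refine integral_congr_ae ?_
    have h2 := (ae_restrict_iff' (isOpen_extChartAt_target x₀).measurableSet).1 (h1 x₀)
    filter_upwards [h2] with u hu
    by_cases hu' : u ∈ (extChartAt (𝓡 n) x₀).target
    · simp only [hu hu']
    · have : fderiv ℝ ψ u (EuclideanSpace.single i 1) = 0 := by
        by_contra h0
        exact hu' (hs (tsupport_fderiv_apply ψ _ (subset_tsupport _ h0)))
      simp only [this, mul_zero]

theorem IsWeakGradient.unique [SecondCountableTopology M] (h : IsWeakGradient f G)
    (h' : IsWeakGradient f G') : ∀ᵐ x ∂riemannianMeasure n M, G x = G' x := by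
  refine ae_of_ae_chart fun x₀ ↦ ?_
  have hU := isOpen_extChartAt_target (I := 𝓡 n) x₀
  have key (i : Fin n) : ∀ᵐ u ∂(volume : Measure (EuclideanSpace ℝ (Fin n))).restrict
      (extChartAt (𝓡 n) x₀).target, coordComp G x₀ i u = coordComp G' x₀ i u := by
    rw [ae_restrict_iff' hU.measurableSet]
    have := hU.ae_eq_zero_of_integral_contDiff_smul_eq_zero
      ((h.locallyIntegrableOn_comp x₀ i).sub (h'.locallyIntegrableOn_comp x₀ i))
      (fun ψ hψ hc hs ↦ ?_)
    · filter_upwards [this] with u hu hu'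
      exact sub_eq_zero.1 (hu hu')
    · have e := h.integral_eq x₀ i ψ hψ hc hs
      rw [h'.integral_eq x₀ i ψ hψ hc hs, neg_inj] at e
      simp only [Pi.sub_apply, smul_eq_mul, mul_sub]
      simp only [mul_comm (ψ _)]
      rw [integral_sub (h.integrable_right x₀ i hψ hc hs) (h'.integrable_right x₀ i hψ hc hs), e,
        sub_self]
  filter_upwards [ae_all_iff.2 key, ae_restrict_mem hU.measurableSet] with u hu hu'
  have h3 := norm_sq_eq_chart (fun x ↦ G x + (-1 : ℝ) • G' x) x₀ hu'
  have h4 : (fun i ↦ coordComp (fun x ↦ G x + (-1 : ℝ) • G' x) x₀ i u) = 0 := by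
    ext i
    rw [coordComp_add, coordComp_smul]
    simp [hu i]
  rw [h4, zero_dotProduct, sq_eq_zero_iff, norm_eq_zero, neg_one_smul, ← sub_eq_add_neg] at h3
  exact sub_eq_zero.1 h3

theorem coordComp_grad (hf : ContMDiff (𝓡 n) 𝓘(ℝ, ℝ) ∞ f) (x₀ : M) (i : Fin n)
    {u : EuclideanSpace ℝ (Fin n)} (hu : u ∈ (extChartAt (𝓡 n) x₀).target) :
    coordComp (grad n f) x₀ i u =
      fderiv ℝ (f ∘ (extChartAt (𝓡 n) x₀).symm) u (EuclideanSpace.single i 1) := by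
  have h1 : HasMFDerivAt 𝓘(ℝ, EuclideanSpace ℝ (Fin n)) (𝓡 n) (extChartAt (𝓡 n) x₀).symm u
      (mfderiv 𝓘(ℝ, EuclideanSpace ℝ (Fin n)) (𝓡 n) (extChartAt (𝓡 n) x₀).symm u) :=
    ((contMDiffOn_extChartAt_symm (I := 𝓡 n) (n := ∞) x₀).mdifferentiableOn (by simp) _ hu
      |>.mdifferentiableAt ((isOpen_extChartAt_target x₀).mem_nhds hu)).hasMFDerivAt
  let D₁ : EuclideanSpace ℝ (Fin n) →L[ℝ] ℝ :=
    mfderiv (𝓡 n) 𝓘(ℝ, ℝ) f ((extChartAt (𝓡 n) x₀).symm u)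
  let D₂ : EuclideanSpace ℝ (Fin n) →L[ℝ] EuclideanSpace ℝ (Fin n) :=
    mfderiv 𝓘(ℝ, EuclideanSpace ℝ (Fin n)) (𝓡 n) (extChartAt (𝓡 n) x₀).symm u
  have h2 : HasFDerivAt (f ∘ (extChartAt (𝓡 n) x₀).symm) (D₁.comp D₂) u :=
    hasMFDerivAt_iff_hasFDerivAt.1 ((hf.mdifferentiable (by simp)
      ((extChartAt (𝓡 n) x₀).symm u)).hasMFDerivAt.comp u h1)
  have h3 := congrArg (fun L : EuclideanSpace ℝ (Fin n) →L[ℝ] ℝ ↦ L (EuclideanSpace.single i 1))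
    h2.fderiv
  have : CompleteSpace (TangentSpace (𝓡 n) ((extChartAt (𝓡 n) x₀).symm u)) :=
    FiniteDimensional.complete ℝ _
  refine Eq.trans ?_ h3.symm
  exact InnerProductSpace.toDual_symm_apply

theorem aestronglyMeasurable_norm_grad [SecondCountableTopology M]
    (hf : ContMDiff (𝓡 n) 𝓘(ℝ, ℝ) ∞ f) :
    AEStronglyMeasurable (fun x ↦ ‖grad n f x‖) (riemannianMeasure n M) := by
  refine aestronglyMeasurable_norm fun x₀ i ↦ ?_
  have hU := isOpen_extChartAt_target (I := 𝓡 n) x₀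
  have h1 : ContDiffOn ℝ ∞ (f ∘ (extChartAt (𝓡 n) x₀).symm) (extChartAt (𝓡 n) x₀).target :=
    (hf.comp_contMDiffOn (contMDiffOn_extChartAt_symm x₀)).contDiffOn
  refine ContinuousOn.aemeasurable ?_ hU.measurableSet
  refine ContinuousOn.congr ?_ fun u hu ↦ coordComp_grad hf x₀ i hu
  exact (h1.continuousOn_fderiv_of_isOpen hU (by simp)).clm_apply continuousOn_const

theorem grad_add (hf : ContMDiff (𝓡 n) 𝓘(ℝ, ℝ) ∞ f) (hf' : ContMDiff (𝓡 n) 𝓘(ℝ, ℝ) ∞ f') (x : M) :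
    grad n (f + f') x = grad n f x + grad n f' x := by
  have : CompleteSpace (TangentSpace (𝓡 n) x) := FiniteDimensional.complete ℝ _
  exact (congrArg (InnerProductSpace.toDual ℝ (TangentSpace (𝓡 n) x)).symm
    (mfderiv_add (hf.mdifferentiable (by simp) x) (hf'.mdifferentiable (by simp) x))).trans
    (map_add (InnerProductSpace.toDual ℝ (TangentSpace (𝓡 n) x)).symm _ _)

theorem grad_smul (c : ℝ) (hf : ContMDiff (𝓡 n) 𝓘(ℝ, ℝ) ∞ f) (x : M) :
    grad n (c • f) x = c • grad n f x := by
  have : CompleteSpace (TangentSpace (𝓡 n) x) := FiniteDimensional.complete ℝ _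
  exact (congrArg (InnerProductSpace.toDual ℝ (TangentSpace (𝓡 n) x)).symm
    (const_smul_mfderiv (hf.mdifferentiable (by simp) x) c)).trans
    (map_smulₛₗ (InnerProductSpace.toDual ℝ (TangentSpace (𝓡 n) x)).symm _ _)

end

section
variable {n : ℕ} {M : Type*} [MetricSpace M] [ChartedSpace (EuclideanSpace ℝ (Fin n)) M]
variable [RiemannianBundle (fun x : M ↦ TangentSpace (𝓡 n) x)]
variable {f f' : M → ℝ} {G G' : ∀ x : M, TangentSpace (𝓡 n) x}

variable [MeasurableSpace M]

variable (n) in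
/-- `V ∈ RH_{q,loc}`: `V` is a weight (locally integrable and non-negative) and
`(⨍_B V ^ q dμ) ^ (1/q) ≤ C ⨍_B V dμ` for all balls `B` of radius less than some `r₀ > 0`. -/
def IsLocalReverseHolder (q : ℝ) (V : M → ℝ) : Prop :=
  LocallyIntegrable V (riemannianMeasure n M) ∧ (∀ᵐ x ∂riemannianMeasure n M, 0 ≤ V x) ∧
  ∃ C : ℝ≥0, ∃ r₀ : ℝ, 0 < r₀ ∧ ∀ (x : M) (r : ℝ), 0 < r → r < r₀ →
    (⨍⁻ y in Metric.ball x r, ENNReal.ofReal (V y) ^ q ∂riemannianMeasure n M) ^ (1 / q) ≤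
      C * ⨍⁻ y in Metric.ball x r, ENNReal.ofReal (V y) ∂riemannianMeasure n M

/-- `‖f‖_p + ‖ |G| ‖_p + ‖V f‖_p`. -/
def sobolevNorm (V : M → ℝ) (p : ℝ≥0∞) (f : M → ℝ) (G : ∀ x : M, TangentSpace (𝓡 n) x) : ℝ :=
  (eLpNorm f p (riemannianMeasure n M)).toReal +
  (eLpNorm (fun x ↦ ‖G x‖) p (riemannianMeasure n M)).toReal +
  (eLpNorm (fun x ↦ V x * f x) p (riemannianMeasure n M)).toReal

open Classical in
/-- The distributional gradient of `f` (`0` if there is none). It is unique almost everywhere, see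
`IsWeakGradient.unique`. -/
def weakGrad (f : M → ℝ) : ∀ x : M, TangentSpace (𝓡 n) x :=
  if h : ∃ G : (∀ x : M, TangentSpace (𝓡 n) x), IsWeakGradient f G then h.choose else fun _ ↦ 0

theorem IsWeakGradient.weakGrad_spec (h : IsWeakGradient f G) :
    IsWeakGradient f (weakGrad (n := n) f) := by
  have h' : ∃ G : (∀ x : M, TangentSpace (𝓡 n) x), IsWeakGradient f G := ⟨G, h⟩
  rw [weakGrad, dif_pos h']
  exact h'.choose_spec

/-- `f`, `|G|` and `V f` are in `L_p`. -/
structure MemSobolev (V : M → ℝ) (p : ℝ≥0∞) (f : M → ℝ) (G : ∀ x : M, TangentSpace (𝓡 n) x) :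
    Prop where
  memLp : MemLp f p (riemannianMeasure n M)
  memLp_grad : MemLp (fun x ↦ ‖G x‖) p (riemannianMeasure n M)
  memLp_mul : MemLp (fun x ↦ V x * f x) p (riemannianMeasure n M)

variable {V : M → ℝ} {p : ℝ≥0∞}

theorem MemSobolev.add (h : MemSobolev V p f G) (h' : MemSobolev V p f' G')
    (hm : AEStronglyMeasurable (fun x ↦ ‖G x + G' x‖) (riemannianMeasure n M)) :
    MemSobolev V p (f + f') (fun x ↦ G x + G' x) := by
  refine ⟨h.memLp.add h'.memLp, (h.memLp_grad.add h'.memLp_grad).mono hm ?_, ?_⟩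
  · refine Filter.Eventually.of_forall fun x ↦ ?_
    rw [norm_norm, Pi.add_apply]
    exact (norm_add_le _ _).trans (le_abs_self _)
  · simpa only [Pi.add_apply, mul_add] using! h.memLp_mul.add h'.memLp_mul

theorem MemSobolev.smul (h : MemSobolev V p f G) (c : ℝ) :
    MemSobolev V p (c • f) (fun x ↦ c • G x) := by
  refine ⟨h.memLp.const_smul c, ?_, ?_⟩
  · simpa only [norm_smul] using! h.memLp_grad.const_mul ‖c‖
  · refine (h.memLp_mul.const_mul c).ae_eq (Filter.Eventually.of_forall fun x ↦ ?_)
    simp only [Pi.smul_apply, smul_eq_mul]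
    ring

theorem MemSobolev.congr (h : MemSobolev V p f G) (hf : f =ᵐ[riemannianMeasure n M] f')
    (hG : ∀ᵐ x ∂riemannianMeasure n M, G x = G' x) : MemSobolev V p f' G' := by
  refine ⟨h.memLp.ae_eq hf, h.memLp_grad.ae_eq ?_, h.memLp_mul.ae_eq ?_⟩
  · filter_upwards [hG] with x hx; rw [hx]
  · filter_upwards [hf] with x hx; rw [hx]

theorem sobolevNorm_congr (hf : f =ᵐ[riemannianMeasure n M] f')
    (hG : ∀ᵐ x ∂riemannianMeasure n M, G x = G' x) :
    sobolevNorm V p f G = sobolevNorm V p f' G' := by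
  have e1 : eLpNorm f p (riemannianMeasure n M) = eLpNorm f' p (riemannianMeasure n M) :=
    eLpNorm_congr_ae hf
  have e2 : eLpNorm (fun x ↦ ‖G x‖) p (riemannianMeasure n M) =
      eLpNorm (fun x ↦ ‖G' x‖) p (riemannianMeasure n M) := by
    refine eLpNorm_congr_ae ?_
    filter_upwards [hG] with x hx; rw [hx]
  have e3 : eLpNorm (fun x ↦ V x * f x) p (riemannianMeasure n M) =
      eLpNorm (fun x ↦ V x * f' x) p (riemannianMeasure n M) := by
    refine eLpNorm_congr_ae ?_
    filter_upwards [hf] with x hx; rw [hx]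
  unfold sobolevNorm
  rw [e1, e2, e3]

theorem sobolevNorm_add_le [Fact (1 ≤ p)] (h : MemSobolev V p f G) (h' : MemSobolev V p f' G') :
    sobolevNorm V p (f + f') (fun x ↦ G x + G' x) ≤ sobolevNorm V p f G + sobolevNorm V p f' G' := by
  have hp : 1 ≤ p := Fact.out
  have tri {a b : M → ℝ} (ha : MemLp a p (riemannianMeasure n M))
      (hb : MemLp b p (riemannianMeasure n M)) :
      (eLpNorm (a + b) p (riemannianMeasure n M)).toReal ≤
        (eLpNorm a p (riemannianMeasure n M)).toReal +
        (eLpNorm b p (riemannianMeasure n M)).toReal := by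
    rw [← ENNReal.toReal_add ha.2.ne hb.2.ne]
    exact ENNReal.toReal_mono (ENNReal.add_ne_top.2 ⟨ha.2.ne, hb.2.ne⟩) (eLpNorm_add_le ha.1 hb.1 hp)
  have h1 := tri h.memLp h'.memLp
  have h2 := tri h.memLp_grad h'.memLp_grad
  have h3 := tri h.memLp_mul h'.memLp_mul
  have h2' : (eLpNorm (fun x ↦ ‖G x + G' x‖) p (riemannianMeasure n M)).toReal ≤
      (eLpNorm ((fun x ↦ ‖G x‖) + fun x ↦ ‖G' x‖) p (riemannianMeasure n M)).toReal := by
    refine ENNReal.toReal_mono (h.memLp_grad.add h'.memLp_grad).2.ne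
      (eLpNorm_mono_real fun x ↦ ?_)
    rw [norm_norm]
    exact norm_add_le _ _
  have h3' : (fun x ↦ V x * (f + f') x) = (fun x ↦ V x * f x) + fun x ↦ V x * f' x := by
    funext x; simp [mul_add]
  unfold sobolevNorm
  rw [h3']
  linarith

theorem sobolevNorm_smul (c : ℝ) :
    sobolevNorm V p (c • f) (fun x ↦ c • G x) = ‖c‖ * sobolevNorm V p f G := by
  have h (a : M → ℝ) : (eLpNorm (c • a) p (riemannianMeasure n M)).toReal =
      ‖c‖ * (eLpNorm a p (riemannianMeasure n M)).toReal := by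
    rw [eLpNorm_const_smul, ENNReal.toReal_mul, toReal_enorm]
  have h2 : eLpNorm (fun x ↦ ‖c • G x‖) p (riemannianMeasure n M) =
      eLpNorm (c • fun x ↦ ‖G x‖) p (riemannianMeasure n M) :=
    eLpNorm_congr_norm_ae (Filter.Eventually.of_forall fun x ↦ by simp [norm_smul])
  have h3 : (fun x ↦ V x * (c • f) x) = c • fun x ↦ V x * f x := by
    funext x; simp only [Pi.smul_apply, smul_eq_mul]; ring
  unfold sobolevNorm
  rw [h2, h3, h, h, h]
  ring

variable [IsManifold (𝓡 n) ∞ M]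
  [IsContMDiffRiemannianBundle (𝓡 n) ∞ (EuclideanSpace ℝ (Fin n)) (fun x : M ↦ TangentSpace (𝓡 n) x)]
  [BorelSpace M] [SecondCountableTopology M]

variable (n V p) in
/-- The space `E¹_{p,V}` of smooth `f` with `f`, `|∇f|` and `V f` in `L_p`, as a subspace of the
space of functions. -/
def smoothSubmodule : Submodule ℝ (M → ℝ) where
  carrier := {f | ContMDiff (𝓡 n) 𝓘(ℝ, ℝ) ∞ f ∧ MemSobolev V p f (grad n f)}
  zero_mem' := by
    have h0 : ContMDiff (𝓡 n) 𝓘(ℝ, ℝ) ∞ (0 : M → ℝ) := contMDiff_const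
    have h1 : grad n (0 : M → ℝ) = fun x ↦ 0 := by
      funext x
      have := grad_smul (0 : ℝ) h0 x
      rwa [zero_smul, zero_smul] at this
    refine ⟨h0, ?_⟩
    rw [h1]
    refine ⟨MemLp.zero, ?_, ?_⟩ <;> simp
  add_mem' := by
    rintro f f' ⟨hf, h⟩ ⟨hf', h'⟩
    have h1 : grad n (f + f') = fun x ↦ grad n f x + grad n f' x := funext fun x ↦ grad_add hf hf' x
    refine ⟨hf.add hf', ?_⟩
    have hm := aestronglyMeasurable_norm_grad (hf.add hf')
    rw [h1] at hm ⊢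
    exact h.add h' hm
  smul_mem' := by
    rintro c f ⟨hf, h⟩
    have h1 : grad n (c • f) = fun x ↦ c • grad n f x := funext fun x ↦ grad_smul c hf x
    refine ⟨(contDiff_const_smul (n := ∞) (F := ℝ) c).contMDiff.comp hf, ?_⟩
    rw [h1]
    exact h.smul c

variable (n V p) in
/-- The space `E¹_{p,V}`, with the norm `‖f‖_p + ‖ |∇f| ‖_p + ‖V f‖_p`. -/
def SmoothSobolev : Type _ := smoothSubmodule n V p

instance : AddCommGroup (SmoothSobolev n V p) := inferInstanceAs (AddCommGroup (smoothSubmodule n V p))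

instance : Module ℝ (SmoothSobolev n V p) := inferInstanceAs (Module ℝ (smoothSubmodule n V p))

/-- The function underlying an element of `E¹_{p,V}`. -/
def SmoothSobolev.toFun : SmoothSobolev n V p →ₗ[ℝ] (M → ℝ) := (smoothSubmodule n V p).subtype

theorem SmoothSobolev.contMDiff (f : SmoothSobolev n V p) : ContMDiff (𝓡 n) 𝓘(ℝ, ℝ) ∞ f.toFun :=
  f.2.1

theorem SmoothSobolev.memSobolev (f : SmoothSobolev n V p) :
    MemSobolev V p f.toFun (grad n f.toFun) := f.2.2

theorem SmoothSobolev.norm_smul_aux (c : ℝ) (f : SmoothSobolev n V p) :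
    sobolevNorm V p (c • f).toFun (grad n (c • f).toFun) =
      ‖c‖ * sobolevNorm V p f.toFun (grad n f.toFun) := by
  have h1 : grad n (c • f.toFun) = fun x ↦ c • grad n f.toFun x :=
    funext fun x ↦ grad_smul c f.contMDiff x
  rw [map_smul, h1, sobolevNorm_smul]

instance [Fact (1 ≤ p)] : SeminormedAddCommGroup (SmoothSobolev n V p) :=
  AddGroupSeminorm.toSeminormedAddCommGroup
    { toFun := fun f ↦ sobolevNorm V p f.toFun (grad n f.toFun)
      map_zero' := by simpa using SmoothSobolev.norm_smul_aux 0 (0 : SmoothSobolev n V p)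
      add_le' := fun f f' ↦ by
        have h1 : grad n (f.toFun + f'.toFun) = fun x ↦ grad n f.toFun x + grad n f'.toFun x :=
          funext fun x ↦ grad_add f.contMDiff f'.contMDiff x
        rw [map_add, h1]
        exact sobolevNorm_add_le f.memSobolev f'.memSobolev
      neg' := fun f ↦ by simpa using SmoothSobolev.norm_smul_aux (-1) f }

theorem SmoothSobolev.norm_def [Fact (1 ≤ p)] (f : SmoothSobolev n V p) :
    ‖f‖ = sobolevNorm V p f.toFun (grad n f.toFun) := rfl

instance [Fact (1 ≤ p)] : NormedSpace ℝ (SmoothSobolev n V p) where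
  norm_smul_le c f := (SmoothSobolev.norm_smul_aux c f).le

variable (n V p) in
/-- The Sobolev space `W¹_{p,V}`, the completion of `E¹_{p,V}`. -/
abbrev SobolevW [Fact (1 ≤ p)] : Type _ := UniformSpace.Completion (SmoothSobolev n V p)

variable (n V p) in
/-- The space `H¹_{p,V}` of `f ∈ L_p` whose distributional gradient satisfies `|∇f| ∈ L_p`, and with
`V f ∈ L_p`, as a subspace of `L_p`. -/
def weakSubmodule : Submodule ℝ (Lp ℝ p (riemannianMeasure n M)) where
  carrier := {f | ∃ G : (∀ x : M, TangentSpace (𝓡 n) x),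
    IsWeakGradient (f : M → ℝ) G ∧ MemSobolev V p (f : M → ℝ) G}
  zero_mem' := by
    have h0 : IsWeakGradient (fun _ : M ↦ (0 : ℝ)) (fun x ↦ (0 : TangentSpace (𝓡 n) x)) := by
      have hc (x₀ : M) (i : Fin n) : coordComp (fun x ↦ (0 : TangentSpace (𝓡 n) x)) x₀ i = 0 := by
        funext u; exact inner_zero_left _
      refine ⟨fun x₀ ↦ locallyIntegrable_zero.locallyIntegrableOn _, fun x₀ i ↦ ?_,
        fun x₀ i ψ _ _ _ ↦ ?_⟩
      · rw [hc]; exact locallyIntegrable_zero.locallyIntegrableOn _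
      · simp [hc]
    have h1 : MemSobolev V p (fun _ : M ↦ (0 : ℝ)) (fun x ↦ (0 : TangentSpace (𝓡 n) x)) := by
      refine ⟨MemLp.zero, ?_, ?_⟩ <;> simp
    have h2 := (Lp.coeFn_zero ℝ p (riemannianMeasure n M)).symm
    exact ⟨_, h0.congr h2, h1.congr h2 (Filter.Eventually.of_forall fun _ ↦ rfl)⟩
  add_mem' := by
    rintro f f' ⟨G, hG, h⟩ ⟨G', hG', h'⟩
    have h2 := (Lp.coeFn_add f f').symm
    exact ⟨_, (hG.add hG').congr h2, (h.add h' (hG.add hG').aestronglyMeasurable_norm).congr h2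
      (Filter.Eventually.of_forall fun _ ↦ rfl)⟩
  smul_mem' := by
    rintro c f ⟨G, hG, h⟩
    have h2 := (Lp.coeFn_smul c f).symm
    exact ⟨_, (hG.smul c).congr h2, (h.smul c).congr h2 (Filter.Eventually.of_forall fun _ ↦ rfl)⟩

variable (n V p) in
/-- The space `H¹_{p,V}`, with the norm `‖f‖_p + ‖ |∇f| ‖_p + ‖V f‖_p`, where `∇f` is the
distributional gradient. -/
def SobolevH : Type _ := weakSubmodule n V p

instance : AddCommGroup (SobolevH n V p) := inferInstanceAs (AddCommGroup (weakSubmodule n V p))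

instance : Module ℝ (SobolevH n V p) := inferInstanceAs (Module ℝ (weakSubmodule n V p))

/-- The element of `L_p` underlying an element of `H¹_{p,V}`. -/
def SobolevH.toLp : SobolevH n V p →ₗ[ℝ] Lp ℝ p (riemannianMeasure n M) :=
  (weakSubmodule n V p).subtype

theorem SobolevH.isWeakGradient (f : SobolevH n V p) :
    IsWeakGradient (f.toLp : M → ℝ) (weakGrad (n := n) (f.toLp : M → ℝ)) := by
  obtain ⟨G, hG, -⟩ := f.2
  exact hG.weakGrad_spec

theorem SobolevH.memSobolev (f : SobolevH n V p) :
    MemSobolev V p (f.toLp : M → ℝ) (weakGrad (n := n) (f.toLp : M → ℝ)) := by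
  obtain ⟨G, hG, h⟩ := f.2
  exact h.congr (Filter.EventuallyEq.refl _ _) (hG.unique hG.weakGrad_spec)

theorem SobolevH.norm_smul_aux (c : ℝ) (f : SobolevH n V p) :
    sobolevNorm V p ((c • f).toLp : M → ℝ) (weakGrad (n := n) ((c • f).toLp : M → ℝ)) =
      ‖c‖ * sobolevNorm V p (f.toLp : M → ℝ) (weakGrad (n := n) (f.toLp : M → ℝ)) := by
  rw [← sobolevNorm_smul]
  have h := Lp.coeFn_smul c f.toLp
  rw [← map_smul] at h
  exact sobolevNorm_congr h
    ((c • f).isWeakGradient.unique ((f.isWeakGradient.smul c).congr h.symm))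

instance [Fact (1 ≤ p)] : NormedAddCommGroup (SobolevH n V p) :=
  AddGroupNorm.toNormedAddCommGroup
    { toFun := fun f ↦ sobolevNorm V p (f.toLp : M → ℝ) (weakGrad (n := n) (f.toLp : M → ℝ))
      map_zero' := by simpa using SobolevH.norm_smul_aux 0 (0 : SobolevH n V p)
      add_le' := fun f f' ↦ by
        have h := Lp.coeFn_add f.toLp f'.toLp
        rw [← map_add] at h
        refine (sobolevNorm_congr h ((f + f').isWeakGradient.unique
          ((f.isWeakGradient.add f'.isWeakGradient).congr h.symm))).trans_le ?_
        exact sobolevNorm_add_le f.memSobolev f'.memSobolev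
      neg' := fun f ↦ by simpa using SobolevH.norm_smul_aux (-1) f
      eq_zero_of_map_eq_zero' := fun f hf ↦ by
        have h1 : (eLpNorm (f.toLp : M → ℝ) p (riemannianMeasure n M)).toReal = 0 := by
          refine le_antisymm ?_ ENNReal.toReal_nonneg
          rw [← hf]
          unfold sobolevNorm
          rw [add_assoc]
          exact le_add_of_nonneg_right (add_nonneg ENNReal.toReal_nonneg ENNReal.toReal_nonneg)
        have h2 : f.toLp = 0 := by
          rw [← Lp.norm_def] at h1
          exact norm_eq_zero.1 h1
        exact Subtype.ext h2 }

theorem SobolevH.norm_def [Fact (1 ≤ p)] (f : SobolevH n V p) :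
    ‖f‖ = sobolevNorm V p (f.toLp : M → ℝ) (weakGrad (n := n) (f.toLp : M → ℝ)) := rfl

instance [Fact (1 ≤ p)] : NormedSpace ℝ (SobolevH n V p) where
  norm_smul_le c f := (SobolevH.norm_smul_aux c f).le

end

end RiemannianSobolev

end

/-! The reverse Hölder inequality enters only through its local consequence `V ∈ L_{p,loc}`
(`IsLocalReverseHolder.memLp`): every small ball has finite measure and finite average of `V`, hence
finite average of `V ^ q`. In particular smooth functions with compact support lie in `H¹_{p,V}`.

Density is first shown for products `η f` with `η` smooth and supported in a chart, where the
problem becomes Euclidean. Mollifications `h_j` of `h = η f` converge to `h` with their derivatives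
in `L_p`, but for the potential term only almost everywhere convergence is available, and `V h_j`
need not be dominated. The remedy is the smooth bounded truncation `T_k(t) = k arctan (t / k)`. For
fixed `k`, `V T_k(h_j)` is dominated by a multiple of `k V`, so that `T_k(h_j)` converges to
`T_k(h)` also in the norm with potential (`exists_contDiff_approx_truncation`); as `k → ∞`,
`V T_k(h)` is dominated by `V h ∈ L_p` (`exists_contDiff_approx`). Truncating after mollifying, only
the chain rule for smooth functions is needed. A finite smooth partition of unity extends this to
every `η` with compact support (`smul_mem_closure_of_hasCompactSupport`).

Completeness is used to exhaust `M`. By the theorem of Hopf and Rinow closed balls are compact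
(`properSpace_of_complete`), so the functions `max 0 (1 - d(o, x) / (j + 1))` are Lipschitz cutoffs
with compact support. They are smoothed by mollification in charts in which the metric is comparable
to a constant one, at the cost of a constant factor in the gradient
(`exists_smooth_approx_of_lipschitzWith`). The resulting `χ_j` tend to `1`, their gradients tend to
`0` uniformly, and therefore `χ_j f → f` in `H¹_{p,V}` (`tendsto_sobolevNorm_smul_sub`).

Finally `H¹_{p,V}` is complete, because the distributional gradient is a closed operator
(`SobolevH.completeSpace`), and the isometric inclusion of `E¹_{p,V}` has dense range, since that
range contains the test functions. It therefore extends to an isometry of the completion onto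
`H¹_{p,V}`. -/

noncomputable section

namespace RiemannianSobolev

set_option linter.unusedSectionVars false

/-! ### Dominated convergence in `L_p` -/

section Lebesgue
open Filter

/-- Dominated convergence in `L_p`, for a dominating function in `L_p`. -/
theorem tendsto_eLpNorm_zero_of_dominated {α : Type*} [MeasurableSpace α] {μ : Measure α}
    {p : ℝ≥0∞} (hp0 : p ≠ 0) (hp : p ≠ ⊤) {F : ℕ → α → ℝ} {b : α → ℝ} (hb : MemLp b p μ)
    (hF : ∀ j, AEStronglyMeasurable (F j) μ) (hFb : ∀ j, ∀ᵐ x ∂μ, |F j x| ≤ b x)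
    (hlim : ∀ᵐ x ∂μ, Tendsto (fun j ↦ F j x) atTop (𝓝 0)) :
    Tendsto (fun j ↦ eLpNorm (F j) p μ) atTop (𝓝 0) := by
  have hpos : 0 < p.toReal := ENNReal.toReal_pos hp0 hp
  simp only [eLpNorm_eq_lintegral_rpow_enorm_toReal hp0 hp]
  have h1 : Tendsto (fun j ↦ ∫⁻ x, ‖F j x‖ₑ ^ p.toReal ∂μ) atTop (𝓝 (∫⁻ _, 0 ∂μ)) := by
    refine tendsto_lintegral_of_dominated_convergence' (fun x ↦ ‖b x‖ₑ ^ p.toReal)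
      (fun j ↦ (hF j).enorm.pow_const _) (fun j ↦ ?_) ?_ ?_
    · filter_upwards [hFb j] with x hx
      refine ENNReal.rpow_le_rpow ?_ hpos.le
      refine enorm_le_iff_norm_le.2 ?_
      rw [Real.norm_eq_abs]
      exact hx.trans (le_abs_self _)
    · exact (lintegral_rpow_enorm_lt_top_of_eLpNorm_lt_top hp0 hp hb.2).ne
    · filter_upwards [hlim] with x hx
      have h2 : Tendsto (fun j ↦ ‖F j x‖ₑ) atTop (𝓝 0) := by simpa using hx.enorm
      have := (ENNReal.continuous_rpow_const (y := p.toReal)).tendsto 0 |>.comp h2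
      simpa [ENNReal.zero_rpow_of_pos hpos] using! this
  have h3 := (ENNReal.continuous_rpow_const (y := 1 / p.toReal)).tendsto _ |>.comp h1
  simpa [ENNReal.zero_rpow_of_pos (inv_pos.2 hpos)] using! h3

end Lebesgue

/-! ### Mollification -/

section Mollification
open Filter ContinuousLinearMap
variable {E : Type*} [NormedAddCommGroup E] [NormedSpace ℝ E] [FiniteDimensional ℝ E]
  [MeasurableSpace E] [BorelSpace E] {μ : Measure E} [μ.IsAddHaarMeasure]

variable (μ) in
/-- The mollification of `h` by the normalized bump function `φ`. -/
def mollify (φ : ContDiffBump (0 : E)) (h : E → ℝ) : E → ℝ :=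
  convolution (φ.normed μ) h (lsmul ℝ ℝ) μ

theorem mollify_apply (φ : ContDiffBump (0 : E)) (h : E → ℝ) (x : E) :
    mollify μ φ h x = ∫ t, φ.normed μ t * h (x - t) ∂μ := rfl

theorem mollify_apply_swap (φ : ContDiffBump (0 : E)) (h : E → ℝ) (x : E) :
    mollify μ φ h x = ∫ t, φ.normed μ (x - t) * h t ∂μ := by
  rw [mollify, convolution_eq_swap]; rfl

theorem contDiff_mollify (φ : ContDiffBump (0 : E)) {h : E → ℝ} (hh : LocallyIntegrable h μ) :
    ContDiff ℝ ∞ (mollify μ φ h) :=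
  φ.hasCompactSupport_normed.contDiff_convolution_left _ φ.contDiff_normed hh

theorem integrable_normed_mul (φ : ContDiffBump (0 : E)) {h : E → ℝ}
    (hh : LocallyIntegrable h μ) (x : E) : Integrable (fun t ↦ φ.normed μ t * h (x - t)) μ := by
  have := φ.hasCompactSupport_normed (μ := μ) |>.convolutionExists_left (lsmul ℝ ℝ)
    φ.continuous_normed hh x
  exact this

theorem mollify_sub (φ : ContDiffBump (0 : E)) {h h' : E → ℝ} (hh : LocallyIntegrable h μ)
    (hh' : LocallyIntegrable h' μ) : mollify μ φ (h - h') = mollify μ φ h - mollify μ φ h' := by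
  funext x
  simp only [mollify_apply, Pi.sub_apply, mul_sub]
  exact integral_sub (integrable_normed_mul φ hh x) (integrable_normed_mul φ hh' x)

/-- Jensen's inequality for the probability density `φ.normed μ`, integrated over all
translations. -/
theorem eLpNorm_mollify_le {p : ℝ≥0∞} (hp1 : 1 ≤ p) (hp : p ≠ ⊤) (φ : ContDiffBump (0 : E))
    {h : E → ℝ} (hh : AEStronglyMeasurable h μ) :
    eLpNorm (mollify μ φ h) p μ ≤ eLpNorm h p μ := by
  obtain ⟨h', hh', hae⟩ := hh
  have e1 : mollify μ φ h = mollify μ φ h' := by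
    rw [mollify, convolution_congr _ EventuallyEq.rfl hae]; rfl
  rw [e1, eLpNorm_congr_ae hae]
  have hp0 : p ≠ 0 := (zero_lt_one.trans_le hp1).ne'
  have hpos : 0 < p.toReal := ENNReal.toReal_pos hp0 hp
  have hp1' : 1 ≤ p.toReal := by
    rw [← ENNReal.toReal_one]; exact ENNReal.toReal_mono hp hp1
  have hρm : Measurable fun t ↦ ENNReal.ofReal (φ.normed μ t) :=
    (φ.continuous_normed.measurable).ennreal_ofReal
  set ν := μ.withDensity fun t ↦ ENNReal.ofReal (φ.normed μ t) with hν
  have hνp : IsProbabilityMeasure ν := by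
    refine ⟨?_⟩
    rw [hν, withDensity_apply _ MeasurableSet.univ, Measure.restrict_univ,
      ← ofReal_integral_eq_lintegral_ofReal φ.integrable_normed
        (Eventually.of_forall φ.nonneg_normed), φ.integral_normed, ENNReal.ofReal_one]
  have hm : Measurable h' := hh'.measurable
  have hpt (x : E) : ‖mollify μ φ h' x‖ₑ ^ p.toReal ≤ ∫⁻ t, ‖h' (x - t)‖ₑ ^ p.toReal ∂ν := by
    have hmx : Measurable fun t ↦ h' (x - t) := hm.comp (measurable_const.sub measurable_id)
    have h1 : ‖mollify μ φ h' x‖ₑ ≤ ∫⁻ t, ‖h' (x - t)‖ₑ ∂ν := by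
      rw [mollify_apply, hν, lintegral_withDensity_eq_lintegral_mul _ hρm hmx.enorm]
      refine (enorm_integral_le_lintegral_enorm _).trans (lintegral_mono fun t ↦ ?_)
      rw [enorm_mul, Pi.mul_apply, Real.enorm_of_nonneg (φ.nonneg_normed t)]
    have h2 := eLpNorm_le_eLpNorm_of_exponent_le (μ := ν) hp1
      (hmx.stronglyMeasurable.aestronglyMeasurable)
    rw [eLpNorm_one_eq_lintegral_enorm, eLpNorm_eq_lintegral_rpow_enorm_toReal hp0 hp] at h2
    have h3 := ENNReal.rpow_le_rpow (h1.trans h2) hpos.le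
    rwa [← ENNReal.rpow_mul, one_div, inv_mul_cancel₀ hpos.ne', ENNReal.rpow_one] at h3
  rw [eLpNorm_eq_lintegral_rpow_enorm_toReal hp0 hp, eLpNorm_eq_lintegral_rpow_enorm_toReal hp0 hp]
  refine ENNReal.rpow_le_rpow ((lintegral_mono hpt).trans ?_) (by positivity)
  rw [lintegral_lintegral_swap]
  · have h4 (t : E) : ∫⁻ x, ‖h' (x - t)‖ₑ ^ p.toReal ∂μ = ∫⁻ x, ‖h' x‖ₑ ^ p.toReal ∂μ :=
      lintegral_sub_right_eq_self (μ := μ) (fun x ↦ ‖h' x‖ₑ ^ p.toReal) t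
    simp [h4]
  · exact ((hm.comp (measurable_fst.sub measurable_snd)).enorm.pow_const _).aemeasurable

/-- Bump functions at the origin of radius `1 / (j + 1)`. -/
def shrinkingBump (E : Type*) [NormedAddCommGroup E] [NormedSpace ℝ E] (j : ℕ) :
    ContDiffBump (0 : E) where
  rIn := 1 / (2 * (j + 1))
  rOut := 1 / (j + 1)
  rIn_pos := by positivity
  rIn_lt_rOut := by
    rw [one_div_lt_one_div (by positivity) (by positivity)]
    have : (0 : ℝ) < j + 1 := by positivity
    linarith

theorem tendsto_rOut_shrinkingBump :
    Tendsto (fun j ↦ (shrinkingBump E j).rOut) atTop (𝓝 0) :=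
  tendsto_one_div_add_atTop_nhds_zero_nat

/-- Almost everywhere convergence of mollifications, by the Lebesgue differentiation theorem. It
applies because the ratio of the two radii of the bumps is bounded. -/
theorem ae_tendsto_mollify {h : E → ℝ} (hh : LocallyIntegrable h μ) :
    ∀ᵐ x ∂μ, Tendsto (fun j ↦ mollify μ (shrinkingBump E j) h x) atTop (𝓝 (h x)) := by
  refine ContDiffBump.ae_convolution_tendsto_right_of_locallyIntegrable (K := 2)
    tendsto_rOut_shrinkingBump (Eventually.of_forall fun j ↦ ?_) hh
  change (1 : ℝ) / (j + 1) ≤ 2 * (1 / (2 * (j + 1)))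
  apply le_of_eq
  field_simp

theorem tsupport_mollify_subset (φ : ContDiffBump (0 : E)) {h : E → ℝ} {K : Set E}
    (hh : Function.support h ⊆ K) :
    tsupport (mollify μ φ h) ⊆ Metric.cthickening φ.rOut K := by
  refine closure_minimal ?_ Metric.isClosed_cthickening
  refine (support_convolution_subset (lsmul ℝ ℝ)).trans ?_
  rintro _ ⟨x, hx, y, hy, rfl⟩
  rw [φ.support_normed_eq, mem_ball_zero_iff] at hx
  refine Metric.mem_cthickening_of_dist_le _ y _ _ (hh hy) ?_
  simpa using hx.le

/-- Mollifications converge in `L_p`: by density of the continuous functions with compact support,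
because mollification is a contraction of `L_p`. -/
theorem tendsto_eLpNorm_mollify_sub {p : ℝ≥0∞} (hp1 : 1 ≤ p) (hp : p ≠ ⊤) {h : E → ℝ}
    (hh : MemLp h p μ) :
    Tendsto (fun j ↦ eLpNorm (mollify μ (shrinkingBump E j) h - h) p μ) atTop (𝓝 0) := by
  rw [ENNReal.tendsto_atTop_zero]
  intro ε hε
  rcases eq_or_ne ε ⊤ with rfl | hε'
  · exact ⟨0, fun _ _ ↦ le_top⟩
  have hε3 : ε / 3 ≠ 0 := by simp [hε.ne']
  obtain ⟨g, hgc, hgh, hg, hgp⟩ := hh.exists_hasCompactSupport_eLpNorm_sub_le hp hε3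
  have hhl := hh.locallyIntegrable hp1
  have hgl : LocallyIntegrable g μ := hg.locallyIntegrable
  -- for `g` continuous with compact support, all mollifications are bounded by a constant and
  -- supported in one compact set
  have key : Tendsto (fun j ↦ eLpNorm (mollify μ (shrinkingBump E j) g - g) p μ) atTop (𝓝 0) := by
    obtain ⟨B, hB⟩ := hg.bounded_above_of_compact_support hgc
    have hB0 : 0 ≤ B := (norm_nonneg _).trans (hB 0)
    set K := Metric.cthickening 1 (tsupport g)
    have hK : IsCompact K := IsCompact.cthickening hgc
    refine tendsto_eLpNorm_zero_of_dominated (zero_lt_one.trans_le hp1).ne' hp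
      (b := K.indicator fun _ ↦ B + B) ?_ (fun j ↦ ?_) (fun j ↦ ?_) ?_
    · exact memLp_indicator_const p hK.measurableSet _ (Or.inr hK.measure_lt_top.ne)
    · exact ((contDiff_mollify _ hgl).continuous.sub hg).aestronglyMeasurable
    · refine Eventually.of_forall fun x ↦ ?_
      by_cases hx : x ∈ K
      · rw [indicator_of_mem hx]
        refine (abs_sub _ _).trans (add_le_add ?_ (hB x))
        rw [← Real.norm_eq_abs, mollify_apply]
        refine (norm_integral_le_of_norm_le ((shrinkingBump E j).integrable_normed.mul_const B)
          (Eventually.of_forall fun t ↦ ?_)).trans ?_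
        · rw [norm_mul, Real.norm_of_nonneg ((shrinkingBump E j).nonneg_normed t)]
          exact mul_le_mul_of_nonneg_left (hB _) ((shrinkingBump E j).nonneg_normed t)
        · rw [integral_mul_const, (shrinkingBump E j).integral_normed, one_mul]
      · rw [indicator_of_notMem hx]
        have h1 : g x = 0 := by
          by_contra h0
          exact hx (Metric.self_subset_cthickening _ (subset_tsupport g h0))
        have h2 : mollify μ (shrinkingBump E j) g x = 0 := by
          by_contra h0
          refine hx (Metric.cthickening_mono ?_ _ (tsupport_mollify_subset (μ := μ)
            (shrinkingBump E j) (subset_tsupport g) (subset_tsupport _ h0)))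
          change (1 : ℝ) / (j + 1) ≤ 1
          rw [div_le_one (by positivity)]
          linarith [(Nat.cast_nonneg j : (0 : ℝ) ≤ j)]
        simp [h1, h2]
    · filter_upwards [ae_tendsto_mollify hgl] with x hx
      simpa using! hx.sub_const (g x)
  obtain ⟨N, hN⟩ := (ENNReal.tendsto_atTop_zero.1 key) (ε / 3) (pos_iff_ne_zero.2 hε3)
  refine ⟨N, fun j hj ↦ ?_⟩
  have e : mollify μ (shrinkingBump E j) h - h = mollify μ (shrinkingBump E j) (h - g) +
      ((mollify μ (shrinkingBump E j) g - g) + (g - h)) := by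
    rw [mollify_sub _ hhl hgl]; ring
  have hm1 := (contDiff_mollify (shrinkingBump E j) (hhl.sub hgl)).continuous.aestronglyMeasurable
    (μ := μ)
  have hm2 := ((contDiff_mollify (shrinkingBump E j) hgl).continuous.sub hg).aestronglyMeasurable
    (μ := μ)
  have hm3 := hgp.1.sub hh.1
  rw [e]
  calc _ ≤ ε / 3 + (ε / 3 + ε / 3) := by
        refine (eLpNorm_add_le hm1 (hm2.add hm3) hp1).trans (add_le_add ?_ ?_)
        · exact (eLpNorm_mollify_le hp1 hp _ (hh.1.sub hgp.1)).trans hgh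
        · refine (eLpNorm_add_le hm2 hm3 hp1).trans (add_le_add (hN j hj) ?_)
          rwa [eLpNorm_sub_comm]
    _ = ε := by rw [← add_assoc, ENNReal.add_thirds]

/-- Mollification commutes with weak differentiation. -/
theorem fderiv_mollify (φ : ContDiffBump (0 : E)) {h h' : E → ℝ} (v : E)
    (hh : LocallyIntegrable h μ)
    (hw : ∀ ψ : E → ℝ, ContDiff ℝ ∞ ψ → HasCompactSupport ψ →
      ∫ u, h u * fderiv ℝ ψ u v ∂μ = -∫ u, h' u * ψ u ∂μ) (x : E) :
    fderiv ℝ (mollify μ φ h) x v = mollify μ φ h' x := by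
  have h1 : HasFDerivAt (mollify μ φ h)
      (convolution (fderiv ℝ (φ.normed μ)) h ((lsmul ℝ ℝ : ℝ →L[ℝ] ℝ →L[ℝ] ℝ).precompL E) μ x) x :=
    φ.hasCompactSupport_normed.hasFDerivAt_convolution_left _ (φ.contDiff_normed (n := 1)) hh x
  have h2 := (φ.hasCompactSupport_normed (μ := μ)).fderiv (𝕜 := ℝ) |>.convolutionExists_left
    ((lsmul ℝ ℝ : ℝ →L[ℝ] ℝ →L[ℝ] ℝ).precompL E)
    ((φ.contDiff_normed (n := 1)).continuous_fderiv (by simp)) hh x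
  rw [h1.fderiv, convolution_eq_swap, mollify_apply_swap]
  have h3 : Integrable (fun t ↦ ((lsmul ℝ ℝ : ℝ →L[ℝ] ℝ →L[ℝ] ℝ).precompL E)
      (fderiv ℝ (φ.normed μ) (x - t)) (h t)) μ := by
    exact convolutionExistsAt_iff_integrable_swap.1 h2
  rw [ContinuousLinearMap.integral_apply h3]
  set ψ : E → ℝ := fun t ↦ φ.normed μ (x - t) with hψ
  have hψ1 : ContDiff ℝ ∞ ψ := φ.contDiff_normed.comp (contDiff_const.sub contDiff_id)
  have hψ2 : HasCompactSupport ψ :=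
    (φ.hasCompactSupport_normed (μ := μ)).comp_homeomorph (Homeomorph.subLeft x)
  -- the reflected bump `t ↦ φ (x - t)` is the test function
  have hψ3 (t : E) : fderiv ℝ ψ t v = - fderiv ℝ (φ.normed μ) (x - t) v := by
    have := ((φ.contDiff_normed (n := 1) (μ := μ)).differentiable (by simp) (x - t)).hasFDerivAt.comp
      t ((hasFDerivAt_const x t).sub (hasFDerivAt_id t))
    have h5 := this.fderiv
    change fderiv ℝ ψ t = _ at h5
    rw [h5]
    simp
  have h4 := hw ψ hψ1 hψ2
  simp only [hψ3] at h4
  simp only [mul_neg, integral_neg, neg_inj] at h4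
  calc _ = ∫ t, h t * fderiv ℝ (φ.normed μ) (x - t) v ∂μ := by
        refine integral_congr_ae (Eventually.of_forall fun t ↦ ?_)
        simp [ContinuousLinearMap.precompL_apply, mul_comm]
    _ = _ := h4
    _ = _ := integral_congr_ae (Eventually.of_forall fun t ↦ mul_comm _ _)

end Mollification

/-! ### Smooth truncation -/

section Truncation
open Filter

/-- The smooth truncation `t ↦ k arctan (t / k)`: bounded, `1`-Lipschitz, and close to the identity
for large `k`. -/
def truncation (k t : ℝ) : ℝ := k * Real.arctan (t / k)

/-- The derivative of `truncation k`. -/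
def truncationDeriv (k t : ℝ) : ℝ := 1 / (1 + (t / k) ^ 2)

variable {k : ℝ}

theorem contDiff_truncation : ContDiff ℝ ∞ (truncation k) :=
  contDiff_const.mul (Real.contDiff_arctan.comp (contDiff_id.div_const k))

theorem hasDerivAt_truncation (hk : 0 < k) (t : ℝ) :
    HasDerivAt (truncation k) (truncationDeriv k t) t := by
  have := ((hasDerivAt_id t).div_const k).arctan.const_mul k
  have e : k * (1 / (1 + (id t / k) ^ 2) * (1 / k)) = truncationDeriv k t := by
    rw [mul_comm, mul_assoc, one_div_mul_cancel hk.ne', mul_one]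
    rfl
  rwa [e] at this

theorem truncationDeriv_nonneg (t : ℝ) : 0 ≤ truncationDeriv k t := by
  unfold truncationDeriv; positivity

theorem truncationDeriv_le_one (t : ℝ) : truncationDeriv k t ≤ 1 := by
  unfold truncationDeriv
  rw [div_le_one (by positivity)]
  linarith [sq_nonneg (t / k)]

theorem continuous_truncationDeriv : Continuous (truncationDeriv k) := by
  unfold truncationDeriv
  exact continuous_const.div (by fun_prop) fun t ↦ by positivity

theorem truncation_zero : truncation k 0 = 0 := by simp [truncation]

theorem abs_truncation_sub_le (hk : 0 < k) (s t : ℝ) :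
    |truncation k s - truncation k t| ≤ |s - t| := by
  have := convex_univ.norm_image_sub_le_of_norm_hasDerivWithin_le (C := 1)
    (fun x _ ↦ (hasDerivAt_truncation hk x).hasDerivWithinAt)
    (fun x _ ↦ by
      rw [Real.norm_of_nonneg (truncationDeriv_nonneg x)]; exact truncationDeriv_le_one x)
    (mem_univ t) (mem_univ s)
  simpa using this

theorem abs_truncation_le_self (hk : 0 < k) (t : ℝ) : |truncation k t| ≤ |t| := by
  simpa [truncation_zero] using abs_truncation_sub_le hk t 0

theorem abs_truncation_le (hk : 0 < k) (t : ℝ) : |truncation k t| ≤ 2 * k := by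
  have h1 := Real.arctan_lt_pi_div_two (t / k)
  have h2 := Real.neg_pi_div_two_lt_arctan (t / k)
  have h3 := Real.pi_lt_four
  have h4 : |Real.arctan (t / k)| ≤ 2 := abs_le.2 ⟨by linarith, by linarith⟩
  rw [truncation, abs_mul, abs_of_pos hk, mul_comm]
  exact mul_le_mul_of_nonneg_right h4 hk.le

theorem tendsto_truncation (t : ℝ) :
    Tendsto (fun j : ℕ ↦ truncation (j + 1) t) atTop (𝓝 t) := by
  have h1 : HasDerivAt (fun s : ℝ ↦ Real.arctan (s * t)) t 0 := by
    have := ((hasDerivAt_id (0 : ℝ)).mul_const t).arctan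
    simpa using! this
  have h2 : Tendsto (fun j : ℕ ↦ (1 : ℝ) / (j + 1)) atTop (𝓝[>] 0) :=
    tendsto_nhdsWithin_iff.2 ⟨tendsto_one_div_add_atTop_nhds_zero_nat,
      Eventually.of_forall fun j ↦ by rw [mem_Ioi]; positivity⟩
  refine (h1.tendsto_slope_zero_right.comp h2).congr fun j ↦ ?_
  simp only [Function.comp, truncation, smul_eq_mul, zero_add, zero_mul, Real.arctan_zero, sub_zero,
    one_div, inv_inv]
  rw [div_eq_inv_mul]

theorem tendsto_truncationDeriv (t : ℝ) :
    Tendsto (fun j : ℕ ↦ truncationDeriv (j + 1) t) atTop (𝓝 1) := by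
  have h2 : Tendsto (fun j : ℕ ↦ t * ((1 : ℝ) / (j + 1))) atTop (𝓝 (t * 0)) :=
    tendsto_one_div_add_atTop_nhds_zero_nat.const_mul t
  have h3 : Tendsto (fun j : ℕ ↦ 1 / (1 + (t * ((1 : ℝ) / (j + 1))) ^ 2)) atTop
      (𝓝 (1 / (1 + (t * 0) ^ 2))) :=
    tendsto_const_nhds.div ((h2.pow 2).const_add 1) (by simp)
  simp only [mul_zero, ne_eq, OfNat.ofNat_ne_zero, not_false_eq_true, zero_pow, add_zero,
    div_one] at h3
  refine h3.congr fun j ↦ ?_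
  rw [truncationDeriv, mul_one_div]

end Truncation

/-! ### Smooth approximation in Euclidean space with a potential -/

section Approximation
open Filter
variable {n : ℕ} {p : ℝ≥0∞} {h : EuclideanSpace ℝ (Fin n) → ℝ}
  {D : Fin n → EuclideanSpace ℝ (Fin n) → ℝ} {W : EuclideanSpace ℝ (Fin n) → ℝ}
  {K K' : Set (EuclideanSpace ℝ (Fin n))}

theorem eLpNorm_le_add_of_eq_add {α : Type*} [MeasurableSpace α] {μ : Measure α} (hp1 : 1 ≤ p)
    {a b c : α → ℝ} (hb : AEStronglyMeasurable b μ) (hc : AEStronglyMeasurable c μ)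
    (h : ∀ x, a x = b x + c x) : eLpNorm a p μ ≤ eLpNorm b p μ + eLpNorm c p μ := by
  rw [show a = b + c from funext h]
  exact eLpNorm_add_le hb hc hp1

/-- A smooth function of a mollification approximates the truncation of `h`: the potential term is
handled by dominated convergence, since the truncated functions are bounded and `W` is in `L_p` on
the compact set `K'`. -/
theorem exists_contDiff_approx_truncation (hp1 : 1 ≤ p) (hp : p ≠ ⊤)
    {δ : ℝ} (hδ : 0 < δ) (hK' : Metric.cthickening δ K ⊆ K')
    (hsupp : Function.support h ⊆ K) (hh : MemLp h p) (hD : ∀ i, MemLp (D i) p)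
    (hweak : ∀ i, ∀ ψ : EuclideanSpace ℝ (Fin n) → ℝ, ContDiff ℝ ∞ ψ → HasCompactSupport ψ →
      ∫ u, h u * fderiv ℝ ψ u (EuclideanSpace.single i 1) = -∫ u, D i u * ψ u)
    (hW : MemLp W p (volume.restrict K')) {k : ℝ} (hk : 0 < k) {ε : ℝ≥0∞} (hε : 0 < ε) :
    ∃ g : EuclideanSpace ℝ (Fin n) → ℝ, ContDiff ℝ ∞ g ∧ tsupport g ⊆ K' ∧
      eLpNorm (fun u ↦ g u - truncation k (h u)) p volume ≤ ε ∧
      (∀ i, eLpNorm (fun u ↦ fderiv ℝ g u (EuclideanSpace.single i 1) -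
        truncationDeriv k (h u) * D i u) p volume ≤ ε) ∧
      eLpNorm (fun u ↦ W u * (g u - truncation k (h u))) p (volume.restrict K') ≤ ε := by
  have hp0 : p ≠ 0 := (zero_lt_one.trans_le hp1).ne'
  have hhl := hh.locallyIntegrable hp1
  set H : ℕ → EuclideanSpace ℝ (Fin n) → ℝ :=
    fun j ↦ mollify volume (shrinkingBump (EuclideanSpace ℝ (Fin n)) j) h with hH
  have hHs (j : ℕ) : ContDiff ℝ ∞ (H j) := contDiff_mollify _ hhl
  have hae : ∀ᵐ u, Tendsto (fun j ↦ H j u) atTop (𝓝 (h u)) := ae_tendsto_mollify hhl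
  have hT : Continuous (truncation k) := contDiff_truncation.continuous
  have hTh : AEStronglyMeasurable (fun u ↦ truncation k (h u)) volume :=
    hT.comp_aestronglyMeasurable hh.1
  have hgm (j : ℕ) : AEStronglyMeasurable (fun u ↦ truncation k (H j u)) volume :=
    (hT.comp (hHs j).continuous).aestronglyMeasurable
  have hah : AEStronglyMeasurable (fun u ↦ truncationDeriv k (h u)) volume :=
    continuous_truncationDeriv.comp_aestronglyMeasurable hh.1
  have haH (j : ℕ) : AEStronglyMeasurable (fun u ↦ truncationDeriv k (H j u)) volume :=
    (continuous_truncationDeriv.comp (hHs j).continuous).aestronglyMeasurable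
  have hfd (j : ℕ) (i : Fin n) (u) : fderiv ℝ (fun u ↦ truncation k (H j u)) u
      (EuclideanSpace.single i 1) = truncationDeriv k (H j u) *
        mollify volume (shrinkingBump (EuclideanSpace ℝ (Fin n)) j) (D i) u := by
    have h1 := (hasDerivAt_truncation hk (H j u)).comp_hasFDerivAt u
      ((hHs j).differentiable (by simp) u).hasFDerivAt
    rw [show (fun u ↦ truncation k (H j u)) = truncation k ∘ H j from rfl, h1.fderiv]
    rw [_root_.smul_apply, smul_eq_mul, fderiv_mollify _ _ hhl (hweak i)]
  -- the supports are eventually contained in `K'`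
  have hev : ∀ᶠ j in atTop, Function.support (H j) ⊆ Metric.cthickening δ K := by
    filter_upwards [(tendsto_rOut_shrinkingBump (E := EuclideanSpace ℝ (Fin n))).eventually
      (gt_mem_nhds hδ)] with j hj
    exact (subset_tsupport _).trans ((tsupport_mollify_subset _ hsupp).trans
      (Metric.cthickening_mono hj.le _))
  have lim1 : Tendsto (fun j ↦ eLpNorm (fun u ↦ truncation k (H j u) - truncation k (h u)) p
      volume) atTop (𝓝 0) := by
    refine tendsto_of_tendsto_of_tendsto_of_le_of_le tendsto_const_nhds
      (tendsto_eLpNorm_mollify_sub hp1 hp hh) (fun j ↦ zero_le) fun j ↦ ?_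
    exact eLpNorm_mono fun u ↦ abs_truncation_sub_le hk _ _
  have lim2 (i : Fin n) : Tendsto (fun j ↦ eLpNorm (fun u ↦ fderiv ℝ
      (fun u ↦ truncation k (H j u)) u (EuclideanSpace.single i 1) -
        truncationDeriv k (h u) * D i u) p volume) atTop (𝓝 0) := by
    have l1 := tendsto_eLpNorm_mollify_sub hp1 hp (hD i)
    -- the difference is `T_k'(H_j) (D_j - D) + (T_k'(H_j) - T_k'(h)) D`, where the derivatives of
    -- the truncation lie in `[0, 1]` and `D_j` is the mollification of `D`
    have l2 : Tendsto (fun j ↦ eLpNorm (fun u ↦ (truncationDeriv k (H j u) -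
        truncationDeriv k (h u)) * D i u) p volume) atTop (𝓝 0) := by
      refine tendsto_eLpNorm_zero_of_dominated hp0 hp (hD i).norm
        (fun j ↦ ((haH j).sub hah).mul (hD i).1) (fun j ↦ Eventually.of_forall fun u ↦ ?_) ?_
      · rw [abs_mul, Real.norm_eq_abs]
        refine mul_le_of_le_one_left (abs_nonneg _) (abs_sub_le_iff.2 ⟨?_, ?_⟩) <;>
        linarith [truncationDeriv_nonneg (k := k) (H j u), truncationDeriv_nonneg (k := k) (h u),
          truncationDeriv_le_one (k := k) (H j u), truncationDeriv_le_one (k := k) (h u)]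
      · filter_upwards [hae] with u hu
        have := (((continuous_truncationDeriv (k := k)).tendsto _).comp hu).sub_const
          (truncationDeriv k (h u)) |>.mul_const (D i u)
        simpa using! this
    have l3 := l1.add l2
    rw [add_zero] at l3
    refine tendsto_of_tendsto_of_tendsto_of_le_of_le tendsto_const_nhds l3 (fun j ↦ zero_le)
      fun j ↦ ?_
    have m1 := ((contDiff_mollify (shrinkingBump (EuclideanSpace ℝ (Fin n)) j)
      ((hD i).locallyIntegrable hp1)).continuous.aestronglyMeasurable (μ := volume)).sub (hD i).1
    refine (eLpNorm_le_add_of_eq_add hp1 ((haH j).mul m1) (((haH j).sub hah).mul (hD i).1)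
      fun u ↦ ?_).trans (add_le_add_left (eLpNorm_mono fun u ↦ ?_) _)
    · rw [hfd]
      simp only [Pi.mul_apply, Pi.sub_apply]
      ring
    · rw [Pi.mul_apply, norm_mul, Real.norm_of_nonneg (truncationDeriv_nonneg _)]
      exact mul_le_of_le_one_left (norm_nonneg _) (truncationDeriv_le_one _)
  -- truncations are bounded by `2 k`, their differences by `4 k`
  have lim3 : Tendsto (fun j ↦ eLpNorm (fun u ↦ W u * (truncation k (H j u) - truncation k (h u))) p
      (volume.restrict K')) atTop (𝓝 0) := by
    refine tendsto_eLpNorm_zero_of_dominated hp0 hp (hW.norm.const_mul (4 * k))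
      (fun j ↦ hW.1.mul ((hgm j).sub hTh).restrict) (fun j ↦ Eventually.of_forall fun u ↦ ?_) ?_
    · rw [abs_mul, Real.norm_eq_abs, mul_comm]
      refine mul_le_mul_of_nonneg_right ?_ (abs_nonneg _)
      refine (abs_sub _ _).trans ?_
      linarith [abs_truncation_le hk (H j u), abs_truncation_le hk (h u)]
    · filter_upwards [ae_restrict_of_ae hae] with u hu
      have := ((hT.tendsto _).comp hu).sub_const (truncation k (h u)) |>.const_mul (W u)
      simpa using! this
  obtain ⟨j, h1, h2, h3, h4⟩ := (hev.and (((lim1.eventually (ge_mem_nhds hε)).and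
    ((eventually_all.2 fun i ↦ (lim2 i).eventually (ge_mem_nhds hε)).and
    (lim3.eventually (ge_mem_nhds hε)))))).exists
  have hTz : ∀ u ∉ Metric.cthickening δ K, truncation k (H j u) = 0 := by
    intro u hu
    have : H j u = 0 := by
      by_contra h0; exact hu (h1 h0)
    rw [this, truncation_zero]
  refine ⟨fun u ↦ truncation k (H j u), contDiff_truncation.comp (hHs j), ?_, h2, h3, h4⟩
  refine (closure_minimal (fun u hu ↦ ?_) Metric.isClosed_cthickening).trans hK'
  by_contra h0; exact hu (hTz u h0)

/-- Smooth approximation of a compactly supported function `h` with weak derivatives `D i`, in the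
norm of `L_p` with the potential `W`. -/
theorem exists_contDiff_approx (hp1 : 1 ≤ p) (hp : p ≠ ⊤)
    {δ : ℝ} (hδ : 0 < δ) (hK' : Metric.cthickening δ K ⊆ K')
    (hsupp : Function.support h ⊆ K) (hh : MemLp h p) (hD : ∀ i, MemLp (D i) p)
    (hweak : ∀ i, ∀ ψ : EuclideanSpace ℝ (Fin n) → ℝ, ContDiff ℝ ∞ ψ → HasCompactSupport ψ →
      ∫ u, h u * fderiv ℝ ψ u (EuclideanSpace.single i 1) = -∫ u, D i u * ψ u)
    (hW : MemLp W p (volume.restrict K')) (hWh : MemLp (fun u ↦ W u * h u) p (volume.restrict K'))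
    {ε : ℝ≥0∞} (hε : 0 < ε) :
    ∃ g : EuclideanSpace ℝ (Fin n) → ℝ, ContDiff ℝ ∞ g ∧ tsupport g ⊆ K' ∧
      eLpNorm (fun u ↦ g u - h u) p volume ≤ ε ∧
      (∀ i, eLpNorm (fun u ↦ fderiv ℝ g u (EuclideanSpace.single i 1) - D i u) p volume ≤ ε) ∧
      eLpNorm (fun u ↦ W u * (g u - h u)) p (volume.restrict K') ≤ ε := by
  have hp0 : p ≠ 0 := (zero_lt_one.trans_le hp1).ne'
  have hk (k : ℕ) : (0 : ℝ) < k + 1 := by positivity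
  have hTm (k : ℝ) : AEStronglyMeasurable (fun u ↦ truncation k (h u)) volume :=
    contDiff_truncation.continuous.comp_aestronglyMeasurable hh.1
  have ham (k : ℝ) : AEStronglyMeasurable (fun u ↦ truncationDeriv k (h u)) volume :=
    continuous_truncationDeriv.comp_aestronglyMeasurable hh.1
  have hTb (k : ℕ) (t : ℝ) : |truncation (k + 1) t - t| ≤ 2 * |t| := by
    refine (abs_sub _ _).trans ?_
    linarith [abs_truncation_le_self (hk k) t]
  -- as the truncation level tends to infinity, the three differences are dominated by `2 |h|`,
  -- `2 |D i|` and `2 |W h|`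
  have lim1 : Tendsto (fun k : ℕ ↦ eLpNorm (fun u ↦ truncation (k + 1) (h u) - h u) p volume)
      atTop (𝓝 0) := by
    refine tendsto_eLpNorm_zero_of_dominated hp0 hp (hh.norm.const_mul 2)
      (fun k ↦ (hTm _).sub hh.1) (fun k ↦ Eventually.of_forall fun u ↦ hTb k _)
      (Eventually.of_forall fun u ↦ ?_)
    simpa using (tendsto_truncation (h u)).sub_const (h u)
  have lim2 (i : Fin n) : Tendsto (fun k : ℕ ↦ eLpNorm (fun u ↦ truncationDeriv (k + 1) (h u) *
      D i u - D i u) p volume) atTop (𝓝 0) := by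
    refine tendsto_eLpNorm_zero_of_dominated hp0 hp ((hD i).norm.const_mul 2)
      (fun k ↦ ((ham _).mul (hD i).1).sub (hD i).1) (fun k ↦ Eventually.of_forall fun u ↦ ?_)
      (Eventually.of_forall fun u ↦ ?_)
    · refine (abs_sub _ _).trans ?_
      rw [abs_mul, abs_of_nonneg (truncationDeriv_nonneg _), two_mul, Real.norm_eq_abs]
      exact add_le_add_left (mul_le_of_le_one_left (abs_nonneg _) (truncationDeriv_le_one _)) _
    · simpa using ((tendsto_truncationDeriv (h u)).mul_const (D i u)).sub_const (D i u)
  have lim3 : Tendsto (fun k : ℕ ↦ eLpNorm (fun u ↦ W u * (truncation (k + 1) (h u) - h u)) p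
      (volume.restrict K')) atTop (𝓝 0) := by
    refine tendsto_eLpNorm_zero_of_dominated hp0 hp (hWh.norm.const_mul 2)
      (fun k ↦ hW.1.mul ((hTm _).sub hh.1).restrict) (fun k ↦ Eventually.of_forall fun u ↦ ?_)
      (Eventually.of_forall fun u ↦ ?_)
    · rw [abs_mul, Real.norm_eq_abs, abs_mul, ← mul_assoc, mul_comm 2, mul_assoc]
      exact mul_le_mul_of_nonneg_left (hTb k _) (abs_nonneg _)
    · simpa using ((tendsto_truncation (h u)).sub_const (h u)).const_mul (W u)
  have hε2 : 0 < ε / 2 := ENNReal.half_pos hε.ne'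
  obtain ⟨k, h1, h2, h3⟩ := ((lim1.eventually (ge_mem_nhds hε2)).and
    ((eventually_all.2 fun i ↦ (lim2 i).eventually (ge_mem_nhds hε2)).and
    (lim3.eventually (ge_mem_nhds hε2)))).exists
  obtain ⟨g, hg, hgK, g1, g2, g3⟩ := exists_contDiff_approx_truncation hp1 hp hδ hK' hsupp
    hh hD hweak hW (hk k) hε2
  have hgc := hg.continuous.aestronglyMeasurable (μ := volume)
  refine ⟨g, hg, hgK, ?_, fun i ↦ ?_, ?_⟩ <;> rw [← ENNReal.add_halves ε]
  · exact (eLpNorm_le_add_of_eq_add hp1 (hgc.sub (hTm _)) ((hTm _).sub hh.1)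
      fun u ↦ (sub_add_sub_cancel _ _ _).symm).trans (add_le_add g1 h1)
  · have m := ((hg.continuous_fderiv (by simp)).clm_apply
      (continuous_const (y := EuclideanSpace.single i (1 : ℝ)))).aestronglyMeasurable (μ := volume)
    exact (eLpNorm_le_add_of_eq_add hp1 (m.sub ((ham _).mul (hD i).1))
      (((ham _).mul (hD i).1).sub (hD i).1)
      fun u ↦ (sub_add_sub_cancel _ _ _).symm).trans (add_le_add (g2 i) (h2 i))
  · refine (eLpNorm_le_add_of_eq_add hp1 (hW.1.mul (hgc.sub (hTm _)).restrict)
      (hW.1.mul ((hTm _).sub hh.1).restrict)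
      fun u ↦ ?_).trans (add_le_add g3 h3)
    simp only [Pi.mul_apply, Pi.sub_apply]
    ring

end Approximation

/-! ### Comparison of norms on the manifold and in charts -/

section ChartComparison
variable {n : ℕ} {M : Type*} [MetricSpace M] [ChartedSpace (EuclideanSpace ℝ (Fin n)) M]
variable [RiemannianBundle (fun x : M ↦ TangentSpace (𝓡 n) x)]
variable [IsManifold (𝓡 n) ∞ M]
  [IsContMDiffRiemannianBundle (𝓡 n) ∞ (EuclideanSpace ℝ (Fin n)) (fun x : M ↦ TangentSpace (𝓡 n) x)]
variable {K : Set (EuclideanSpace ℝ (Fin n))} {p : ℝ≥0∞}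

theorem continuousOn_sqrt_det_gram (x₀ : M) :
    ContinuousOn (fun u ↦ Real.sqrt (gram x₀ u).det) (extChartAt (𝓡 n) x₀).target :=
  (Real.continuous_sqrt.comp (continuous_id.matrix_det)).comp_continuousOn (continuousOn_gram x₀)

theorem continuousOn_gram_inv (x₀ : M) (i j : Fin n) :
    ContinuousOn (fun u ↦ (gram x₀ u)⁻¹ i j) (extChartAt (𝓡 n) x₀).target := by
  have h1 : ContinuousOn (fun u ↦ (gram x₀ u).det⁻¹ * (gram x₀ u).adjugate i j)
      (extChartAt (𝓡 n) x₀).target :=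
    ((continuous_id.matrix_det.comp_continuousOn (continuousOn_gram x₀)).inv₀
      fun u hu ↦ (det_gram_pos x₀ hu).ne').mul
      ((continuous_id.matrix_adjugate.matrix_elem i j).comp_continuousOn (continuousOn_gram x₀))
  refine h1.congr fun u hu ↦ ?_
  simp [Matrix.inv_def]

/-- On a compact part of a chart, the norm of a vector is controlled by its covariant components. -/
theorem exists_norm_le_sum_coordComp (x₀ : M) (hK : IsCompact K)
    (hKt : K ⊆ (extChartAt (𝓡 n) x₀).target) :
    ∃ C : ℝ, 0 ≤ C ∧ ∀ (G : ∀ x : M, TangentSpace (𝓡 n) x), ∀ u ∈ K,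
      ‖G ((extChartAt (𝓡 n) x₀).symm u)‖ ≤ C * ∑ i, |coordComp G x₀ i u| := by
  have h1 (i j : Fin n) : ∃ B : ℝ, ∀ u ∈ K, |(gram x₀ u)⁻¹ i j| ≤ B := by
    obtain ⟨B, hB⟩ := hK.exists_bound_of_continuousOn ((continuousOn_gram_inv x₀ i j).mono hKt)
    exact ⟨B, hB⟩
  choose B hB using h1
  set A := ∑ i, ∑ j, |B i j| with hA
  have hA0 : 0 ≤ A := Finset.sum_nonneg fun i _ ↦ Finset.sum_nonneg fun j _ ↦ abs_nonneg _
  refine ⟨Real.sqrt A, Real.sqrt_nonneg _, fun G u hu ↦ ?_⟩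
  set S := ∑ i, |coordComp G x₀ i u| with hS
  have hS0 : 0 ≤ S := Finset.sum_nonneg fun i _ ↦ abs_nonneg _
  have hle (i : Fin n) : |coordComp G x₀ i u| ≤ S :=
    Finset.single_le_sum (f := fun i ↦ |coordComp G x₀ i u|) (fun i _ ↦ abs_nonneg _)
      (Finset.mem_univ i)
  rw [← Real.sqrt_sq (norm_nonneg (G ((extChartAt (𝓡 n) x₀).symm u))), ← Real.sqrt_sq hS0,
    ← Real.sqrt_mul hA0]
  refine Real.sqrt_le_sqrt ?_
  rw [norm_sq_eq_chart G x₀ (hKt hu), hA, Finset.sum_mul]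
  simp only [dotProduct, Matrix.mulVec, Finset.mul_sum, Finset.sum_mul]
  refine Finset.sum_le_sum fun i _ ↦ Finset.sum_le_sum fun j _ ↦ ?_
  calc coordComp G x₀ i u * ((gram x₀ u)⁻¹ i j * coordComp G x₀ j u)
      ≤ |coordComp G x₀ i u * ((gram x₀ u)⁻¹ i j * coordComp G x₀ j u)| := le_abs_self _
    _ = |(gram x₀ u)⁻¹ i j| * (|coordComp G x₀ i u| * |coordComp G x₀ j u|) := by
        rw [abs_mul, abs_mul]; ring
    _ ≤ |B i j| * (S * S) := by
        refine mul_le_mul ((hB i j u hu).trans (le_abs_self _))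
          (mul_le_mul (hle i) (hle j) (abs_nonneg _) hS0) (by positivity) (abs_nonneg _)
    _ = |B i j| * S ^ 2 := by ring

/-- On a compact part of a chart, the covariant components of a vector are controlled by its
norm. -/
theorem exists_coordComp_le_norm (x₀ : M) (hK : IsCompact K)
    (hKt : K ⊆ (extChartAt (𝓡 n) x₀).target) :
    ∃ C : ℝ, 0 ≤ C ∧ ∀ (G : ∀ x : M, TangentSpace (𝓡 n) x) (i : Fin n), ∀ u ∈ K,
      |coordComp G x₀ i u| ≤ C * ‖G ((extChartAt (𝓡 n) x₀).symm u)‖ := by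
  have h1 (i : Fin n) : ∃ B : ℝ, ∀ u ∈ K, |gram x₀ u i i| ≤ B := by
    obtain ⟨B, hB⟩ := hK.exists_bound_of_continuousOn
      (((continuous_id.matrix_elem i i).comp_continuousOn (continuousOn_gram x₀)).mono hKt)
    exact ⟨B, hB⟩
  choose B hB using h1
  refine ⟨Real.sqrt (∑ i, |B i|), Real.sqrt_nonneg _, fun G i u hu ↦ ?_⟩
  have h2 : ‖coordVec x₀ i u‖ ≤ Real.sqrt (∑ i, |B i|) := by
    refine Real.le_sqrt_of_sq_le ?_
    rw [← real_inner_self_eq_norm_sq]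
    refine (le_abs_self _).trans ((hB i u hu).trans ((le_abs_self _).trans ?_))
    exact Finset.single_le_sum (f := fun i ↦ |B i|) (fun i _ ↦ abs_nonneg _) (Finset.mem_univ i)
  rw [mul_comm]
  exact (abs_real_inner_le_norm _ _).trans (mul_le_mul_of_nonneg_left h2 (norm_nonneg _))

variable [MeasurableSpace M] [BorelSpace M]

/-- On a compact part of a chart the volume density is bounded above and away from zero. -/
theorem exists_volDensity_bounds (x₀ : M) (hK : IsCompact K)
    (hKt : K ⊆ (extChartAt (𝓡 n) x₀).target) :
    ∃ c C : ℝ≥0, (∀ u ∈ K, 1 ≤ c * volDensity x₀ u) ∧ ∀ u ∈ K, volDensity x₀ u ≤ C := by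
  have hc := (continuousOn_sqrt_det_gram x₀).mono hKt
  have hpos : ∀ u ∈ K, 0 < Real.sqrt (gram x₀ u).det :=
    fun u hu ↦ Real.sqrt_pos.2 (det_gram_pos x₀ (hKt hu))
  obtain ⟨C, hC⟩ := hK.exists_bound_of_continuousOn hc
  obtain ⟨c, hc'⟩ := hK.exists_bound_of_continuousOn (hc.inv₀ fun u hu ↦ (hpos u hu).ne')
  refine ⟨c.toNNReal, C.toNNReal, fun u hu ↦ ?_, fun u hu ↦ ?_⟩
  · have h1 : ‖(Real.sqrt (gram x₀ u).det)⁻¹‖ ≤ c := hc' u hu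
    rw [Real.norm_of_nonneg (inv_nonneg.2 (hpos u hu).le)] at h1
    have h2 := mul_le_mul_of_nonneg_right h1 (hpos u hu).le
    rw [inv_mul_cancel₀ (hpos u hu).ne'] at h2
    have hc0 : 0 ≤ c := (inv_nonneg.2 (hpos u hu).le).trans h1
    have h3 := ENNReal.ofReal_le_ofReal h2
    rwa [ENNReal.ofReal_mul hc0, ENNReal.ofReal_one] at h3
  · exact ENNReal.ofReal_le_ofReal ((le_abs_self _).trans (hC u hu))

/-- The measure `√(det g_{ij}) du` on the target of the chart around `x₀`. -/
def chartVolume (x₀ : M) : Measure (EuclideanSpace ℝ (Fin n)) :=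
  ((volume : Measure (EuclideanSpace ℝ (Fin n))).restrict
    (extChartAt (𝓡 n) x₀).target).withDensity (volDensity x₀)

theorem restrict_le_smul_chartVolume (x₀ : M) (hK : IsCompact K)
    (hKt : K ⊆ (extChartAt (𝓡 n) x₀).target) :
    ∃ c : ℝ≥0, (volume.restrict K) ≤ (c : ℝ≥0∞) • chartVolume x₀ := by
  obtain ⟨c, -, hc, -⟩ := exists_volDensity_bounds x₀ hK hKt
  refine ⟨c, Measure.le_iff.2 fun s hs ↦ ?_⟩
  rw [Measure.restrict_apply hs, Measure.smul_apply, chartVolume, withDensity_apply _ hs,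
    Measure.restrict_restrict hs, smul_eq_mul, ← lintegral_const_mul' _ _ ENNReal.coe_ne_top]
  calc volume (s ∩ K) = ∫⁻ u in s ∩ K, 1 := by simp
    _ ≤ ∫⁻ u in s ∩ K, c * volDensity x₀ u :=
        setLIntegral_mono' (hs.inter hK.measurableSet) fun u hu ↦ hc u hu.2
    _ ≤ _ := lintegral_mono_set (inter_subset_inter_right _ hKt)

theorem chartVolume_restrict_le_smul (x₀ : M) (hK : IsCompact K)
    (hKt : K ⊆ (extChartAt (𝓡 n) x₀).target) :
    ∃ c : ℝ≥0, (chartVolume x₀).restrict K ≤ (c : ℝ≥0∞) • volume.restrict K := by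
  obtain ⟨-, C, -, hC⟩ := exists_volDensity_bounds x₀ hK hKt
  refine ⟨C, Measure.le_iff.2 fun s hs ↦ ?_⟩
  rw [Measure.restrict_apply hs, Measure.smul_apply, chartVolume,
    withDensity_apply _ (hs.inter hK.measurableSet), Measure.restrict_apply hs,
    Measure.restrict_restrict (hs.inter hK.measurableSet), smul_eq_mul,
    inter_eq_left.2 (inter_subset_right.trans hKt)]
  calc ∫⁻ u in s ∩ K, volDensity x₀ u ≤ ∫⁻ u in s ∩ K, C :=
        setLIntegral_mono' (hs.inter hK.measurableSet) fun u hu ↦ hC u hu.2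
    _ = _ := by simp

theorem eLpNorm_chartMeasure (x₀ : M) {k : M → ℝ}
    (hk : AEStronglyMeasurable k (riemannianMeasure n M)) :
    eLpNorm k p (chartMeasure n x₀) =
      eLpNorm (k ∘ (extChartAt (𝓡 n) x₀).symm) p (chartVolume x₀) := by
  rw [chartMeasure, eLpNorm_map_measure _ (aemeasurable_chart_symm x₀)]
  · rfl
  · exact hk.mono_measure (chartMeasure_le x₀)

/-- The `L_p` norm over a compact part of a chart with Lebesgue measure is controlled by the `L_p`
norm on the manifold. -/
theorem exists_eLpNorm_chart_le (hp : p ≠ ⊤) (x₀ : M) (hK : IsCompact K)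
    (hKt : K ⊆ (extChartAt (𝓡 n) x₀).target) :
    ∃ C : ℝ≥0, ∀ k : M → ℝ, AEStronglyMeasurable k (riemannianMeasure n M) →
      eLpNorm (k ∘ (extChartAt (𝓡 n) x₀).symm) p (volume.restrict K) ≤
        C * eLpNorm k p (riemannianMeasure n M) := by
  obtain ⟨c, hc⟩ := restrict_le_smul_chartVolume x₀ hK hKt
  refine ⟨c ^ (1 / p).toReal, fun k hk ↦ ?_⟩
  refine (eLpNorm_mono_measure _ hc).trans ?_
  rw [eLpNorm_smul_measure_of_ne_top hp, ← eLpNorm_chartMeasure x₀ hk, smul_eq_mul,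
    ENNReal.coe_rpow_of_nonneg _ ENNReal.toReal_nonneg]
  exact mul_le_mul_right (eLpNorm_mono_measure _ (chartMeasure_le x₀)) _

/-- The `L_p` norm of a function supported in a compact part of a chart is controlled by its `L_p`
norm in the chart with Lebesgue measure. -/
theorem exists_eLpNorm_le_chart (hp : p ≠ ⊤) (x₀ : M) (hK : IsCompact K)
    (hKt : K ⊆ (extChartAt (𝓡 n) x₀).target) :
    ∃ C : ℝ≥0, ∀ k : M → ℝ, AEStronglyMeasurable k (riemannianMeasure n M) →
      (∀ x ∉ (extChartAt (𝓡 n) x₀).symm '' K, k x = 0) →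
      eLpNorm k p (riemannianMeasure n M) ≤
        C * eLpNorm (k ∘ (extChartAt (𝓡 n) x₀).symm) p (volume.restrict K) := by
  obtain ⟨c, hc⟩ := chartVolume_restrict_le_smul x₀ hK hKt
  refine ⟨c ^ (1 / p).toReal, fun k hk hk0 ↦ ?_⟩
  have hs : Function.support k ⊆ (extChartAt (𝓡 n) x₀).source := by
    intro x hx
    by_contra h
    refine hx (hk0 x ?_)
    rintro ⟨u, hu, rfl⟩
    exact h ((extChartAt (𝓡 n) x₀).map_target (hKt hu))
  rw [← eLpNorm_restrict_eq_of_support_subset hs, riemannianMeasure_restrict_source,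
    eLpNorm_chartMeasure x₀ hk]
  have h1 : k ∘ (extChartAt (𝓡 n) x₀).symm =ᵐ[chartVolume x₀]
      K.indicator (k ∘ (extChartAt (𝓡 n) x₀).symm) := by
    have h2 : ∀ᵐ u ∂chartVolume x₀, u ∈ (extChartAt (𝓡 n) x₀).target :=
      (withDensity_absolutelyContinuous _ _).ae_le
        (ae_restrict_mem (isOpen_extChartAt_target x₀).measurableSet)
    filter_upwards [h2] with u hu
    by_cases huK : u ∈ K
    · rw [indicator_of_mem huK]
    · rw [indicator_of_notMem huK]
      refine hk0 _ ?_
      rintro ⟨v, hv, hvu⟩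
      exact huK ((extChartAt (𝓡 n) x₀).symm.injOn (hKt hv) hu hvu ▸ hv)
  rw [eLpNorm_congr_ae h1, eLpNorm_indicator_eq_eLpNorm_restrict hK.measurableSet]
  refine (eLpNorm_mono_measure _ hc).trans ?_
  rw [eLpNorm_smul_measure_of_ne_top hp, smul_eq_mul,
    ENNReal.coe_rpow_of_nonneg _ ENNReal.toReal_nonneg]

theorem exists_compact_chart_nhds (x₀ : M) : ∃ K : Set (EuclideanSpace ℝ (Fin n)), IsCompact K ∧
    K ⊆ (extChartAt (𝓡 n) x₀).target ∧ (extChartAt (𝓡 n) x₀).symm '' K ∈ 𝓝 x₀ := by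
  obtain ⟨K, hK, hKt, hKc⟩ := local_compact_nhds (extChartAt_target_mem_nhds (I := 𝓡 n) x₀)
  refine ⟨K, hKc, hKt, ?_⟩
  have h1 := (continuousAt_extChartAt (I := 𝓡 n) x₀).preimage_mem_nhds hK
  filter_upwards [h1, extChartAt_source_mem_nhds (I := 𝓡 n) x₀] with x hx hxs
  exact ⟨_, hx, (extChartAt (𝓡 n) x₀).left_inv hxs⟩

theorem isCompact_symm_image (x₀ : M) (hK : IsCompact K)
    (hKt : K ⊆ (extChartAt (𝓡 n) x₀).target) : IsCompact ((extChartAt (𝓡 n) x₀).symm '' K) :=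
  hK.image_of_continuousOn ((continuousOn_extChartAt_symm x₀).mono hKt)

/-- The volume density is bounded on compact parts of charts. -/
instance isLocallyFiniteMeasure_riemannianMeasure :
    IsLocallyFiniteMeasure (riemannianMeasure n M) := by
  refine ⟨fun x₀ ↦ ?_⟩
  obtain ⟨K, hK, hKt, hKn⟩ := exists_compact_chart_nhds (n := n) x₀
  refine ⟨_, hKn, ?_⟩
  set S := (extChartAt (𝓡 n) x₀).symm '' K with hS
  have hSs : S ⊆ (extChartAt (𝓡 n) x₀).source := by
    rintro _ ⟨u, hu, rfl⟩
    exact (extChartAt (𝓡 n) x₀).map_target (hKt hu)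
  have hSm : MeasurableSet S := (isCompact_symm_image x₀ hK hKt).measurableSet
  have h1 : riemannianMeasure n M S = chartMeasure n x₀ S := by
    rw [← riemannianMeasure_restrict_source, Measure.restrict_apply hSm, inter_eq_left.2 hSs]
  have h2 : extChartAt (𝓡 n) x₀ '' S = K := by
    rw [hS, (extChartAt (𝓡 n) x₀).image_symm_image_of_subset_target hKt]
  obtain ⟨-, C, -, hC⟩ := exists_volDensity_bounds x₀ hK hKt
  rw [h1, chartMeasure_apply x₀ hSm hSs, h2]
  refine (setLIntegral_mono' hK.measurableSet hC).trans_lt ?_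
  simpa using ENNReal.mul_lt_top ENNReal.coe_lt_top hK.measure_lt_top

variable [SecondCountableTopology M]

/-- The only consequence of the reverse Hölder inequality that is needed: `V` is locally in `L_p`
for `p < q`. -/
theorem IsLocalReverseHolder.memLp {V : M → ℝ} {q : ℝ} (hV : IsLocalReverseHolder n q V)
    (hp1 : 1 ≤ p) (hpq : p < ENNReal.ofReal q) {S : Set M} (hS : IsCompact S) :
    MemLp V p ((riemannianMeasure n M).restrict S) := by
  obtain ⟨hVl, hV0, C, r₀, hr₀, hB⟩ := hV
  have hp : p ≠ ⊤ := (hpq.trans_le le_top).ne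
  have hp0 : p ≠ 0 := (zero_lt_one.trans_le hp1).ne'
  have hq : 0 < q := ENNReal.ofReal_pos.1 (bot_le.trans_lt hpq)
  have hVm : AEStronglyMeasurable V (riemannianMeasure n M) := hVl.aestronglyMeasurable
  have key (x : M) : ∃ U ∈ 𝓝 x, MemLp V p ((riemannianMeasure n M).restrict U) := by
    obtain ⟨U, hU, hVU⟩ := hVl x
    obtain ⟨U', hU', hμU'⟩ := (riemannianMeasure n M).finiteAt_nhds x
    obtain ⟨ρ, hρ, hρU⟩ := Metric.mem_nhds_iff.1 (Filter.inter_mem hU hU')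
    -- a ball of radius less than `r₀` with finite measure on which `V` is integrable
    set r := min ρ (r₀ / 2) with hr
    have hr0 : 0 < r := lt_min hρ (by positivity)
    have hrr : r < r₀ := (min_le_right _ _).trans_lt (by linarith)
    have hsub : Metric.ball x r ⊆ U ∩ U' :=
      (Metric.ball_subset_ball (min_le_left _ _)).trans hρU
    refine ⟨Metric.ball x r, Metric.ball_mem_nhds x hr0, ?_⟩
    set ν := (riemannianMeasure n M).restrict (Metric.ball x r) with hν
    have hνfin : IsFiniteMeasure ν :=
      ⟨by rw [hν, Measure.restrict_apply_univ]
          exact (measure_mono (hsub.trans inter_subset_right)).trans_lt hμU'⟩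
    have hint : Integrable V ν := hVU.mono_set (hsub.trans inter_subset_left)
    have h1 : ∫⁻ y, ENNReal.ofReal (V y) ∂ν < ⊤ := by
      refine (lintegral_mono fun y ↦ ?_).trans_lt hint.2
      exact Real.ofReal_le_enorm _
    have h2 : ⨍⁻ y, ENNReal.ofReal (V y) ∂ν < ⊤ := laverage_lt_top h1.ne
    have h3 := (hB x r hr0 hrr).trans_lt (ENNReal.mul_lt_top ENNReal.coe_lt_top h2)
    -- by the reverse Hölder inequality `V ^ q` has finite average, hence finite integral
    have h4 : ⨍⁻ y, ENNReal.ofReal (V y) ^ q ∂ν < ⊤ := by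
      rwa [ENNReal.rpow_lt_top_iff_of_pos (by positivity)] at h3
    have h5 : ∫⁻ y, ENNReal.ofReal (V y) ^ q ∂ν < ⊤ := by
      rw [← measure_mul_laverage]
      exact ENNReal.mul_lt_top (measure_lt_top _ _) h4
    have hVq : MemLp V (ENNReal.ofReal q) ν := by
      refine ⟨hVm.restrict, ?_⟩
      rw [eLpNorm_lt_top_iff_lintegral_rpow_enorm_lt_top (by simpa using hq) ENNReal.ofReal_ne_top,
        ENNReal.toReal_ofReal hq.le]
      refine lt_of_eq_of_lt (lintegral_congr_ae ?_) h5
      filter_upwards [ae_restrict_of_ae hV0] with y hy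
      rw [Real.enorm_of_nonneg hy]
    exact hVq.mono_exponent hpq.le
  have hloc : LocallyIntegrable (fun x ↦ ‖V x‖ ^ p.toReal) (riemannianMeasure n M) := by
    intro x
    obtain ⟨U, hU, h⟩ := key x
    exact ⟨U, hU, h.integrable_norm_rpow hp0 hp⟩
  exact (integrable_norm_rpow_iff hVm.restrict hp0 hp).1 (hloc.integrableOn_isCompact hS)

end ChartComparison

/-! ### Calculus of distributional gradients -/

section WeakGradient
variable {n : ℕ} {M : Type*} [MetricSpace M] [ChartedSpace (EuclideanSpace ℝ (Fin n)) M]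
variable [RiemannianBundle (fun x : M ↦ TangentSpace (𝓡 n) x)]
variable {f f' η : M → ℝ} {G G' : ∀ x : M, TangentSpace (𝓡 n) x}

theorem coordComp_sub (G G' : ∀ x : M, TangentSpace (𝓡 n) x) (x₀ : M) (i : Fin n) :
    coordComp (fun x ↦ G x - G' x) x₀ i = coordComp G x₀ i - coordComp G' x₀ i := by
  funext u; exact inner_sub_left _ _ _

theorem IsWeakGradient.sub (h : IsWeakGradient f G) (h' : IsWeakGradient f' G') :
    IsWeakGradient (fun x ↦ f x - f' x) (fun x ↦ G x - G' x) := by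
  have := h.add (h'.smul (-1))
  simpa only [neg_one_mul, neg_one_smul, ← sub_eq_add_neg] using! this

theorem isWeakGradient_zero :
    IsWeakGradient (fun _ : M ↦ (0 : ℝ)) (fun x ↦ (0 : TangentSpace (𝓡 n) x)) := by
  have hc (x₀ : M) (i : Fin n) : coordComp (fun x ↦ (0 : TangentSpace (𝓡 n) x)) x₀ i = 0 := by
    funext u; exact inner_zero_left _
  refine ⟨fun x₀ ↦ locallyIntegrable_zero.locallyIntegrableOn _, fun x₀ i ↦ ?_,
    fun x₀ i ψ _ _ _ ↦ ?_⟩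
  · rw [hc]; exact locallyIntegrable_zero.locallyIntegrableOn _
  · simp [hc]

theorem IsWeakGradient.sum {F : ℕ → M → ℝ} {Γ : ℕ → ∀ x : M, TangentSpace (𝓡 n) x}
    (h : ∀ j, IsWeakGradient (F j) (Γ j)) (k : ℕ) :
    IsWeakGradient (fun x ↦ ∑ j ∈ Finset.range k, F j x)
      (fun x ↦ ∑ j ∈ Finset.range k, Γ j x) := by
  induction k with
  | zero => simpa using isWeakGradient_zero
  | succ k ih => simpa only [Finset.sum_range_succ] using ih.add (h k)

variable [IsManifold (𝓡 n) ∞ M]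
  [IsContMDiffRiemannianBundle (𝓡 n) ∞ (EuclideanSpace ℝ (Fin n)) (fun x : M ↦ TangentSpace (𝓡 n) x)]

theorem contDiffOn_comp_chart (hf : ContMDiff (𝓡 n) 𝓘(ℝ, ℝ) ∞ f) (x₀ : M) :
    ContDiffOn ℝ ∞ (f ∘ (extChartAt (𝓡 n) x₀).symm) (extChartAt (𝓡 n) x₀).target :=
  (hf.comp_contMDiffOn (contMDiffOn_extChartAt_symm x₀)).contDiffOn

/-- A smooth function times a test function supported in the open set where it is smooth. -/
theorem contDiff_mul_test {E : Type*} [NormedAddCommGroup E] [NormedSpace ℝ E] {U : Set E}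
    (hU : IsOpen U) {F ψ : E → ℝ} (hF : ContDiffOn ℝ ∞ F U) (hψ : ContDiff ℝ ∞ ψ)
    (hs : tsupport ψ ⊆ U) : ContDiff ℝ ∞ (fun u ↦ F u * ψ u) := by
  rw [contDiff_iff_contDiffAt]
  intro u
  by_cases hu : u ∈ tsupport ψ
  · exact ((hF u (hs hu)).contDiffAt (hU.mem_nhds (hs hu))).mul hψ.contDiffAt
  · have : (fun u ↦ F u * ψ u) =ᶠ[𝓝 u] fun _ ↦ 0 := by
      filter_upwards [(notMem_tsupport_iff_eventuallyEq.1 hu)] with v hv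
      rw [hv, Pi.zero_apply, mul_zero]
    exact contDiffAt_const.congr_of_eventuallyEq this

theorem fderiv_mul_test {E : Type*} [NormedAddCommGroup E] [NormedSpace ℝ E] {U : Set E}
    (hU : IsOpen U) {F ψ : E → ℝ} (hF : ContDiffOn ℝ ∞ F U) (hψ : ContDiff ℝ ∞ ψ)
    (hs : tsupport ψ ⊆ U) (u v : E) :
    fderiv ℝ (fun u ↦ F u * ψ u) u v = F u * fderiv ℝ ψ u v + fderiv ℝ F u v * ψ u := by
  by_cases hu : u ∈ tsupport ψ
  · have h1 : DifferentiableAt ℝ F u :=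
      ((hF u (hs hu)).contDiffAt (hU.mem_nhds (hs hu))).differentiableAt (by simp)
    have h2 : DifferentiableAt ℝ ψ u := hψ.differentiable (by simp) u
    rw [fderiv_fun_mul h1 h2]
    simp [mul_comm]
  · have h0 := notMem_tsupport_iff_eventuallyEq.1 hu
    have : (fun u ↦ F u * ψ u) =ᶠ[𝓝 u] fun _ ↦ 0 := by
      filter_upwards [h0] with v hv
      rw [hv, Pi.zero_apply, mul_zero]
    have h3 : fderiv ℝ ψ u = 0 := by
      rw [h0.fderiv_eq]
      exact fderiv_const_apply (0 : ℝ)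
    rw [this.fderiv_eq, h3, h0.eq_of_nhds]
    simp

variable [MeasurableSpace M] [BorelSpace M]

theorem continuousOn_coordComp_grad (hf : ContMDiff (𝓡 n) 𝓘(ℝ, ℝ) ∞ f) (x₀ : M) (i : Fin n) :
    ContinuousOn (coordComp (grad n f) x₀ i) (extChartAt (𝓡 n) x₀).target :=
  (((contDiffOn_comp_chart hf x₀).continuousOn_fderiv_of_isOpen (isOpen_extChartAt_target x₀)
    (by simp)).clm_apply continuousOn_const).congr fun _ hu ↦ coordComp_grad hf x₀ i hu

/-- The gradient of a smooth function is its distributional gradient. -/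
theorem isWeakGradient_grad (hf : ContMDiff (𝓡 n) 𝓘(ℝ, ℝ) ∞ f) :
    IsWeakGradient f (grad n f) := by
  have hU (x₀ : M) := isOpen_extChartAt_target (I := 𝓡 n) x₀
  have hl (x₀ : M) : LocallyIntegrableOn (f ∘ (extChartAt (𝓡 n) x₀).symm)
      (extChartAt (𝓡 n) x₀).target :=
    (contDiffOn_comp_chart hf x₀).continuousOn.locallyIntegrableOn (hU x₀).measurableSet
  have hl' (x₀ : M) (i : Fin n) : LocallyIntegrableOn (coordComp (grad n f) x₀ i)
      (extChartAt (𝓡 n) x₀).target :=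
    (continuousOn_coordComp_grad hf x₀ i).locallyIntegrableOn (hU x₀).measurableSet
  refine ⟨hl, hl', fun x₀ i ψ hψ hc hs ↦ ?_⟩
  set F := f ∘ (extChartAt (𝓡 n) x₀).symm with hF
  have hFd := contDiffOn_comp_chart hf x₀
  have e (u) : coordComp (grad n f) x₀ i u * ψ u =
      fderiv ℝ F u (EuclideanSpace.single i 1) * ψ u := by
    by_cases hu : u ∈ (extChartAt (𝓡 n) x₀).target
    · rw [coordComp_grad hf x₀ i hu]
    · rw [image_eq_zero_of_notMem_tsupport fun h ↦ hu (hs h), mul_zero, mul_zero]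
  have i1 := integrable_mul_test (hl' x₀ i) hψ.continuous hc hs
  simp only [e] at i1 ⊢
  refine integral_mul_fderiv_eq_neg_fderiv_mul_of_integrable i1 ?_ ?_ (fun u hu ↦ ?_)
    (fun u _ ↦ hψ.differentiable (by simp) u)
  · exact integrable_mul_test (hl x₀)
      ((hψ.continuous_fderiv (by simp)).clm_apply continuous_const) (hc.fderiv_apply (𝕜 := ℝ) _)
      ((tsupport_fderiv_apply ψ _).trans hs)
  · exact integrable_mul_test (hl x₀) hψ.continuous hc hs
  · exact ((hFd u (hs hu)).contDiffAt ((hU x₀).mem_nhds (hs hu))).differentiableAt (by simp)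

theorem locallyIntegrableOn_continuousOn_mul {U : Set (EuclideanSpace ℝ (Fin n))} (hU : IsOpen U)
    {a b : EuclideanSpace ℝ (Fin n) → ℝ} (ha : ContinuousOn a U) (hb : LocallyIntegrableOn b U) :
    LocallyIntegrableOn (fun u ↦ a u * b u) U := by
  rw [locallyIntegrableOn_iff hU.isLocallyClosed] at hb ⊢
  exact fun K hK hKc ↦ (hb K hK hKc).continuousOn_mul (ha.mono hK) hKc

/-- The Leibniz rule for the product with a smooth function. -/
theorem IsWeakGradient.smooth_mul (h : IsWeakGradient f G) (hη : ContMDiff (𝓡 n) 𝓘(ℝ, ℝ) ∞ η) :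
    IsWeakGradient (fun x ↦ η x * f x) (fun x ↦ η x • G x + f x • grad n η x) := by
  have hU (x₀ : M) := isOpen_extChartAt_target (I := 𝓡 n) x₀
  have hc (x₀ : M) (i : Fin n) : coordComp (fun x ↦ η x • G x + f x • grad n η x) x₀ i =
      (fun u ↦ (η ∘ (extChartAt (𝓡 n) x₀).symm) u * coordComp G x₀ i u) +
      fun u ↦ coordComp (grad n η) x₀ i u * (f ∘ (extChartAt (𝓡 n) x₀).symm) u := by
    funext u
    refine (inner_add_left _ _ _).trans ?_
    refine (congrArg₂ (· + ·) (real_inner_smul_left _ _ _) (real_inner_smul_left _ _ _)).trans ?_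
    simp only [Pi.add_apply, Function.comp, coordComp]
    ring
  refine ⟨fun x₀ ↦ ?_, fun x₀ i ↦ ?_, fun x₀ i ψ hψ hψc hs ↦ ?_⟩
  · exact locallyIntegrableOn_continuousOn_mul (hU x₀) (contDiffOn_comp_chart hη x₀).continuousOn
      (h.locallyIntegrableOn x₀)
  · rw [hc]
    exact (locallyIntegrableOn_continuousOn_mul (hU x₀) (contDiffOn_comp_chart hη x₀).continuousOn
      (h.locallyIntegrableOn_comp x₀ i)).add (locallyIntegrableOn_continuousOn_mul (hU x₀)
      (continuousOn_coordComp_grad hη x₀ i) (h.locallyIntegrableOn x₀))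
  · set θ := η ∘ (extChartAt (𝓡 n) x₀).symm with hθ
    have hθd := contDiffOn_comp_chart hη x₀
    have hsub : tsupport (fun u ↦ θ u * ψ u) ⊆ tsupport ψ := tsupport_mul_subset_right
    -- test the distributional gradient of `f` with `θ ψ` and expand `∂ᵢ(θ ψ) = θ ∂ᵢψ + ψ ∂ᵢθ`
    have key := h.integral_eq x₀ i (fun u ↦ θ u * ψ u)
      (contDiff_mul_test (hU x₀) hθd hψ hs) hψc.mul_left (hsub.trans hs)
    have i1 := integrable_mul_test (locallyIntegrableOn_continuousOn_mul (hU x₀)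
      hθd.continuousOn (h.locallyIntegrableOn x₀))
      ((hψ.continuous_fderiv (by simp)).clm_apply (continuous_const
        (y := EuclideanSpace.single i (1 : ℝ)))) (hψc.fderiv_apply (𝕜 := ℝ) _)
      ((tsupport_fderiv_apply ψ _).trans hs)
    have i2 := integrable_mul_test (locallyIntegrableOn_continuousOn_mul (hU x₀)
      (continuousOn_coordComp_grad hη x₀ i) (h.locallyIntegrableOn x₀)) hψ.continuous hψc hs
    have i3 := integrable_mul_test (locallyIntegrableOn_continuousOn_mul (hU x₀)
      hθd.continuousOn (h.locallyIntegrableOn_comp x₀ i)) hψ.continuous hψc hs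
    have e1 (u) : f ((extChartAt (𝓡 n) x₀).symm u) *
        fderiv ℝ (fun u ↦ θ u * ψ u) u (EuclideanSpace.single i 1) =
        θ u * (f ∘ (extChartAt (𝓡 n) x₀).symm) u * fderiv ℝ ψ u (EuclideanSpace.single i 1) +
        coordComp (grad n η) x₀ i u * (f ∘ (extChartAt (𝓡 n) x₀).symm) u * ψ u := by
      rw [fderiv_mul_test (hU x₀) hθd hψ hs]
      by_cases hu : u ∈ (extChartAt (𝓡 n) x₀).target
      · rw [coordComp_grad hη x₀ i hu]
        simp only [Function.comp, hθ]
        ring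
      · rw [image_eq_zero_of_notMem_tsupport fun h ↦ hu (hs h)]
        simp only [Function.comp, hθ]
        ring
    have e2 (u) : coordComp (fun x ↦ η x • G x + f x • grad n η x) x₀ i u * ψ u =
        θ u * coordComp G x₀ i u * ψ u +
        coordComp (grad n η) x₀ i u * (f ∘ (extChartAt (𝓡 n) x₀).symm) u * ψ u := by
      rw [hc, Pi.add_apply, add_mul]
    simp only [e1] at key
    simp only [e2]
    rw [integral_add i1 i2] at key
    rw [integral_add i3 i2]
    have e3 : ∫ u, θ u * coordComp G x₀ i u * ψ u = ∫ u, coordComp G x₀ i u * (θ u * ψ u) :=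
      integral_congr_ae (Filter.Eventually.of_forall fun u ↦ by ring)
    have e4 : ∫ u, η ((extChartAt (𝓡 n) x₀).symm u) * f ((extChartAt (𝓡 n) x₀).symm u) *
        fderiv ℝ ψ u (EuclideanSpace.single i 1) = ∫ u, θ u * (f ∘ (extChartAt (𝓡 n) x₀).symm) u *
          fderiv ℝ ψ u (EuclideanSpace.single i 1) := rfl
    rw [e3, e4]
    linarith

theorem exists_norm_grad_le_of_isCompact (hf : ContMDiff (𝓡 n) 𝓘(ℝ, ℝ) ∞ f) {S : Set M}
    (hS : IsCompact S) : ∃ B : ℝ, ∀ x ∈ S, ‖grad n f x‖ ≤ B := by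
  refine hS.induction_on (p := fun S ↦ ∃ B : ℝ, ∀ x ∈ S, ‖grad n f x‖ ≤ B) ⟨0, by simp⟩
    (fun s t hst ⟨B, hB⟩ ↦ ⟨B, fun x hx ↦ hB x (hst hx)⟩) ?_ fun x₀ _ ↦ ?_
  · rintro s t ⟨B, hB⟩ ⟨B', hB'⟩
    refine ⟨max B B', fun x hx ↦ hx.elim (fun h ↦ (hB x h).trans (le_max_left _ _))
      (fun h ↦ (hB' x h).trans (le_max_right _ _))⟩
  · obtain ⟨K, hK, hKt, hKn⟩ := exists_compact_chart_nhds (n := n) x₀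
    obtain ⟨C, hC, hCK⟩ := exists_norm_le_sum_coordComp x₀ hK hKt
    have hb (i : Fin n) : ∃ B : ℝ, ∀ u ∈ K, |coordComp (grad n f) x₀ i u| ≤ B := by
      obtain ⟨B, hB⟩ := hK.exists_bound_of_continuousOn
        ((continuousOn_coordComp_grad hf x₀ i).mono hKt)
      exact ⟨B, hB⟩
    choose B hB using hb
    refine ⟨_, nhdsWithin_le_nhds hKn, C * ∑ i, B i, ?_⟩
    rintro _ ⟨u, hu, rfl⟩
    exact (hCK (grad n f) u hu).trans
      (mul_le_mul_of_nonneg_left (Finset.sum_le_sum fun i _ ↦ hB i u hu) hC)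

theorem grad_eq_zero_of_eventuallyEq (c : ℝ) {x : M} (h : f =ᶠ[𝓝 x] fun _ ↦ c) :
    grad n f x = 0 := by
  have : CompleteSpace (TangentSpace (𝓡 n) x) := FiniteDimensional.complete ℝ _
  have h1 : mfderiv (𝓡 n) 𝓘(ℝ, ℝ) f x = 0 := by
    rw [h.mfderiv_eq]; exact mfderiv_const
  exact (congrArg (InnerProductSpace.toDual ℝ (TangentSpace (𝓡 n) x)).symm h1).trans
    (map_zero (InnerProductSpace.toDual ℝ (TangentSpace (𝓡 n) x)).symm)

theorem exists_norm_grad_le (hf : ContMDiff (𝓡 n) 𝓘(ℝ, ℝ) ∞ f) (hc : HasCompactSupport f) :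
    ∃ B : ℝ, 0 ≤ B ∧ ∀ x, ‖grad n f x‖ ≤ B := by
  obtain ⟨B, hB⟩ := exists_norm_grad_le_of_isCompact hf hc
  refine ⟨|B|, abs_nonneg _, fun x ↦ ?_⟩
  by_cases hx : x ∈ tsupport f
  · exact (hB x hx).trans (le_abs_self _)
  · rw [grad_eq_zero_of_eventuallyEq 0 (notMem_tsupport_iff_eventuallyEq.1 hx), norm_zero]
    exact abs_nonneg _

end WeakGradient

/-! ### The norm of `H¹_{p,V}` -/

section SobolevSpace
open Filter
variable {n : ℕ} {M : Type*} [MetricSpace M] [ChartedSpace (EuclideanSpace ℝ (Fin n)) M]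
variable [RiemannianBundle (fun x : M ↦ TangentSpace (𝓡 n) x)]
variable {f f' η : M → ℝ} {G G' : ∀ x : M, TangentSpace (𝓡 n) x}
variable [IsManifold (𝓡 n) ∞ M]
  [IsContMDiffRiemannianBundle (𝓡 n) ∞ (EuclideanSpace ℝ (Fin n)) (fun x : M ↦ TangentSpace (𝓡 n) x)]
variable [MeasurableSpace M] [BorelSpace M] [SecondCountableTopology M]
variable {V : M → ℝ} {p : ℝ≥0∞}

theorem sobolevNorm_le_of_eLpNorm_le {ε : ℝ} (hε : 0 ≤ ε)
    (h1 : eLpNorm f p (riemannianMeasure n M) ≤ ENNReal.ofReal ε)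
    (h2 : eLpNorm (fun x ↦ ‖G x‖) p (riemannianMeasure n M) ≤ ENNReal.ofReal ε)
    (h3 : eLpNorm (fun x ↦ V x * f x) p (riemannianMeasure n M) ≤ ENNReal.ofReal ε) :
    sobolevNorm V p f G ≤ 3 * ε := by
  have h {a : ℝ≥0∞} (ha : a ≤ ENNReal.ofReal ε) : a.toReal ≤ ε :=
    ENNReal.toReal_le_of_le_ofReal hε ha
  unfold sobolevNorm
  linarith [h h1, h h2, h h3]

theorem tendsto_sobolevNorm_zero {F : ℕ → M → ℝ} {Γ : ℕ → ∀ x : M, TangentSpace (𝓡 n) x}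
    (h1 : Tendsto (fun j ↦ eLpNorm (F j) p (riemannianMeasure n M)) atTop (𝓝 0))
    (h2 : Tendsto (fun j ↦ eLpNorm (fun x ↦ ‖Γ j x‖) p (riemannianMeasure n M)) atTop (𝓝 0))
    (h3 : Tendsto (fun j ↦ eLpNorm (fun x ↦ V x * F j x) p (riemannianMeasure n M)) atTop (𝓝 0)) :
    Tendsto (fun j ↦ sobolevNorm V p (F j) (Γ j)) atTop (𝓝 0) := by
  have h {a : ℕ → ℝ≥0∞} (ha : Tendsto a atTop (𝓝 0)) :
      Tendsto (fun j ↦ (a j).toReal) atTop (𝓝 0) :=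
    (ENNReal.tendsto_toReal ENNReal.zero_ne_top).comp ha
  simpa [sobolevNorm] using ((h h1).add (h h2)).add (h h3)

theorem MemSobolev.smooth_mul (hw : IsWeakGradient f G) (hm : MemSobolev V p f G)
    (hη : ContMDiff (𝓡 n) 𝓘(ℝ, ℝ) ∞ η) {B : ℝ} (hB : ∀ x, |η x| ≤ B)
    (hB' : ∀ x, ‖grad n η x‖ ≤ B) :
    MemSobolev V p (fun x ↦ η x * f x) (fun x ↦ η x • G x + f x • grad n η x) := by
  have hηm : AEStronglyMeasurable η (riemannianMeasure n M) := hη.continuous.aestronglyMeasurable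
  refine ⟨hm.memLp.of_le_mul (c := B) (hηm.mul hm.memLp.1) (Eventually.of_forall fun x ↦ ?_),
    ((hm.memLp_grad.const_mul B).add (hm.memLp.norm.const_mul B)).mono
      (hw.smooth_mul hη).aestronglyMeasurable_norm (Eventually.of_forall fun x ↦ ?_), ?_⟩
  · rw [norm_mul]
    exact mul_le_mul_of_nonneg_right (hB x) (norm_nonneg _)
  · rw [norm_norm, Pi.add_apply]
    refine ((norm_add_le _ _).trans (add_le_add ?_ ?_)).trans (le_abs_self _)
    · rw [norm_smul]
      exact mul_le_mul_of_nonneg_right (hB x) (norm_nonneg _)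
    · rw [norm_smul, mul_comm]
      exact mul_le_mul_of_nonneg_right (hB' x) (norm_nonneg _)
  · have e : (fun x ↦ V x * (η x * f x)) = fun x ↦ η x * (V x * f x) := by
      funext x; ring
    rw [e]
    refine hm.memLp_mul.of_le_mul (c := B) (hηm.mul hm.memLp_mul.1)
      (Eventually.of_forall fun x ↦ ?_)
    rw [norm_mul]
    exact mul_le_mul_of_nonneg_right (hB x) (norm_nonneg _)

/-- The element of `H¹_{p,V}` given by a function `f` with distributional gradient `G`. -/
def SobolevH.mk (hw : IsWeakGradient f G) (hm : MemSobolev V p f G) : SobolevH n V p :=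
  ⟨hm.memLp.toLp f, G, hw.congr hm.memLp.coeFn_toLp.symm,
    hm.congr hm.memLp.coeFn_toLp.symm (Eventually.of_forall fun _ ↦ rfl)⟩

theorem SobolevH.coeFn_mk (hw : IsWeakGradient f G) (hm : MemSobolev V p f G) :
    (SobolevH.mk hw hm).toLp =ᵐ[riemannianMeasure n M] f := hm.memLp.coeFn_toLp

theorem SobolevH.ext_ae {h h' : SobolevH n V p}
    (e : h.toLp =ᵐ[riemannianMeasure n M] h'.toLp) : h = h' := Subtype.ext (Lp.ext e)

theorem SobolevH.coeFn_sub (h h' : SobolevH n V p) (hf : h.toLp =ᵐ[riemannianMeasure n M] f)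
    (hf' : h'.toLp =ᵐ[riemannianMeasure n M] f') :
    (h - h').toLp =ᵐ[riemannianMeasure n M] fun x ↦ f x - f' x := by
  rw [map_sub]
  filter_upwards [Lp.coeFn_sub h.toLp h'.toLp, hf, hf'] with x h1 h2 h3
  rw [h1, Pi.sub_apply, h2, h3]

theorem SobolevH.coeFn_sum {ι : Type*} (s : Finset ι) (h : ι → SobolevH n V p) :
    (∑ j ∈ s, h j).toLp =ᵐ[riemannianMeasure n M] fun x ↦ ∑ j ∈ s, (h j).toLp x := by
  rw [map_sum]
  exact Lp.coeFn_fun_finsetSum _ _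

variable [Fact (1 ≤ p)]

theorem SobolevH.norm_eq {h : SobolevH n V p} (hf : h.toLp =ᵐ[riemannianMeasure n M] f)
    (hw : IsWeakGradient f G) : ‖h‖ = sobolevNorm V p f G :=
  sobolevNorm_congr hf (h.isWeakGradient.unique (hw.congr hf.symm))

theorem SobolevH.norm_sub_eq {h h' : SobolevH n V p} (hf : h.toLp =ᵐ[riemannianMeasure n M] f)
    (hw : IsWeakGradient f G) (hf' : h'.toLp =ᵐ[riemannianMeasure n M] f')
    (hw' : IsWeakGradient f' G') :
    ‖h - h'‖ = sobolevNorm V p (fun x ↦ f x - f' x) (fun x ↦ G x - G' x) :=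
  SobolevH.norm_eq (SobolevH.coeFn_sub h h' hf hf') (hw.sub hw')

end SobolevSpace

/-! ### Completeness of `H¹_{p,V}` -/

section Completeness
open Filter

/-- Minkowski's inequality for series of nonnegative functions. -/
theorem eLpNorm_tsum_le {α : Type*} [MeasurableSpace α] {μ : Measure α} {p : ℝ≥0∞} (hp1 : 1 ≤ p)
    {b : ℕ → α → ℝ} (hb : ∀ j, AEStronglyMeasurable (b j) μ) (hb0 : ∀ j x, 0 ≤ b j x)
    (hs : ∑' j, eLpNorm (b j) p μ ≠ ⊤) :
    eLpNorm (fun x ↦ ∑' j, b j x) p μ ≤ ∑' j, eLpNorm (b j) p μ := by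
  have h1 := summable_norm_of_tsum_eLpNorm_ne_top hp1 hb hs
  refine (Lp.eLpNorm_lim_le_liminf_eLpNorm (f := fun k x ↦ ∑ j ∈ Finset.range k, b j x)
    (fun k ↦ Finset.aestronglyMeasurable_fun_sum _ fun j _ ↦ hb j) _ ?_).trans ?_
  · filter_upwards [h1] with x hx
    have : Summable fun j ↦ b j x := by
      refine hx.congr fun j ↦ ?_
      rw [Real.norm_of_nonneg (hb0 j x)]
    exact this.hasSum.tendsto_sum_nat
  · refine liminf_le_of_le ?_ fun B hB ↦ ?_
    · isBoundedDefault
    · obtain ⟨k, hk⟩ := hB.exists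
      refine hk.trans ((?_ : _ ≤ ∑ j ∈ Finset.range k, eLpNorm (b j) p μ).trans
        (ENNReal.sum_le_tsum _))
      have := eLpNorm_sum_le (s := Finset.range k) (fun j _ ↦ hb j) hp1
      refine le_trans (le_of_eq ?_) this
      congr 1
      funext x
      simp

/-- The remainders of an absolutely convergent series of `L_p` functions tend to zero. -/
theorem tendsto_eLpNorm_tsum_tail {α : Type*} [MeasurableSpace α] {μ : Measure α} {p : ℝ≥0∞}
    (hp1 : 1 ≤ p) {b : ℕ → α → ℝ} (hb : ∀ j, AEStronglyMeasurable (b j) μ) (hb0 : ∀ j x, 0 ≤ b j x)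
    (hs : ∑' j, eLpNorm (b j) p μ ≠ ⊤) :
    Tendsto (fun k ↦ eLpNorm (fun x ↦ ∑' j, b (j + k) x) p μ) atTop (𝓝 0) := by
  refine tendsto_of_tendsto_of_tendsto_of_le_of_le tendsto_const_nhds
    (ENNReal.tendsto_sum_nat_add (fun j ↦ eLpNorm (b j) p μ) hs) (fun k ↦ zero_le) fun k ↦ ?_
  refine eLpNorm_tsum_le hp1 (fun j ↦ hb _) (fun j ↦ hb0 _) (ne_top_of_le_ne_top hs ?_)
  exact ENNReal.tsum_comp_le_tsum_of_injective (add_left_injective k) _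

theorem norm_tsum_sub_sum_le {E : Type*} [NormedAddCommGroup E] [CompleteSpace E] {u : ℕ → E}
    (hu : Summable fun j ↦ ‖u j‖) (k : ℕ) :
    ‖∑' j, u j - ∑ j ∈ Finset.range k, u j‖ ≤ ∑' j, ‖u (j + k)‖ := by
  rw [← hu.of_norm.sum_add_tsum_nat_add k, add_sub_cancel_left]
  exact norm_tsum_le_tsum_norm ((summable_nat_add_iff k).2 hu)

/-- Convergence in `L_p` on a compact set implies convergence of the integrals against a continuous
function supported there, by Hölder on a set of finite measure. -/
theorem tendsto_integral_mul_of_eLpNorm {n : ℕ} {K : Set (EuclideanSpace ℝ (Fin n))} {p : ℝ≥0∞}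
    (hp1 : 1 ≤ p) (hK : IsCompact K) {h : ℕ → EuclideanSpace ℝ (Fin n) → ℝ}
    {h' θ : EuclideanSpace ℝ (Fin n) → ℝ}
    (hθ : Continuous θ) (hs : Function.support θ ⊆ K) (hh : ∀ j, IntegrableOn (h j) K)
    (hh' : IntegrableOn h' K)
    (hlim : Tendsto (fun j ↦ eLpNorm (fun u ↦ h j u - h' u) p (volume.restrict K)) atTop (𝓝 0)) :
    Tendsto (fun j ↦ ∫ u, h j u * θ u) atTop (𝓝 (∫ u, h' u * θ u)) := by
  have e (a : EuclideanSpace ℝ (Fin n) → ℝ) : ∫ u, a u * θ u = ∫ u in K, a u * θ u := by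
    refine (setIntegral_eq_integral_of_forall_compl_eq_zero fun u hu ↦ ?_).symm
    have : θ u = 0 := by
      by_contra h0; exact hu (hs h0)
    rw [this, mul_zero]
  simp only [e]
  have hfin : IsFiniteMeasure (volume.restrict K) :=
    ⟨by rw [Measure.restrict_apply_univ]; exact hK.measure_lt_top⟩
  obtain ⟨B, hB⟩ := hK.exists_bound_of_continuousOn hθ.continuousOn
  have hi (a : EuclideanSpace ℝ (Fin n) → ℝ) (ha : IntegrableOn a K) :
      IntegrableOn (fun u ↦ a u * θ u) K := ha.mul_continuousOn hθ.continuousOn hK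
  refine tendsto_integral_of_L1' _ (hi _ hh').1 (Eventually.of_forall fun j ↦ hi _ (hh j)) ?_
  have h2 : Tendsto (fun j ↦ ENNReal.ofReal B * (eLpNorm (fun u ↦ h j u - h' u) p
      (volume.restrict K) * (volume.restrict K) univ ^ (1 / (1 : ℝ≥0∞).toReal - 1 / p.toReal)))
      atTop (𝓝 0) := by
    have hc : (volume.restrict K) univ ^ (1 / (1 : ℝ≥0∞).toReal - 1 / p.toReal) ≠ ⊤ := by
      refine (ENNReal.rpow_lt_top_of_nonneg ?_ (measure_ne_top _ _)).ne
      rw [ENNReal.toReal_one, div_one, sub_nonneg]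
      rcases eq_or_ne p ⊤ with rfl | hp
      · simp
      · rw [div_le_one (ENNReal.toReal_pos (zero_lt_one.trans_le hp1).ne' hp),
          ← ENNReal.toReal_one]
        exact ENNReal.toReal_mono hp hp1
    have := ENNReal.Tendsto.const_mul (ENNReal.Tendsto.mul_const hlim (Or.inr hc))
      (Or.inr (ENNReal.ofReal_ne_top (r := B)))
    simpa using this
  refine tendsto_of_tendsto_of_tendsto_of_le_of_le tendsto_const_nhds h2 (fun j ↦ zero_le)
    fun j ↦ ?_
  refine le_trans ?_ (mul_le_mul_right (eLpNorm_le_eLpNorm_mul_rpow_measure_univ hp1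
    ((hh j).1.sub hh'.1)) _)
  refine eLpNorm_le_mul_eLpNorm_of_ae_le_mul ?_ 1
  filter_upwards [ae_restrict_mem hK.measurableSet] with u hu
  rw [Pi.sub_apply, ← sub_mul, norm_mul, mul_comm]
  exact mul_le_mul_of_nonneg_right (hB u hu) (norm_nonneg _)

variable {n : ℕ} {M : Type*} [MetricSpace M] [ChartedSpace (EuclideanSpace ℝ (Fin n)) M]
variable [RiemannianBundle (fun x : M ↦ TangentSpace (𝓡 n) x)]
variable {f f' η : M → ℝ} {G G' : ∀ x : M, TangentSpace (𝓡 n) x}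
variable [IsManifold (𝓡 n) ∞ M]
  [IsContMDiffRiemannianBundle (𝓡 n) ∞ (EuclideanSpace ℝ (Fin n)) (fun x : M ↦ TangentSpace (𝓡 n) x)]
variable [MeasurableSpace M] [BorelSpace M]
variable {V : M → ℝ} {p : ℝ≥0∞}

theorem memLp_chart (hp : p ≠ ⊤) {K : Set (EuclideanSpace ℝ (Fin n))} (x₀ : M) (hK : IsCompact K)
    (hKt : K ⊆ (extChartAt (𝓡 n) x₀).target) {k : M → ℝ} (hk : MemLp k p (riemannianMeasure n M)) :
    MemLp (k ∘ (extChartAt (𝓡 n) x₀).symm) p (volume.restrict K) := by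
  obtain ⟨C, hC⟩ := exists_eLpNorm_chart_le (p := p) hp x₀ hK hKt
  refine ⟨?_, (hC k hk.1).trans_lt (ENNReal.mul_lt_top ENNReal.coe_lt_top hk.2)⟩
  obtain ⟨c, hc⟩ := restrict_le_smul_chartVolume x₀ hK hKt
  have h1 : AEStronglyMeasurable (k ∘ (extChartAt (𝓡 n) x₀).symm) (chartVolume x₀) :=
    (hk.1.mono_measure (chartMeasure_le x₀)).comp_aemeasurable (aemeasurable_chart_symm x₀)
  exact (h1.smul_measure (c : ℝ≥0∞)).mono_measure hc

theorem exists_eLpNorm_coordComp_le (hp : p ≠ ⊤) {K : Set (EuclideanSpace ℝ (Fin n))} (x₀ : M)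
    (hK : IsCompact K) (hKt : K ⊆ (extChartAt (𝓡 n) x₀).target) :
    ∃ C : ℝ≥0, ∀ (G : ∀ x : M, TangentSpace (𝓡 n) x) (i : Fin n),
      AEStronglyMeasurable (fun x ↦ ‖G x‖) (riemannianMeasure n M) →
      eLpNorm (coordComp G x₀ i) p (volume.restrict K) ≤
        C * eLpNorm (fun x ↦ ‖G x‖) p (riemannianMeasure n M) := by
  obtain ⟨C, hC⟩ := exists_eLpNorm_chart_le (p := p) hp x₀ hK hKt
  obtain ⟨B, hB, hBK⟩ := exists_coordComp_le_norm x₀ hK hKt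
  refine ⟨B.toNNReal * C, fun G i hG ↦ ?_⟩
  rw [ENNReal.coe_mul, mul_assoc]
  refine le_trans ?_ (mul_le_mul_right (hC _ hG) _)
  refine eLpNorm_le_mul_eLpNorm_of_ae_le_mul ?_ p
  filter_upwards [ae_restrict_mem hK.measurableSet] with u hu
  refine (hBK G i u hu).trans (le_of_eq ?_)
  exact congrArg (B * ·) (norm_norm _).symm

theorem memLp_coordComp_chart (hp : p ≠ ⊤) {K : Set (EuclideanSpace ℝ (Fin n))} (x₀ : M)
    (hK : IsCompact K) (hKt : K ⊆ (extChartAt (𝓡 n) x₀).target) (i : Fin n)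
    (hGm : AEStronglyMeasurable (coordComp G x₀ i) (volume.restrict K))
    (hG : MemLp (fun x ↦ ‖G x‖) p (riemannianMeasure n M)) :
    MemLp (coordComp G x₀ i) p (volume.restrict K) := by
  obtain ⟨C, hC⟩ := exists_eLpNorm_coordComp_le (p := p) hp x₀ hK hKt
  exact ⟨hGm, (hC G i hG.1).trans_lt (ENNReal.mul_lt_top ENNReal.coe_lt_top hG.2)⟩

theorem locallyIntegrableOn_of_memLp (hp1 : 1 ≤ p) {U : Set (EuclideanSpace ℝ (Fin n))}
    (hU : IsOpen U) {h : EuclideanSpace ℝ (Fin n) → ℝ}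
    (hh : ∀ K ⊆ U, IsCompact K → MemLp h p (volume.restrict K)) : LocallyIntegrableOn h U := by
  rw [locallyIntegrableOn_iff hU.isLocallyClosed]
  intro K hK hKc
  have hfin : IsFiniteMeasure (volume.restrict K) :=
    ⟨by rw [Measure.restrict_apply_univ]; exact hKc.measure_lt_top⟩
  exact (hh K hK hKc).integrable hp1

variable [SecondCountableTopology M]

/-- The distributional gradient is a closed operator for convergence in `L_p`. -/
theorem IsWeakGradient.of_tendsto (hp1 : 1 ≤ p) (hp : p ≠ ⊤) {F : ℕ → M → ℝ}
    {Γ : ℕ → ∀ x : M, TangentSpace (𝓡 n) x} (hw : ∀ k, IsWeakGradient (F k) (Γ k))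
    (hf : MemLp f p (riemannianMeasure n M))
    (hF : ∀ k, AEStronglyMeasurable (F k) (riemannianMeasure n M))
    (hlim : Tendsto (fun k ↦ eLpNorm (fun x ↦ F k x - f x) p (riemannianMeasure n M)) atTop (𝓝 0))
    (hΓ : ∀ k, MemLp (fun x ↦ ‖Γ k x‖) p (riemannianMeasure n M))
    (hae : ∀ᵐ x ∂riemannianMeasure n M, Tendsto (fun k ↦ ‖Γ k x - G x‖) atTop (𝓝 0))
    (hlimG : Tendsto (fun k ↦ eLpNorm (fun x ↦ ‖Γ k x - G x‖) p (riemannianMeasure n M))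
      atTop (𝓝 0)) :
    IsWeakGradient f G ∧ MemLp (fun x ↦ ‖G x‖) p (riemannianMeasure n M) := by
  have hU (x₀ : M) := isOpen_extChartAt_target (I := 𝓡 n) x₀
  -- the components of `G` are measurable as almost everywhere limits; this is not part of the
  -- hypotheses
  have hGm (x₀ : M) (i : Fin n) : AEMeasurable (coordComp G x₀ i)
      ((volume : Measure (EuclideanSpace ℝ (Fin n))).restrict (extChartAt (𝓡 n) x₀).target) := by
    refine aemeasurable_of_tendsto_metrizable_ae atTop
      (fun k ↦ ((hw k).locallyIntegrableOn_comp x₀ i).aestronglyMeasurable.aemeasurable) ?_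
    filter_upwards [ae_chart_of_ae hae x₀] with u hu
    rw [tendsto_iff_norm_sub_tendsto_zero]
    have h1 := hu.mul_const ‖coordVec x₀ i u‖
    rw [zero_mul] at h1
    refine squeeze_zero (fun k ↦ norm_nonneg _) (fun k ↦ ?_) h1
    have : coordComp (Γ k) x₀ i u - coordComp G x₀ i u = coordComp (fun x ↦ Γ k x - G x) x₀ i u := by
      rw [coordComp_sub]; rfl
    rw [this]
    exact norm_inner_le_norm _ _
  have hdm (k : ℕ) : AEStronglyMeasurable (fun x ↦ ‖Γ k x - G x‖) (riemannianMeasure n M) := by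
    refine RiemannianSobolev.aestronglyMeasurable_norm fun x₀ i ↦ ?_
    rw [coordComp_sub]
    exact ((hw k).locallyIntegrableOn_comp x₀ i).aestronglyMeasurable.aemeasurable.sub (hGm x₀ i)
  have hGp : MemLp (fun x ↦ ‖G x‖) p (riemannianMeasure n M) := by
    obtain ⟨k, hk⟩ := (hlimG.eventually (gt_mem_nhds (zero_lt_one (α := ℝ≥0∞)))).exists
    have h1 : MemLp (fun x ↦ ‖Γ k x - G x‖) p (riemannianMeasure n M) :=
      ⟨hdm k, hk.trans ENNReal.one_lt_top⟩
    refine ((hΓ k).add h1).mono (RiemannianSobolev.aestronglyMeasurable_norm hGm)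
      (Eventually.of_forall fun x ↦ ?_)
    rw [norm_norm, Pi.add_apply]
    refine le_trans ?_ (le_abs_self _)
    calc ‖G x‖ = ‖Γ k x - (Γ k x - G x)‖ := by rw [sub_sub_cancel]
      _ ≤ _ := norm_sub_le _ _
  refine ⟨?_, hGp⟩
  have hfl (x₀ : M) : LocallyIntegrableOn (f ∘ (extChartAt (𝓡 n) x₀).symm)
      (extChartAt (𝓡 n) x₀).target :=
    locallyIntegrableOn_of_memLp hp1 (hU x₀) fun K hK hKc ↦ memLp_chart hp x₀ hKc hK hf
  have hGl (x₀ : M) (i : Fin n) : LocallyIntegrableOn (coordComp G x₀ i)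
      (extChartAt (𝓡 n) x₀).target :=
    locallyIntegrableOn_of_memLp hp1 (hU x₀) fun K hK hKc ↦ memLp_coordComp_chart hp x₀ hKc hK i
      ((hGm x₀ i).aestronglyMeasurable.mono_measure (Measure.restrict_mono hK le_rfl)) hGp
  refine ⟨hfl, hGl, fun x₀ i ψ hψ hψc hs ↦ ?_⟩
  -- pass to the limit on both sides of the defining identity
  have hKt : tsupport ψ ⊆ (extChartAt (𝓡 n) x₀).target := hs
  obtain ⟨C, hC⟩ := exists_eLpNorm_chart_le (p := p) hp x₀ hψc hKt
  obtain ⟨B, hB⟩ := exists_eLpNorm_coordComp_le (p := p) hp x₀ hψc hKt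
  have t0 {a : ℕ → ℝ≥0∞} (c : ℝ≥0) (ha : Tendsto a atTop (𝓝 0)) :
      Tendsto (fun k ↦ c * a k) atTop (𝓝 0) := by
    simpa using ENNReal.Tendsto.const_mul ha (Or.inr (ENNReal.coe_ne_top (r := c)))
  have l1 : Tendsto (fun k ↦ ∫ u, F k ((extChartAt (𝓡 n) x₀).symm u) *
      fderiv ℝ ψ u (EuclideanSpace.single i 1)) atTop
      (𝓝 (∫ u, f ((extChartAt (𝓡 n) x₀).symm u) * fderiv ℝ ψ u (EuclideanSpace.single i 1))) := by
    refine tendsto_integral_mul_of_eLpNorm (p := p)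
      (h := fun k ↦ F k ∘ (extChartAt (𝓡 n) x₀).symm) (h' := f ∘ (extChartAt (𝓡 n) x₀).symm) hp1 hψc
      ((hψ.continuous_fderiv (by simp)).clm_apply continuous_const)
      ((subset_tsupport _).trans (tsupport_fderiv_apply ψ _))
      (fun k ↦ ((hw k).locallyIntegrableOn x₀).integrableOn_compact_subset hKt hψc)
      ((hfl x₀).integrableOn_compact_subset hKt hψc) ?_
    exact tendsto_of_tendsto_of_tendsto_of_le_of_le tendsto_const_nhds (t0 C hlim)
      (fun k ↦ zero_le) fun k ↦ hC (fun x ↦ F k x - f x) ((hF k).sub hf.1)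
  have l2 : Tendsto (fun k ↦ ∫ u, coordComp (Γ k) x₀ i u * ψ u) atTop
      (𝓝 (∫ u, coordComp G x₀ i u * ψ u)) := by
    refine tendsto_integral_mul_of_eLpNorm (p := p) hp1 hψc hψ.continuous (subset_tsupport _)
      (fun k ↦ ((hw k).locallyIntegrableOn_comp x₀ i).integrableOn_compact_subset hKt hψc)
      ((hGl x₀ i).integrableOn_compact_subset hKt hψc) ?_
    refine tendsto_of_tendsto_of_tendsto_of_le_of_le tendsto_const_nhds (t0 B hlimG)
      (fun k ↦ zero_le) fun k ↦ ?_
    have := hB (fun x ↦ Γ k x - G x) i (hdm k)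
    rwa [coordComp_sub] at this
  simp only [fun k ↦ (hw k).integral_eq x₀ i ψ hψ hψc hs] at l1
  exact tendsto_nhds_unique l1 l2.neg

variable [Fact (1 ≤ p)]

theorem SobolevH.eLpNorm_le_ofReal_norm (h : SobolevH n V p) :
    eLpNorm h.toLp p (riemannianMeasure n M) ≤ ENNReal.ofReal ‖h‖ ∧
    eLpNorm (fun x ↦ ‖weakGrad (n := n) h.toLp x‖) p (riemannianMeasure n M) ≤ ENNReal.ofReal ‖h‖ ∧
    eLpNorm (fun x ↦ V x * h.toLp x) p (riemannianMeasure n M) ≤ ENNReal.ofReal ‖h‖ := by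
  have hm := h.memSobolev
  have h1 := ENNReal.toReal_nonneg (a := eLpNorm h.toLp p (riemannianMeasure n M))
  have h2 := ENNReal.toReal_nonneg
    (a := eLpNorm (fun x ↦ ‖weakGrad (n := n) h.toLp x‖) p (riemannianMeasure n M))
  have h3 := ENNReal.toReal_nonneg
    (a := eLpNorm (fun x ↦ V x * h.toLp x) p (riemannianMeasure n M))
  rw [SobolevH.norm_def, sobolevNorm]
  refine ⟨?_, ?_, ?_⟩
  · exact (ENNReal.le_ofReal_iff_toReal_le hm.memLp.2.ne (by positivity)).2 (by linarith)
  · exact (ENNReal.le_ofReal_iff_toReal_le hm.memLp_grad.2.ne (by positivity)).2 (by linarith)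
  · exact (ENNReal.le_ofReal_iff_toReal_le hm.memLp_mul.2.ne (by positivity)).2 (by linarith)

/-- `H¹_{p,V}` is complete: an absolutely convergent series converges almost everywhere together
with its gradients, in each tangent space, and the distributional gradient is closed. -/
theorem SobolevH.completeSpace (hp : p ≠ ⊤) : CompleteSpace (SobolevH n V p) := by
  have hp1 : 1 ≤ p := Fact.out
  refine NormedAddCommGroup.completeSpace_of_summable_imp_tendsto fun u hu ↦ ?_
  have hsum : ∑' j, ENNReal.ofReal ‖u j‖ ≠ ⊤ := hu.tsum_ofReal_ne_top
  have hs {a : ℕ → ℝ≥0∞} (ha : ∀ j, a j ≤ ENNReal.ofReal ‖u j‖) : ∑' j, a j ≠ ⊤ :=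
    ne_top_of_le_ne_top hsum (ENNReal.tsum_le_tsum ha)
  have hm (j : ℕ) := (u j).memSobolev
  set F : ℕ → M → ℝ := fun j ↦ (u j).toLp with hF
  set Γ : ℕ → ∀ x : M, TangentSpace (𝓡 n) x := fun j ↦ weakGrad (n := n) (F j) with hΓ
  have hw (j : ℕ) : IsWeakGradient (F j) (Γ j) := (u j).isWeakGradient
  have bound (j : ℕ) := (u j).eLpNorm_le_ofReal_norm
  have s1 : ∑' j, eLpNorm (fun x ↦ ‖F j x‖) p (riemannianMeasure n M) ≠ ⊤ :=
    hs fun j ↦ by rw [eLpNorm_norm]; exact (bound j).1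
  have s2 : ∑' j, eLpNorm (fun x ↦ ‖Γ j x‖) p (riemannianMeasure n M) ≠ ⊤ :=
    hs fun j ↦ (bound j).2.1
  have s3 : ∑' j, eLpNorm (fun x ↦ ‖V x * F j x‖) p (riemannianMeasure n M) ≠ ⊤ :=
    hs fun j ↦ by rw [eLpNorm_norm]; exact (bound j).2.2
  have a1 := summable_norm_of_tsum_eLpNorm_ne_top hp1 (fun j ↦ (hm j).memLp.1.norm) s1
  have a2 := summable_norm_of_tsum_eLpNorm_ne_top hp1 (fun j ↦ (hm j).memLp_grad.1) s2
  have a3 := summable_norm_of_tsum_eLpNorm_ne_top hp1 (fun j ↦ (hm j).memLp_mul.1.norm) s3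
  simp only [norm_norm] at a1 a2 a3
  have hcomp (x : M) : CompleteSpace (TangentSpace (𝓡 n) x) := FiniteDimensional.complete ℝ _
  -- the limit is the pointwise sum; where a series is not summable, a null set, `∑'` is `0`
  set f : M → ℝ := fun x ↦ ∑' j, F j x with hf
  set G : ∀ x : M, TangentSpace (𝓡 n) x := fun x ↦ ∑' j, Γ j x with hG
  have tail1 := tendsto_eLpNorm_tsum_tail hp1 (fun j ↦ (hm j).memLp.1.norm)
    (fun j x ↦ norm_nonneg _) s1
  have tail2 := tendsto_eLpNorm_tsum_tail hp1 (fun j ↦ (hm j).memLp_grad.1)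
    (fun j x ↦ norm_nonneg _) s2
  have tail3 := tendsto_eLpNorm_tsum_tail hp1 (fun j ↦ (hm j).memLp_mul.1.norm)
    (fun j x ↦ norm_nonneg _) s3
  have hFm (k : ℕ) : AEStronglyMeasurable (fun x ↦ ∑ j ∈ Finset.range k, F j x)
      (riemannianMeasure n M) := Finset.aestronglyMeasurable_fun_sum _ fun j _ ↦ (hm j).memLp.1
  have hfm : AEStronglyMeasurable f (riemannianMeasure n M) := by
    refine aestronglyMeasurable_of_tendsto_ae atTop hFm ?_
    filter_upwards [a1] with x hx
    exact hx.of_norm.hasSum.tendsto_sum_nat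
  have hVf : ∀ᵐ x ∂riemannianMeasure n M, Tendsto (fun k ↦ ∑ j ∈ Finset.range k, V x * F j x)
      atTop (𝓝 (V x * f x)) := by
    filter_upwards [a1] with x hx
    exact (hx.of_norm.hasSum.mul_left (V x)).tendsto_sum_nat
  have hVfm : AEStronglyMeasurable (fun x ↦ V x * f x) (riemannianMeasure n M) :=
    aestronglyMeasurable_of_tendsto_ae atTop (fun k ↦ Finset.aestronglyMeasurable_fun_sum _
      fun j _ ↦ (hm j).memLp_mul.1) hVf
  have lim1 : Tendsto (fun k ↦ eLpNorm (fun x ↦ ∑ j ∈ Finset.range k, F j x - f x) p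
      (riemannianMeasure n M)) atTop (𝓝 0) := by
    refine tendsto_of_tendsto_of_tendsto_of_le_of_le tendsto_const_nhds tail1 (fun k ↦ zero_le)
      fun k ↦ eLpNorm_mono_ae_real ?_
    filter_upwards [a1] with x hx
    rw [norm_sub_rev]
    exact norm_tsum_sub_sum_le hx k
  have lim2 : Tendsto (fun k ↦ eLpNorm (fun x ↦ ‖∑ j ∈ Finset.range k, Γ j x - G x‖) p
      (riemannianMeasure n M)) atTop (𝓝 0) := by
    refine tendsto_of_tendsto_of_tendsto_of_le_of_le tendsto_const_nhds tail2 (fun k ↦ zero_le)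
      fun k ↦ eLpNorm_mono_ae_real ?_
    filter_upwards [a2] with x hx
    rw [norm_norm, norm_sub_rev]
    exact norm_tsum_sub_sum_le hx k
  have lim3 : Tendsto (fun k ↦ eLpNorm (fun x ↦ V x * (∑ j ∈ Finset.range k, F j x - f x)) p
      (riemannianMeasure n M)) atTop (𝓝 0) := by
    refine tendsto_of_tendsto_of_tendsto_of_le_of_le tendsto_const_nhds tail3 (fun k ↦ zero_le)
      fun k ↦ eLpNorm_mono_ae_real ?_
    filter_upwards [a3] with x hx
    rw [mul_sub, norm_sub_rev, Finset.mul_sum, hf]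
    simp only [← tsum_mul_left]
    exact norm_tsum_sub_sum_le hx k
  have hfp : MemLp f p (riemannianMeasure n M) := by
    refine ⟨hfm, lt_of_le_of_lt ?_ (lt_top_iff_ne_top.2 s1)⟩
    refine le_trans (eLpNorm_mono_ae_real ?_) (eLpNorm_tsum_le hp1
      (fun j ↦ (hm j).memLp.1.norm) (fun j x ↦ norm_nonneg _) s1)
    filter_upwards [a1] with x hx
    exact norm_tsum_le_tsum_norm hx
  have hVfp : MemLp (fun x ↦ V x * f x) p (riemannianMeasure n M) := by
    refine ⟨hVfm, lt_of_le_of_lt ?_ (lt_top_iff_ne_top.2 s3)⟩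
    refine le_trans (eLpNorm_mono_ae_real ?_) (eLpNorm_tsum_le hp1
      (fun j ↦ (hm j).memLp_mul.1.norm) (fun j x ↦ norm_nonneg _) s3)
    filter_upwards [a3] with x hx
    rw [hf]
    simp only [← tsum_mul_left]
    exact norm_tsum_le_tsum_norm hx
  have hwk (k : ℕ) := IsWeakGradient.sum hw k
  have hΓp (k : ℕ) : MemLp (fun x ↦ ‖∑ j ∈ Finset.range k, Γ j x‖) p (riemannianMeasure n M) := by
    refine (memLp_finsetSum' (Finset.range k) fun j _ ↦ (hm j).memLp_grad).mono
      (hwk k).aestronglyMeasurable_norm (Eventually.of_forall fun x ↦ ?_)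
    rw [norm_norm, Finset.sum_apply]
    exact (norm_sum_le _ _).trans (le_abs_self _)
  obtain ⟨hwf, hGp⟩ := IsWeakGradient.of_tendsto (G := G) hp1 hp hwk hfp hFm lim1 hΓp (by
    filter_upwards [a2] with x hx
    exact tendsto_iff_norm_sub_tendsto_zero.1 hx.of_norm.hasSum.tendsto_sum_nat) lim2
  refine ⟨SobolevH.mk hwf ⟨hfp, hGp, hVfp⟩, tendsto_iff_norm_sub_tendsto_zero.2 ?_⟩
  simp only [fun k ↦ SobolevH.norm_sub_eq (SobolevH.coeFn_sum (Finset.range k) u) (hwk k)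
    (SobolevH.coeFn_mk hwf ⟨hfp, hGp, hVfp⟩) hwf]
  exact tendsto_sobolevNorm_zero lim1 lim2 lim3

end Completeness

/-! ### Approximation inside a chart -/

section LocalApproximation
open Filter
variable {n : ℕ}

/-- Weak derivatives tested inside an open set `U` are weak derivatives on the whole space once the
function is supported in a compact part of `U`. -/
theorem integral_indicator_mul_fderiv {U K : Set (EuclideanSpace ℝ (Fin n))} (hU : IsOpen U)
    (hK : IsCompact K) (hKU : K ⊆ U) {a b : EuclideanSpace ℝ (Fin n) → ℝ}
    (ha : ∀ u ∈ U, u ∉ K → a u = 0) (hb : ∀ u ∈ U, u ∉ K → b u = 0) (v : EuclideanSpace ℝ (Fin n))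
    (hab : ∀ ψ : EuclideanSpace ℝ (Fin n) → ℝ, ContDiff ℝ ∞ ψ → HasCompactSupport ψ →
      tsupport ψ ⊆ U → ∫ u, a u * fderiv ℝ ψ u v = -∫ u, b u * ψ u)
    {ψ : EuclideanSpace ℝ (Fin n) → ℝ} (hψ : ContDiff ℝ ∞ ψ) (hψc : HasCompactSupport ψ) :
    ∫ u, K.indicator a u * fderiv ℝ ψ u v = -∫ u, K.indicator b u * ψ u := by
  -- multiply the test function by a cutoff `κ` that is `1` near `K` and supported in `U`
  obtain ⟨δ, hδ, hδU⟩ := hK.exists_cthickening_subset_open hU hKU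
  obtain ⟨κ, hκ1, hκ0, -⟩ := exists_contMDiffMap_one_nhds_of_subset_interior (n := ⊤)
    𝓘(ℝ, EuclideanSpace ℝ (Fin n)) hK.isClosed (t := Metric.cthickening δ K)
    (interior_maximal (Metric.thickening_subset_cthickening _ _) Metric.isOpen_thickening
      |> (Metric.self_subset_thickening hδ K).trans)
  have hκ : ContDiff ℝ ∞ κ := κ.contMDiff.contDiff
  have hκs : tsupport κ ⊆ U := by
    refine (closure_minimal (fun u hu ↦ ?_) Metric.isClosed_cthickening).trans hδU
    by_contra h; exact hu (hκ0 u h)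
  have hκψs : tsupport (fun u ↦ κ u * ψ u) ⊆ U := tsupport_mul_subset_left.trans hκs
  have key := hab (fun u ↦ κ u * ψ u) (hκ.mul hψ) hψc.mul_left hκψs
  have e1 (u) : K.indicator a u * fderiv ℝ ψ u v = a u * fderiv ℝ (fun u ↦ κ u * ψ u) u v := by
    by_cases hu : u ∈ K
    · have h1 : (fun u ↦ κ u * ψ u) =ᶠ[𝓝 u] ψ := by
        filter_upwards [hκ1.filter_mono (nhds_le_nhdsSet hu)] with w hw
        rw [hw, one_mul]
      rw [indicator_of_mem hu, h1.fderiv_eq]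
    · rw [indicator_of_notMem hu, zero_mul]
      by_cases huU : u ∈ U
      · rw [ha u huU hu, zero_mul]
      · have := notMem_subset (tsupport_fderiv_apply_subset ℝ (f := fun u ↦ κ u * ψ u) v)
          (fun h ↦ huU (hκψs h))
        rw [image_eq_zero_of_notMem_tsupport this, mul_zero]
  have e2 (u) : K.indicator b u * ψ u = b u * (κ u * ψ u) := by
    by_cases hu : u ∈ K
    · rw [indicator_of_mem hu, (hκ1.filter_mono (nhds_le_nhdsSet hu)).self_of_nhds, one_mul]
    · rw [indicator_of_notMem hu, zero_mul]
      by_cases huU : u ∈ U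
      · rw [hb u huU hu, zero_mul]
      · rw [image_eq_zero_of_notMem_tsupport (f := κ) fun h ↦ huU (hκs h), zero_mul, mul_zero]
  simp only [e1, e2]
  exact key

variable {M : Type*} [MetricSpace M] [ChartedSpace (EuclideanSpace ℝ (Fin n)) M]

/-- The function on `M` that is `g` in the chart around `x₀` and zero outside of the chart. -/
def chartExtend (x₀ : M) (g : EuclideanSpace ℝ (Fin n) → ℝ) : M → ℝ :=
  (extChartAt (𝓡 n) x₀).source.indicator (g ∘ extChartAt (𝓡 n) x₀)

theorem chartExtend_symm (x₀ : M) (g : EuclideanSpace ℝ (Fin n) → ℝ) {u : EuclideanSpace ℝ (Fin n)}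
    (hu : u ∈ (extChartAt (𝓡 n) x₀).target) :
    chartExtend x₀ g ((extChartAt (𝓡 n) x₀).symm u) = g u := by
  rw [chartExtend, indicator_of_mem ((extChartAt (𝓡 n) x₀).map_target hu), Function.comp,
    (extChartAt (𝓡 n) x₀).right_inv hu]

theorem tsupport_chartExtend_subset (x₀ : M) {g : EuclideanSpace ℝ (Fin n) → ℝ}
    {K : Set (EuclideanSpace ℝ (Fin n))} (hK : IsCompact K)
    (hKt : K ⊆ (extChartAt (𝓡 n) x₀).target) (hg : tsupport g ⊆ K) :
    tsupport (chartExtend x₀ g) ⊆ (extChartAt (𝓡 n) x₀).symm '' K := by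
  refine closure_minimal (fun x hx ↦ ?_) (hK.image_of_continuousOn
    ((continuousOn_extChartAt_symm x₀).mono hKt)).isClosed
  have hxs : x ∈ (extChartAt (𝓡 n) x₀).source := by
    by_contra h; exact hx (indicator_of_notMem h _)
  refine ⟨extChartAt (𝓡 n) x₀ x, hg (subset_tsupport _ fun h ↦ hx ?_),
    (extChartAt (𝓡 n) x₀).left_inv hxs⟩
  rw [chartExtend, indicator_of_mem hxs]
  exact h

theorem hasCompactSupport_chartExtend (x₀ : M) {g : EuclideanSpace ℝ (Fin n) → ℝ}
    {K : Set (EuclideanSpace ℝ (Fin n))} (hK : IsCompact K)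
    (hKt : K ⊆ (extChartAt (𝓡 n) x₀).target) (hg : tsupport g ⊆ K) :
    HasCompactSupport (chartExtend x₀ g) :=
  (hK.image_of_continuousOn ((continuousOn_extChartAt_symm x₀).mono hKt)).of_isClosed_subset
    (isClosed_tsupport _)
    (tsupport_chartExtend_subset x₀ hK hKt hg)

variable [IsManifold (𝓡 n) ∞ M]

theorem contMDiff_chartExtend (x₀ : M) {g : EuclideanSpace ℝ (Fin n) → ℝ}
    {K : Set (EuclideanSpace ℝ (Fin n))} (hK : IsCompact K)
    (hKt : K ⊆ (extChartAt (𝓡 n) x₀).target) (hg : tsupport g ⊆ K) (hgs : ContDiff ℝ ∞ g) :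
    ContMDiff (𝓡 n) 𝓘(ℝ, ℝ) ∞ (chartExtend x₀ g) := by
  refine contMDiff_of_tsupport fun x hx ↦ ?_
  obtain ⟨u, hu, rfl⟩ := tsupport_chartExtend_subset x₀ hK hKt hg hx
  have hxs := (extChartAt (𝓡 n) x₀).map_target (hKt hu)
  have h1 : ContMDiffAt (𝓡 n) 𝓘(ℝ, ℝ) ∞ (g ∘ extChartAt (𝓡 n) x₀)
      ((extChartAt (𝓡 n) x₀).symm u) :=
    hgs.contMDiff.contMDiffAt.comp _ (contMDiffAt_extChartAt' (by simpa using hxs))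
  refine h1.congr_of_eventuallyEq ?_
  filter_upwards [(isOpen_extChartAt_source (I := 𝓡 n) x₀).mem_nhds hxs] with y hy
  exact indicator_of_mem hy _

variable [RiemannianBundle (fun x : M ↦ TangentSpace (𝓡 n) x)]
  [IsContMDiffRiemannianBundle (𝓡 n) ∞ (EuclideanSpace ℝ (Fin n)) (fun x : M ↦ TangentSpace (𝓡 n) x)]
variable [MeasurableSpace M] [BorelSpace M] [SecondCountableTopology M]
variable {f η : M → ℝ} {G : ∀ x : M, TangentSpace (𝓡 n) x} {V : M → ℝ} {p : ℝ≥0∞}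

/-- Test functions belong to `E¹_{p,V}`; this needs `V ∈ L_{p,loc}`. -/
theorem memSobolev_of_hasCompactSupport {φ : M → ℝ}
    (hV : ∀ S : Set M, IsCompact S → MemLp V p ((riemannianMeasure n M).restrict S))
    (hφ : ContMDiff (𝓡 n) 𝓘(ℝ, ℝ) ∞ φ) (hc : HasCompactSupport φ) :
    MemSobolev V p φ (grad n φ) := by
  have hS : MeasurableSet (tsupport φ) := hc.measurableSet
  obtain ⟨B, hB⟩ := hφ.continuous.bounded_above_of_compact_support hc
  obtain ⟨B', hB'0, hB'⟩ := exists_norm_grad_le hφ hc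
  refine ⟨hφ.continuous.memLp_of_hasCompactSupport hc, ?_, ?_⟩
  · have h1 : MemLp ((tsupport φ).indicator fun _ ↦ B') p (riemannianMeasure n M) :=
      memLp_indicator_const p hS _ (Or.inr hc.measure_lt_top.ne)
    refine h1.mono (aestronglyMeasurable_norm_grad hφ) (Eventually.of_forall fun x ↦ ?_)
    rw [norm_norm]
    by_cases hx : x ∈ tsupport φ
    · rw [indicator_of_mem hx]
      exact (hB' x).trans (le_abs_self _)
    · rw [grad_eq_zero_of_eventuallyEq 0 (notMem_tsupport_iff_eventuallyEq.1 hx), norm_zero]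
      exact norm_nonneg _
  · have h1 : MemLp ((tsupport φ).indicator V) p (riemannianMeasure n M) :=
      (memLp_indicator_iff_restrict hS).2 (hV _ hc)
    have e : (fun x ↦ V x * φ x) = fun x ↦ φ x * (tsupport φ).indicator V x := by
      funext x
      by_cases hx : x ∈ tsupport φ
      · rw [indicator_of_mem hx, mul_comm]
      · rw [indicator_of_notMem hx, image_eq_zero_of_notMem_tsupport hx, mul_zero, zero_mul]
    rw [e]
    refine h1.of_le_mul (c := B) (hφ.continuous.aestronglyMeasurable.mul h1.1)
      (Eventually.of_forall fun x ↦ ?_)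
    rw [norm_mul]
    exact mul_le_mul_of_nonneg_right (hB x) (norm_nonneg _)

/-- The `L_p` norm of a vector field supported in a compact part of a chart is controlled by the
Euclidean `L_p` norms of its components. -/
theorem exists_eLpNorm_norm_le_sum (hp1 : 1 ≤ p) (hp : p ≠ ⊤)
    {K : Set (EuclideanSpace ℝ (Fin n))} (x₀ : M) (hK : IsCompact K)
    (hKt : K ⊆ (extChartAt (𝓡 n) x₀).target) :
    ∃ C : ℝ≥0, ∀ G : (∀ x : M, TangentSpace (𝓡 n) x),
      AEStronglyMeasurable (fun x ↦ ‖G x‖) (riemannianMeasure n M) →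
      (∀ i, AEStronglyMeasurable (coordComp G x₀ i) (volume.restrict K)) →
      (∀ x ∉ (extChartAt (𝓡 n) x₀).symm '' K, G x = 0) →
      eLpNorm (fun x ↦ ‖G x‖) p (riemannianMeasure n M) ≤
        C * ∑ i, eLpNorm (coordComp G x₀ i) p (volume.restrict K) := by
  obtain ⟨C, hC⟩ := exists_eLpNorm_le_chart (p := p) hp x₀ hK hKt
  obtain ⟨B, hB, hBK⟩ := exists_norm_le_sum_coordComp x₀ hK hKt
  refine ⟨C * B.toNNReal, fun G hG hGm hG0 ↦ ?_⟩
  rw [ENNReal.coe_mul, mul_assoc]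
  refine (hC _ hG fun x hx ↦ by rw [hG0 x hx, norm_zero]).trans (mul_le_mul_right ?_ _)
  have h1 : eLpNorm (∑ i, fun u ↦ ‖coordComp G x₀ i u‖) p (volume.restrict K) ≤
      ∑ i, eLpNorm (coordComp G x₀ i) p (volume.restrict K) := by
    refine (eLpNorm_sum_le (fun i _ ↦ (hGm i).norm) hp1).trans (le_of_eq ?_)
    simp only [eLpNorm_norm]
  refine le_trans ?_ (mul_le_mul_right h1 _)
  refine eLpNorm_le_mul_eLpNorm_of_ae_le_mul ?_ p
  filter_upwards [ae_restrict_mem hK.measurableSet] with u hu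
  refine (le_of_eq (norm_norm _)).trans ((hBK G u hu).trans
    (mul_le_mul_of_nonneg_left (le_of_eq_of_le ?_ (le_abs_self _)) hB))
  simp [Real.norm_eq_abs]

/-- Inside a chart, `η f` is approximated in `H¹_{p,V}` by smooth functions with compact support. -/
theorem exists_approx_of_tsupport_subset_source (hp1 : 1 ≤ p) (hp : p ≠ ⊤)
    (hV : ∀ S : Set M, IsCompact S → MemLp V p ((riemannianMeasure n M).restrict S)) (x₀ : M)
    (hw : IsWeakGradient f G) (hm : MemSobolev V p f G) (hη : ContMDiff (𝓡 n) 𝓘(ℝ, ℝ) ∞ η)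
    (hc : HasCompactSupport η) (hs : tsupport η ⊆ (extChartAt (𝓡 n) x₀).source) {ε : ℝ}
    (hε : 0 < ε) :
    ∃ φ : M → ℝ, ContMDiff (𝓡 n) 𝓘(ℝ, ℝ) ∞ φ ∧ HasCompactSupport φ ∧
      sobolevNorm V p (fun x ↦ η x * f x - φ x)
        (fun x ↦ (η x • G x + f x • grad n η x) - grad n φ x) ≤ ε := by
  set ι := extChartAt (𝓡 n) x₀ with hι
  have hU : IsOpen ι.target := isOpen_extChartAt_target x₀
  obtain ⟨B, hB⟩ := hη.continuous.bounded_above_of_compact_support hc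
  obtain ⟨B', hB'0, hB'⟩ := exists_norm_grad_le hη hc
  set k : M → ℝ := fun x ↦ η x * f x with hk
  set Γ : ∀ x : M, TangentSpace (𝓡 n) x := fun x ↦ η x • G x + f x • grad n η x with hΓ
  have hwk : IsWeakGradient k Γ := hw.smooth_mul hη
  have hmk : MemSobolev V p k Γ := MemSobolev.smooth_mul (B := max B B') hw hm hη
    (fun x ↦ (hB x).trans (le_max_left _ _)) (fun x ↦ (hB' x).trans (le_max_right _ _))
  have hk0 (x) (hx : x ∉ tsupport η) : k x = 0 := by
    rw [hk]; simp only [image_eq_zero_of_notMem_tsupport hx, zero_mul]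
  have hΓ0 (x) (hx : x ∉ tsupport η) : Γ x = 0 := by
    simp only [hΓ, image_eq_zero_of_notMem_tsupport hx, zero_smul, zero_add,
      grad_eq_zero_of_eventuallyEq 0 (notMem_tsupport_iff_eventuallyEq.1 hx), smul_zero]
  -- `K` is the support in coordinates; the compact neighbourhood `K'` leaves room for mollification
  set K := ι '' tsupport η with hKdef
  have hK : IsCompact K := hc.image_of_continuousOn ((continuousOn_extChartAt x₀).mono hs)
  have hKt : K ⊆ ι.target := by
    rintro _ ⟨x, hx, rfl⟩
    exact ι.map_source (hs hx)
  have hnot (u) (hu : u ∈ ι.target) (huK : u ∉ K) : ι.symm u ∉ tsupport η :=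
    fun h ↦ huK ⟨_, h, ι.right_inv hu⟩
  obtain ⟨δ, hδ, hδt⟩ := hK.exists_cthickening_subset_open hU hKt
  set K' := Metric.cthickening δ K with hK'def
  have hK' : IsCompact K' := hK.cthickening
  have hKK' : K ⊆ K' := Metric.self_subset_cthickening _
  have hkc (u) (hu : u ∈ ι.target) (huK : u ∉ K) : (k ∘ ι.symm) u = 0 := hk0 _ (hnot u hu huK)
  have hΓc (i) (u) (hu : u ∈ ι.target) (huK : u ∉ K) : coordComp Γ x₀ i u = 0 := by
    unfold coordComp
    rw [hΓ0 _ (hnot u hu huK)]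
    exact inner_zero_left _
  -- outside of the target `ι.symm` has junk values, hence the indicators of `K`; inside they change
  -- nothing
  have hindk (u) (hu : u ∈ ι.target) : K.indicator (k ∘ ι.symm) u = k (ι.symm u) := by
    by_cases huK : u ∈ K
    · rw [indicator_of_mem huK]; rfl
    · rw [indicator_of_notMem huK]; exact (hkc u hu huK).symm
  have hindΓ (i) (u) (hu : u ∈ ι.target) :
      K.indicator (coordComp Γ x₀ i) u = coordComp Γ x₀ i u := by
    by_cases huK : u ∈ K
    · rw [indicator_of_mem huK]
    · rw [indicator_of_notMem huK]; exact (hΓc i u hu huK).symm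
  have hh : MemLp (K.indicator (k ∘ ι.symm)) p volume :=
    (memLp_indicator_iff_restrict hK.measurableSet).2 (memLp_chart hp x₀ hK hKt hmk.memLp)
  have hD (i) : MemLp (K.indicator (coordComp Γ x₀ i)) p volume :=
    (memLp_indicator_iff_restrict hK.measurableSet).2 (memLp_coordComp_chart hp x₀ hK hKt i
      ((hwk.locallyIntegrableOn_comp x₀ i).integrableOn_compact_subset hKt hK).1 hmk.memLp_grad)
  set W : EuclideanSpace ℝ (Fin n) → ℝ := V ∘ ι.symm with hWdef
  have hW : MemLp W p (volume.restrict K') := by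
    have hS := isCompact_symm_image x₀ hK' hδt
    have h1 := memLp_chart hp x₀ hK' hδt ((memLp_indicator_iff_restrict hS.measurableSet).2 (hV _ hS))
    refine h1.ae_eq ?_
    filter_upwards [ae_restrict_mem hK'.measurableSet] with u hu
    exact indicator_of_mem (mem_image_of_mem _ hu) V
  have hWh : MemLp (fun u ↦ W u * K.indicator (k ∘ ι.symm) u) p (volume.restrict K') := by
    refine (memLp_chart hp x₀ hK' hδt hmk.memLp_mul).ae_eq ?_
    filter_upwards [ae_restrict_mem hK'.measurableSet] with u hu
    rw [hindk u (hδt hu)]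
    rfl
  obtain ⟨C₁, hC₁⟩ := exists_eLpNorm_le_chart (p := p) hp x₀ hK' hδt
  obtain ⟨C₂, hC₂⟩ := exists_eLpNorm_norm_le_sum (p := p) hp1 hp x₀ hK' hδt
  -- the Euclidean accuracy that makes each of the three terms at most `ε / 3`
  set A : ℝ≥0∞ := (C₁ : ℝ≥0∞) + C₂ * n + 1 with hA
  have hA0 : A ≠ 0 := by simp [hA]
  have hAt : A ≠ ⊤ := by simp [hA, ENNReal.mul_eq_top]
  set e : ℝ≥0∞ := ENNReal.ofReal (ε / 3) / A with he
  have he0 : 0 < e := ENNReal.div_pos (by simpa using hε) hAt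
  have heA : A * e = ENNReal.ofReal (ε / 3) := ENNReal.mul_div_cancel hA0 hAt
  have he1 : C₁ * e ≤ ENNReal.ofReal (ε / 3) := by
    rw [← heA]
    exact mul_le_mul_left (by rw [hA, add_assoc]; exact le_self_add) _
  have he2 : C₂ * (n * e) ≤ ENNReal.ofReal (ε / 3) := by
    rw [← heA, ← mul_assoc]
    exact mul_le_mul_left (by rw [hA]; exact le_add_self.trans le_self_add) _
  obtain ⟨g, hg, hgK, g1, g2, g3⟩ := exists_contDiff_approx (W := W) hp1 hp hδ le_rfl
    Set.support_indicator_subset hh hD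
    (fun i ψ hψ hψc ↦ integral_indicator_mul_fderiv hU hK hKt hkc (hΓc i) _
      (fun ψ h1 h2 h3 ↦ hwk.integral_eq x₀ i ψ h1 h2 h3) hψ hψc) hW hWh he0
  set φ := chartExtend x₀ g with hφ
  have hφs : ContMDiff (𝓡 n) 𝓘(ℝ, ℝ) ∞ φ := contMDiff_chartExtend x₀ hK' hδt hgK hg
  have hφc : HasCompactSupport φ := hasCompactSupport_chartExtend x₀ hK' hδt hgK
  have hmφ := memSobolev_of_hasCompactSupport hV hφs hφc
  have hw' := hwk.sub (isWeakGradient_grad hφs)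
  have hout (x) (hx : x ∉ ι.symm '' K') : x ∉ tsupport η ∧ x ∉ tsupport φ := by
    refine ⟨fun h ↦ hx ⟨ι x, hKK' ⟨x, h, rfl⟩, ι.left_inv (hs h)⟩, fun h ↦ hx ?_⟩
    exact tsupport_chartExtend_subset x₀ hK' hδt hgK h
  have hz (x) (hx : x ∉ ι.symm '' K') : k x - φ x = 0 := by
    rw [hk0 x (hout x hx).1, image_eq_zero_of_notMem_tsupport (hout x hx).2, sub_zero]
  have hK'm := ae_restrict_mem (μ := (volume : Measure (EuclideanSpace ℝ (Fin n))))
    hK'.measurableSet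
  refine ⟨φ, hφs, hφc, ?_⟩
  have hε3 : (3 : ℝ) * (ε / 3) = ε := by ring
  rw [← hε3]
  refine sobolevNorm_le_of_eLpNorm_le (by positivity) ?_ ?_ ?_
  · refine (hC₁ _ (hmk.memLp.1.sub hmφ.memLp.1) hz).trans (le_trans ?_ he1)
    refine mul_le_mul_right (le_trans ?_ g1) _
    refine le_trans (le_of_eq (eLpNorm_congr_norm_ae ?_)) (eLpNorm_mono_measure _
      Measure.restrict_le_self)
    filter_upwards [hK'm] with u hu
    rw [hindk u (hδt hu), norm_sub_rev, ← chartExtend_symm x₀ g (hδt hu)]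
    rfl
  · have hcm (i) : AEStronglyMeasurable (coordComp (fun x ↦ Γ x - grad n φ x) x₀ i)
        (volume.restrict K') :=
      ((hw'.locallyIntegrableOn_comp x₀ i).integrableOn_compact_subset hδt hK').1
    refine (hC₂ _ hw'.aestronglyMeasurable_norm hcm fun x hx ↦ ?_).trans (le_trans ?_ he2)
    · rw [hΓ0 x (hout x hx).1, grad_eq_zero_of_eventuallyEq 0
        (notMem_tsupport_iff_eventuallyEq.1 (hout x hx).2), sub_zero]
    · refine mul_le_mul_right ?_ _
      refine (Finset.sum_le_sum fun i _ ↦ le_trans ?_ (g2 i)).trans (le_of_eq (by simp))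
      refine le_trans (le_of_eq (eLpNorm_congr_norm_ae ?_)) (eLpNorm_mono_measure _
        Measure.restrict_le_self)
      filter_upwards [hK'm] with u hu
      rw [hindΓ i u (hδt hu), norm_sub_rev, coordComp_sub, Pi.sub_apply,
        coordComp_grad hφs x₀ i (hδt hu)]
      have : φ ∘ (extChartAt (𝓡 n) x₀).symm =ᶠ[𝓝 u] g := by
        filter_upwards [hU.mem_nhds (hδt hu)] with v hv
        exact chartExtend_symm x₀ g hv
      rw [this.fderiv_eq]
  · have hVm : AEStronglyMeasurable (fun x ↦ V x * (k x - φ x)) (riemannianMeasure n M) := by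
      simp only [mul_sub]
      exact hmk.memLp_mul.1.sub hmφ.memLp_mul.1
    refine (hC₁ _ hVm fun x hx ↦ by rw [hz x hx, mul_zero]).trans (le_trans ?_ he1)
    refine mul_le_mul_right (le_trans (le_of_eq (eLpNorm_congr_norm_ae ?_)) g3) _
    filter_upwards [hK'm] with u hu
    rw [hindk u (hδt hu), norm_mul, norm_sub_rev (g u), ← chartExtend_symm x₀ g (hδt hu), ← norm_mul]
    rfl

end LocalApproximation

/-! ### Gluing with a partition of unity -/

section Partition
open Filter

variable {n : ℕ} {M : Type*} [MetricSpace M] [ChartedSpace (EuclideanSpace ℝ (Fin n)) M]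
variable [IsManifold (𝓡 n) ∞ M] [SecondCountableTopology M]

/-- A finite family of smooth functions with compact support subordinate to a cover, with sum at
most `1` everywhere and equal to `1` in a neighbourhood of the compact set `S`. -/
theorem exists_finite_smooth_partition {S : Set M} (hS : IsCompact S) (U : M → Set M)
    (hU : ∀ x, IsOpen (U x)) (hxU : ∀ x, x ∈ U x) :
    ∃ (t : Finset M) (ρ : M → M → ℝ), (∀ i, ContMDiff (𝓡 n) 𝓘(ℝ, ℝ) ∞ (ρ i)) ∧
      (∀ i, HasCompactSupport (ρ i)) ∧ (∀ i, tsupport (ρ i) ⊆ U i) ∧ (∀ i x, 0 ≤ ρ i x) ∧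
      (∀ x, ∑ i ∈ t, ρ i x ≤ 1) ∧ ∀ x ∈ S, ∀ᶠ y in 𝓝 x, ∑ i ∈ t, ρ i y = 1 := by
  have : LocallyCompactSpace M := Manifold.locallyCompact_of_finiteDimensional (𝓡 n)
  -- a partition of unity on a compact neighbourhood `S'` of `S`, so that the sum is `1` near `S`
  obtain ⟨S', hS', hSS'⟩ := exists_compact_superset hS
  choose K hK hxK using fun x : M ↦ exists_compact_mem_nhds x
  obtain ⟨P, hP⟩ := SmoothPartitionOfUnity.exists_isSubordinate (𝓡 n) hS'.isClosed
    (fun x ↦ U x ∩ interior (K x)) (fun x ↦ (hU x).inter isOpen_interior)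
    (fun x _ ↦ mem_iUnion.2 ⟨x, hxU x, mem_interior_iff_mem_nhds.2 (hxK x)⟩)
  have hfin := P.locallyFinite.finite_nonempty_inter_compact hS'
  refine ⟨hfin.toFinset, fun i ↦ P i, fun i ↦ (P i).contMDiff, fun i ↦ ?_, fun i ↦
    (hP i).trans inter_subset_left, fun i x ↦ P.nonneg i x, fun x ↦ ?_, fun x hx ↦ ?_⟩
  · exact (hK i).of_isClosed_subset (isClosed_tsupport _)
      ((hP i).trans (inter_subset_right.trans interior_subset))
  · refine le_trans ?_ (P.sum_le_one x)
    have hxf : (Function.support fun i ↦ P i x).Finite := P.locallyFinite.point_finite x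
    classical
    rw [finsum_eq_sum_of_support_subset (s := hfin.toFinset ∪ hxf.toFinset) _
      (fun i hi ↦ by simp only [Finset.coe_union, Finite.coe_toFinset]; exact Or.inr hi)]
    exact Finset.sum_le_sum_of_subset_of_nonneg Finset.subset_union_left
      fun i _ _ ↦ P.nonneg i x
  · filter_upwards [mem_interior_iff_mem_nhds.1 (hSS' hx)] with y hy
    rw [← P.sum_eq_one hy, finsum_eq_sum_of_support_subset]
    intro i hi
    rw [Finite.coe_toFinset]
    exact ⟨y, hi, hy⟩

variable [RiemannianBundle (fun x : M ↦ TangentSpace (𝓡 n) x)]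
  [IsContMDiffRiemannianBundle (𝓡 n) ∞ (EuclideanSpace ℝ (Fin n)) (fun x : M ↦ TangentSpace (𝓡 n) x)]
variable [MeasurableSpace M] [BorelSpace M]
variable {f η : M → ℝ} {G : ∀ x : M, TangentSpace (𝓡 n) x} {V : M → ℝ} {p : ℝ≥0∞}

variable (n V p) in
/-- The subspace of `H¹_{p,V}` of the classes of the smooth functions with compact support. -/
def testSubmodule : Submodule ℝ (SobolevH n V p) where
  carrier := {h | ∃ φ : M → ℝ, ContMDiff (𝓡 n) 𝓘(ℝ, ℝ) ∞ φ ∧ HasCompactSupport φ ∧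
    h.toLp =ᵐ[riemannianMeasure n M] φ}
  zero_mem' := by
    refine ⟨0, contMDiff_const, HasCompactSupport.zero, ?_⟩
    rw [map_zero]
    exact Lp.coeFn_zero _ _ _
  add_mem' := by
    rintro h h' ⟨φ, hφ, hc, e⟩ ⟨φ', hφ', hc', e'⟩
    refine ⟨φ + φ', hφ.add hφ', hc.add hc', ?_⟩
    rw [map_add]
    exact (Lp.coeFn_add _ _).trans (e.add e')
  smul_mem' := by
    rintro c h ⟨φ, hφ, hc, e⟩
    refine ⟨c • φ, (contMDiff_const (c := c)).mul hφ, hc.mul_left (f := fun _ ↦ c), ?_⟩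
    rw [map_smul]
    exact (Lp.coeFn_smul _ _).trans (e.const_smul c)

variable [Fact (1 ≤ p)]

theorem smul_mem_closure_of_tsupport_subset_source (hp : p ≠ ⊤)
    (hV : ∀ S : Set M, IsCompact S → MemLp V p ((riemannianMeasure n M).restrict S)) (x₀ : M)
    (hw : IsWeakGradient f G) (hm : MemSobolev V p f G) (hη : ContMDiff (𝓡 n) 𝓘(ℝ, ℝ) ∞ η)
    (hc : HasCompactSupport η) (hs : tsupport η ⊆ (extChartAt (𝓡 n) x₀).source)
    {h : SobolevH n V p} (hh : h.toLp =ᵐ[riemannianMeasure n M] fun x ↦ η x * f x) :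
    h ∈ (testSubmodule n V p).topologicalClosure := by
  rw [← SetLike.mem_coe, Submodule.topologicalClosure_coe, Metric.mem_closure_iff]
  intro ε hε
  obtain ⟨φ, hφ, hφc, hle⟩ := exists_approx_of_tsupport_subset_source Fact.out hp hV x₀ hw hm hη
    hc hs (half_pos hε)
  have hwφ := isWeakGradient_grad hφ
  have hmφ := memSobolev_of_hasCompactSupport hV hφ hφc
  refine ⟨SobolevH.mk hwφ hmφ, ⟨φ, hφ, hφc, SobolevH.coeFn_mk hwφ hmφ⟩, ?_⟩
  rw [dist_eq_norm, SobolevH.norm_sub_eq hh (hw.smooth_mul hη) (SobolevH.coeFn_mk hwφ hmφ) hwφ]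
  exact hle.trans_lt (half_lt_self hε)

/-- The local approximations are glued with a finite smooth partition of unity. -/
theorem smul_mem_closure_of_hasCompactSupport (hp : p ≠ ⊤)
    (hV : ∀ S : Set M, IsCompact S → MemLp V p ((riemannianMeasure n M).restrict S))
    (hw : IsWeakGradient f G) (hm : MemSobolev V p f G) (hη : ContMDiff (𝓡 n) 𝓘(ℝ, ℝ) ∞ η)
    (hc : HasCompactSupport η)
    {h : SobolevH n V p} (hh : h.toLp =ᵐ[riemannianMeasure n M] fun x ↦ η x * f x) :
    h ∈ (testSubmodule n V p).topologicalClosure := by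
  obtain ⟨t, ρ, hρ, hρc, hρs, hρ0, -, hρ1⟩ := exists_finite_smooth_partition (n := n) hc
    (fun x ↦ (extChartAt (𝓡 n) x).source) (fun x ↦ isOpen_extChartAt_source (I := 𝓡 n) x)
    (fun x ↦ mem_extChartAt_source (I := 𝓡 n) x)
  have hg (i) : ContMDiff (𝓡 n) 𝓘(ℝ, ℝ) ∞ (fun x ↦ ρ i x * η x) := (hρ i).mul hη
  have hgc (i) : HasCompactSupport (fun x ↦ ρ i x * η x) := (hρc i).mul_right
  have hm' (i) : MemSobolev V p (fun x ↦ ρ i x * η x * f x)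
      (fun x ↦ (ρ i x * η x) • G x + f x • grad n (fun x ↦ ρ i x * η x) x) := by
    obtain ⟨B, hB⟩ := (hg i).continuous.bounded_above_of_compact_support (hgc i)
    obtain ⟨B', -, hB'⟩ := exists_norm_grad_le (hg i) (hgc i)
    exact MemSobolev.smooth_mul (B := max B B') hw hm (hg i)
      (fun x ↦ (hB x).trans (le_max_left _ _)) (fun x ↦ (hB' x).trans (le_max_right _ _))
  have hsum : h = ∑ i ∈ t, SobolevH.mk (hw.smooth_mul (hg i)) (hm' i) := by
    refine SobolevH.ext_ae ?_
    have hall : ∀ᵐ x ∂riemannianMeasure n M, ∀ i ∈ t,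
        (SobolevH.mk (hw.smooth_mul (hg i)) (hm' i)).toLp x = ρ i x * η x * f x :=
      (Finset.eventually_all t).2 fun i _ ↦ SobolevH.coeFn_mk (hw.smooth_mul (hg i)) (hm' i)
    filter_upwards [hh, SobolevH.coeFn_sum t fun i ↦ SobolevH.mk (hw.smooth_mul (hg i)) (hm' i),
      hall] with x h1 h2 h3
    rw [h1, h2, Finset.sum_congr rfl h3]
    simp only [mul_assoc]
    rw [← Finset.sum_mul]
    by_cases hx : x ∈ tsupport η
    · rw [(hρ1 x hx).self_of_nhds, one_mul]
    · rw [image_eq_zero_of_notMem_tsupport hx]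
      simp
  rw [hsum]
  refine Submodule.sum_mem _ fun i _ ↦ ?_
  exact smul_mem_closure_of_tsupport_subset_source hp hV i hw hm (hg i) (hgc i)
    (tsupport_mul_subset_left.trans (hρs i)) (SobolevH.coeFn_mk _ _)

end Partition

/-! ### The Hopf–Rinow theorem -/

section HopfRinow
open Filter Metric

/-- The Hopf–Rinow theorem for locally compact metric spaces whose distance is approximately
realized by intermediate points: completeness makes closed balls compact, because the set of radii
of compact balls around a point is open and closed. -/
theorem properSpace_of_exists_between {M : Type*} [MetricSpace M] [CompleteSpace M]
    [LocallyCompactSpace M]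
    (hM : ∀ (x y : M) (s t : ℝ), 0 ≤ s → 0 < t → dist x y < s + t →
      ∃ z, dist x z ≤ s ∧ dist z y < t) : ProperSpace M := by
  refine ⟨fun x r₀ ↦ ?_⟩
  by_contra hr₀
  set S : Set ℝ := {r | 0 ≤ r ∧ IsCompact (closedBall x r)} with hS
  have hdown {r r' : ℝ} (h : IsCompact (closedBall x r)) (hr : r' ≤ r) :
      IsCompact (closedBall x r') :=
    h.of_isClosed_subset isClosed_closedBall (closedBall_subset_closedBall hr)
  have h0 : (0 : ℝ) ∈ S := ⟨le_rfl, by rw [closedBall_zero]; exact isCompact_singleton⟩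
  have hbdd : BddAbove S := ⟨r₀, fun r hr ↦ le_of_not_gt fun h ↦ hr₀ (hdown hr.2 h.le)⟩
  set R := sSup S with hR
  have hR0 : 0 ≤ R := le_csSup hbdd h0
  have hlt {r : ℝ} (hr : r < R) : IsCompact (closedBall x r) := by
    obtain ⟨r', hr', h⟩ := exists_lt_of_lt_csSup ⟨0, h0⟩ hr
    exact hdown hr'.2 h.le
  -- points at distance at most `R` are close to points of a slightly smaller, compact ball
  have hRc : IsCompact (closedBall x R) := by
    refine TotallyBounded.isCompact_of_isClosed (totallyBounded_iff.2 fun ε hε ↦ ?_)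
      isClosed_closedBall
    have hc : IsCompact (closedBall x (max 0 (R - ε / 4))) := by
      rcases le_total (R - ε / 4) 0 with h | h
      · rw [max_eq_left h]; exact h0.2
      · rw [max_eq_right h]; exact hlt (by linarith)
    obtain ⟨t, ht, hcov⟩ := totallyBounded_iff.1 hc.totallyBounded (ε / 2) (half_pos hε)
    refine ⟨t, ht, fun y hy ↦ ?_⟩
    obtain ⟨z, hz, hzy⟩ := hM x y (max 0 (R - ε / 4)) (ε / 2) (le_max_left _ _) (half_pos hε) (by
      have h1 := le_max_right 0 (R - ε / 4)
      have h2 : dist x y ≤ R := by rw [dist_comm]; exact hy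
      linarith)
    obtain ⟨w, hw, hzw⟩ := mem_iUnion₂.1 (hcov (mem_closedBall'.2 hz))
    refine mem_iUnion₂.2 ⟨w, hw, ?_⟩
    rw [mem_ball] at hzw ⊢
    have := dist_triangle y z w
    rw [dist_comm y z] at this
    linarith
  -- a compact thickening of the ball of radius `R` contains a larger ball, contradicting maximality
  obtain ⟨δ, hδ, hδc⟩ := hRc.exists_isCompact_cthickening
  have hmem : R + δ / 2 ∈ S := by
    refine ⟨by positivity, hδc.of_isClosed_subset isClosed_closedBall fun y hy ↦ ?_⟩
    obtain ⟨z, hz, hzy⟩ := hM x y R δ hR0 hδ (by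
      have h2 : dist x y ≤ R + δ / 2 := by rw [dist_comm]; exact hy
      linarith)
    exact mem_cthickening_of_dist_le y z δ _ (mem_closedBall'.2 hz)
      (by rw [dist_comm]; exact hzy.le)
  have := le_csSup hbdd hmem
  linarith

/-- An almost minimizing path from `x` to `y` passes through a point at distance `s` from `x`; the
rest of the path has length less than `t`. -/
theorem exists_dist_le_dist_lt (n : ℕ) {M : Type*} [MetricSpace M]
    [ChartedSpace (EuclideanSpace ℝ (Fin n)) M] [RiemannianBundle (fun x : M ↦ TangentSpace (𝓡 n) x)]
    [IsManifold (𝓡 n) ∞ M] [IsRiemannianManifold (𝓡 n) M] (x y : M) {s t : ℝ} (hs : 0 ≤ s) (ht : 0 < t)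
    (h : dist x y < s + t) : ∃ z, dist x z ≤ s ∧ dist z y < t := by
  rcases le_or_gt (dist x y) s with hxy | hxy
  · exact ⟨y, hxy, by rwa [dist_self]⟩
  have h' : Manifold.riemannianEDist (𝓡 n) x y < ENNReal.ofReal (s + t) := by
    rw [← IsRiemannianManifold.out (I := 𝓡 n), edist_dist]
    exact (ENNReal.ofReal_lt_ofReal_iff (by positivity)).2 h
  obtain ⟨γ, hγ0, hγ1, hγ, hlen⟩ := Manifold.exists_lt_of_riemannianEDist_lt h'
  obtain ⟨τ, hτ, hτs⟩ : ∃ τ ∈ Icc (0 : ℝ) 1, dist x (γ τ) = s := by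
    have hc : ContinuousOn (fun τ ↦ dist x (γ τ)) (Icc 0 1) :=
      (continuous_const.dist continuous_id).comp_continuousOn hγ.continuousOn
    refine intermediate_value_Icc zero_le_one hc ⟨?_, ?_⟩
    · simp only [hγ0, dist_self]; exact hs
    · simp only [hγ1]; exact hxy.le
  refine ⟨γ τ, hτs.le, ?_⟩
  have h1 : edist x (γ τ) ≤ Manifold.pathELength (𝓡 n) γ 0 τ := by
    rw [IsRiemannianManifold.out (I := 𝓡 n)]
    exact Manifold.riemannianEDist_le_pathELength
      (hγ.mono (Icc_subset_Icc_right hτ.2)) hγ0 rfl hτ.1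
  have h2 : edist (γ τ) y ≤ Manifold.pathELength (𝓡 n) γ τ 1 := by
    rw [IsRiemannianManifold.out (I := 𝓡 n)]
    exact Manifold.riemannianEDist_le_pathELength
      (hγ.mono (Icc_subset_Icc_left hτ.1)) rfl hγ1 hτ.2
  rw [← Manifold.pathELength_add hτ.1 hτ.2] at hlen
  have h3 := (add_le_add h1 h2).trans_lt hlen
  rw [edist_dist, edist_dist, hτs, ← ENNReal.ofReal_add hs dist_nonneg,
    ENNReal.ofReal_lt_ofReal_iff (by positivity)] at h3
  linarith

/-- Closed balls of a complete Riemannian manifold are compact. -/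
theorem properSpace_of_complete (n : ℕ) (M : Type*) [MetricSpace M] [CompleteSpace M]
    [ChartedSpace (EuclideanSpace ℝ (Fin n)) M] [RiemannianBundle (fun x : M ↦ TangentSpace (𝓡 n) x)]
    [IsManifold (𝓡 n) ∞ M] [IsRiemannianManifold (𝓡 n) M] : ProperSpace M := by
  have : LocallyCompactSpace M := Manifold.locallyCompact_of_finiteDimensional (𝓡 n)
  exact properSpace_of_exists_between fun x y s t hs ht h ↦ exists_dist_le_dist_lt n x y hs ht h

end HopfRinow

/-! ### The Riemannian norm in a chart -/

section ChartNorm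
open Filter Metric

variable {n : ℕ} {M : Type*} [MetricSpace M] [ChartedSpace (EuclideanSpace ℝ (Fin n)) M]
variable [RiemannianBundle (fun x : M ↦ TangentSpace (𝓡 n) x)]

/-- The Riemannian norm at the point with coordinates `u` of the vector with coordinates `v` in the
chart around `x₀`. -/
def chartNorm (x₀ : M) (u v : EuclideanSpace ℝ (Fin n)) : ℝ :=
  ‖mfderiv 𝓘(ℝ, EuclideanSpace ℝ (Fin n)) (𝓡 n) (extChartAt (𝓡 n) x₀).symm u v‖

theorem chartNorm_nonneg (x₀ : M) (u v : EuclideanSpace ℝ (Fin n)) : 0 ≤ chartNorm x₀ u v :=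
  norm_nonneg (E := TangentSpace (𝓡 n) ((extChartAt (𝓡 n) x₀).symm u)) _

theorem chartNorm_smul (x₀ : M) (u v : EuclideanSpace ℝ (Fin n)) (c : ℝ) :
    chartNorm x₀ u (c • v) = |c| * chartNorm x₀ u v := by
  unfold chartNorm
  rw [← Real.norm_eq_abs]
  refine Eq.trans ?_ (norm_smul c (mfderiv 𝓘(ℝ, EuclideanSpace ℝ (Fin n)) (𝓡 n)
    (extChartAt (𝓡 n) x₀).symm u v))
  exact congrArg _ (map_smul _ _ _)

theorem chartNorm_le (x₀ : M) (u : EuclideanSpace ℝ (Fin n)) :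
    ∃ K : ℝ, ∀ v : EuclideanSpace ℝ (Fin n), chartNorm x₀ u v ≤ K * ‖v‖ := by
  let D : EuclideanSpace ℝ (Fin n) →L[ℝ] TangentSpace (𝓡 n) ((extChartAt (𝓡 n) x₀).symm u) :=
    mfderiv 𝓘(ℝ, EuclideanSpace ℝ (Fin n)) (𝓡 n) (extChartAt (𝓡 n) x₀).symm u
  exact ⟨‖D‖, fun v ↦ D.le_opNorm v⟩

/-- The fibres of the tangent bundle are all the model space; this changes the base point at which
the norm of a vector is taken. -/
theorem norm_tangent_congr {x y : M} (h : x = y) (v : EuclideanSpace ℝ (Fin n)) :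
    @norm (TangentSpace (𝓡 n) x) _ v = @norm (TangentSpace (𝓡 n) y) _ v := by
  subst h; rfl

variable [IsManifold (𝓡 n) ∞ M]
  [IsContMDiffRiemannianBundle (𝓡 n) ∞ (EuclideanSpace ℝ (Fin n)) (fun x : M ↦ TangentSpace (𝓡 n) x)]

/-- The trivialization of the tangent bundle at `x₀` is given by the derivative of the chart. -/
theorem chartNorm_extChartAt {x₀ x : M} (hx : x ∈ (chartAt (EuclideanSpace ℝ (Fin n)) x₀).source)
    (v : EuclideanSpace ℝ (Fin n)) : chartNorm x₀ (extChartAt (𝓡 n) x₀ x) v =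
      ‖(trivializationAt (EuclideanSpace ℝ (Fin n)) (TangentSpace (𝓡 n)) x₀).symmL ℝ x v‖ := by
  rw [TangentBundle.symmL_trivializationAt hx, ModelWithCorners.range_eq_univ, mfderivWithin_univ]
  exact norm_tangent_congr ((extChartAt (𝓡 n) x₀).left_inv (by simpa using hx)) _

/-- Near the centre of a chart the metric is comparable, with a factor `2`, to its value at the
centre. -/
theorem eventually_chartNorm_le (x₀ : M) : ∀ᶠ u in 𝓝 (extChartAt (𝓡 n) x₀ x₀),
    ∀ v, chartNorm x₀ u v ≤ 2 * chartNorm x₀ (extChartAt (𝓡 n) x₀ x₀) v ∧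
      chartNorm x₀ (extChartAt (𝓡 n) x₀ x₀) v ≤ 2 * chartNorm x₀ u v := by
  have : IsContinuousRiemannianBundle (EuclideanSpace ℝ (Fin n))
      (fun x : M ↦ TangentSpace (𝓡 n) x) := by
    obtain ⟨g, hg, hg'⟩ := IsContMDiffRiemannianBundle.exists_contMDiff (IB := 𝓡 n) (n := ∞)
      (F := EuclideanSpace ℝ (Fin n)) (E := fun x : M ↦ TangentSpace (𝓡 n) x)
    exact ⟨g, hg.continuous, hg'⟩
  have h1 := eventually_norm_symmL_trivializationAt_self_comp_lt (EuclideanSpace ℝ (Fin n))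
    (fun x : M ↦ TangentSpace (𝓡 n) x) x₀ one_lt_two
  have h2 := eventually_norm_symmL_trivializationAt_comp_self_lt (EuclideanSpace ℝ (Fin n))
    (fun x : M ↦ TangentSpace (𝓡 n) x) x₀ one_lt_two
  have h3 := chart_source_mem_nhds (EuclideanSpace ℝ (Fin n)) x₀
  have hx₀ := mem_chart_source (EuclideanSpace ℝ (Fin n)) x₀
  have key : ∀ᶠ y in 𝓝 x₀, ∀ v, chartNorm x₀ (extChartAt (𝓡 n) x₀ y) v ≤
      2 * chartNorm x₀ (extChartAt (𝓡 n) x₀ x₀) v ∧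
      chartNorm x₀ (extChartAt (𝓡 n) x₀ x₀) v ≤ 2 * chartNorm x₀ (extChartAt (𝓡 n) x₀ y) v := by
    filter_upwards [h1, h2, h3] with y hy1 hy2 hy v
    rw [chartNorm_extChartAt hy, chartNorm_extChartAt hx₀]
    have hb {z : M} (hz : z ∈ (chartAt (EuclideanSpace ℝ (Fin n)) x₀).source) :
        (trivializationAt (EuclideanSpace ℝ (Fin n)) (TangentSpace (𝓡 n)) x₀).continuousLinearMapAt
          ℝ z ((trivializationAt (EuclideanSpace ℝ (Fin n)) (TangentSpace (𝓡 n)) x₀).symmL ℝ z v)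
          = v :=
      Trivialization.continuousLinearMapAt_symmL _ (by simpa using hz) v
    constructor
    · have := ContinuousLinearMap.le_of_opNorm_le _ hy2.le
        ((trivializationAt (EuclideanSpace ℝ (Fin n)) (TangentSpace (𝓡 n)) x₀).symmL ℝ x₀ v)
      rwa [ContinuousLinearMap.comp_apply, hb hx₀] at this
    · have := ContinuousLinearMap.le_of_opNorm_le _ hy1.le
        ((trivializationAt (EuclideanSpace ℝ (Fin n)) (TangentSpace (𝓡 n)) x₀).symmL ℝ y v)
      rwa [ContinuousLinearMap.comp_apply, hb hy] at this
  have hc : Tendsto (extChartAt (𝓡 n) x₀).symm (𝓝 (extChartAt (𝓡 n) x₀ x₀)) (𝓝 x₀) := by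
    have := continuousAt_extChartAt_symm (I := 𝓡 n) x₀
    rwa [ContinuousAt, (extChartAt (𝓡 n) x₀).left_inv (mem_extChartAt_source x₀)] at this
  filter_upwards [hc.eventually key, (isOpen_extChartAt_target (I := 𝓡 n) x₀).mem_nhds
    (mem_extChartAt_target x₀)] with u hu hut
  rwa [(extChartAt (𝓡 n) x₀).right_inv hut] at hu

/-- The distance of two points of a chart is at most the length of the image of the segment between
their coordinates. -/
theorem dist_symm_le [IsRiemannianManifold (𝓡 n) M] (x₀ : M) {a b : EuclideanSpace ℝ (Fin n)}
    {K : ℝ} (hs : segment ℝ a b ⊆ (extChartAt (𝓡 n) x₀).target)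
    (hK : ∀ u ∈ segment ℝ a b, chartNorm x₀ u (b - a) ≤ K) :
    dist ((extChartAt (𝓡 n) x₀).symm a) ((extChartAt (𝓡 n) x₀).symm b) ≤ K := by
  have hK0 : 0 ≤ K := (chartNorm_nonneg _ _ _).trans (hK a (left_mem_segment ℝ a b))
  set γ : ℝ → M := fun t ↦ (extChartAt (𝓡 n) x₀).symm (AffineMap.lineMap a b t) with hγ
  have hmem {t : ℝ} (ht : t ∈ Icc (0 : ℝ) 1) : AffineMap.lineMap a b t ∈ segment ℝ a b := by
    rw [segment_eq_image_lineMap]; exact mem_image_of_mem _ ht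
  have hl : ContDiff ℝ ∞ (AffineMap.lineMap a b : ℝ → EuclideanSpace ℝ (Fin n)) :=
    (ContinuousAffineMap.lineMap (R := ℝ) a b).contDiff
  have hγs : ContMDiffOn 𝓘(ℝ, ℝ) (𝓡 n) 1 γ (Icc 0 1) :=
    ((contMDiffOn_extChartAt_symm (I := 𝓡 n) (n := 1) x₀).comp
      ((hl.of_le (by simp)).contMDiff.contMDiffOn) fun t ht ↦ hs (hmem ht))
  have h1 : edist ((extChartAt (𝓡 n) x₀).symm a) ((extChartAt (𝓡 n) x₀).symm b) ≤
      Manifold.pathELength (𝓡 n) γ 0 1 := by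
    rw [IsRiemannianManifold.out (I := 𝓡 n)]
    exact Manifold.riemannianEDist_le_pathELength hγs (by simp [hγ]) (by simp [hγ]) zero_le_one
  have h2 : Manifold.pathELength (𝓡 n) γ 0 1 ≤ ENNReal.ofReal K := by
    rw [Manifold.pathELength_eq_lintegral_mfderiv_Ioo]
    have h3 : ∀ t ∈ Ioo (0 : ℝ) 1, ‖mfderiv 𝓘(ℝ, ℝ) (𝓡 n) γ t 1‖ₑ ≤ ENNReal.ofReal K := by
      intro t ht
      have hu := hmem (Ioo_subset_Icc_self ht)
      have e1 : HasMFDerivAt 𝓘(ℝ, EuclideanSpace ℝ (Fin n)) (𝓡 n) (extChartAt (𝓡 n) x₀).symm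
          (AffineMap.lineMap a b t) (mfderiv 𝓘(ℝ, EuclideanSpace ℝ (Fin n)) (𝓡 n)
            (extChartAt (𝓡 n) x₀).symm (AffineMap.lineMap a b t)) :=
        ((contMDiffOn_extChartAt_symm (I := 𝓡 n) (n := ∞) x₀).mdifferentiableOn (by simp) _ (hs hu)
          |>.mdifferentiableAt ((isOpen_extChartAt_target x₀).mem_nhds (hs hu))).hasMFDerivAt
      have e2 : HasMFDerivAt 𝓘(ℝ, ℝ) 𝓘(ℝ, EuclideanSpace ℝ (Fin n))
          (AffineMap.lineMap a b : ℝ → EuclideanSpace ℝ (Fin n)) t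
          (ContinuousLinearMap.toSpanSingleton ℝ (b - a)) :=
        (AffineMap.hasDerivAt_lineMap (a := a) (b := b) (x := t)).hasFDerivAt.hasMFDerivAt
      have e3 := (e1.comp t e2).mfderiv
      have e4 : mfderiv 𝓘(ℝ, ℝ) (𝓡 n) γ t 1 = mfderiv 𝓘(ℝ, EuclideanSpace ℝ (Fin n)) (𝓡 n)
            (extChartAt (𝓡 n) x₀).symm (AffineMap.lineMap a b t) (b - a) := by
        refine (congrArg (fun L : ℝ →L[ℝ] EuclideanSpace ℝ (Fin n) ↦ L 1) e3).trans ?_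
        exact congrArg (mfderiv 𝓘(ℝ, EuclideanSpace ℝ (Fin n)) (𝓡 n)
          (extChartAt (𝓡 n) x₀).symm (AffineMap.lineMap a b t)) (one_smul ℝ (b - a))
      rw [← ofReal_norm]
      refine ENNReal.ofReal_le_ofReal (le_of_eq_of_le ?_ (hK _ hu))
      exact congrArg (@norm (TangentSpace (𝓡 n) (γ t)) _) e4
    refine (setLIntegral_mono' measurableSet_Ioo h3).trans ?_
    rw [setLIntegral_const, Real.volume_Ioo]
    simp
  have h3 := h1.trans h2
  rw [edist_dist, ENNReal.ofReal_le_ofReal_iff hK0] at h3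
  exact h3

end ChartNorm

/-! ### Mollification of Lipschitz functions -/

section LipschitzMollify
open Filter Metric
variable {E : Type*} [NormedAddCommGroup E] [InnerProductSpace ℝ E] [FiniteDimensional ℝ E]
  [MeasurableSpace E] [BorelSpace E] {μ : Measure E} [μ.IsAddHaarMeasure]

/-- Mollification preserves Lipschitz bounds that depend only on the increment. -/
theorem abs_mollify_sub_le (φ : ContDiffBump (0 : E)) {h : E → ℝ} (hh : LocallyIntegrable h μ)
    {a b : E} {K : ℝ} (hK : ∀ t ∈ ball (0 : E) φ.rOut, |h (a - t) - h (b - t)| ≤ K) :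
    |mollify μ φ h a - mollify μ φ h b| ≤ K := by
  have hi := φ.continuous_normed (μ := μ) |>.integrable_of_hasCompactSupport (μ := μ)
    (φ.hasCompactSupport_normed (μ := μ))
  rw [mollify_apply, mollify_apply, ← integral_sub (integrable_normed_mul φ hh a)
    (integrable_normed_mul φ hh b), ← Real.norm_eq_abs]
  refine (norm_integral_le_of_norm_le (hi.mul_const K) (Eventually.of_forall fun t ↦ ?_)).trans
    (le_of_eq ?_)
  · rw [← mul_sub, norm_mul, Real.norm_of_nonneg (φ.nonneg_normed t), Real.norm_eq_abs]
    by_cases ht : t ∈ ball (0 : E) φ.rOut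
    · exact mul_le_mul_of_nonneg_left (hK t ht) (φ.nonneg_normed t)
    · have : φ.normed μ t = 0 := by
        rw [← φ.support_normed_eq (μ := μ)] at ht
        exact Function.notMem_support.1 ht
      rw [this, zero_mul, zero_mul]
  · rw [integral_mul_const, φ.integral_normed, one_mul]

end LipschitzMollify

/-! ### Smooth approximation of Lipschitz functions -/

section SmoothApproximation
open Filter Metric

variable {n : ℕ} {M : Type*} [MetricSpace M] [ChartedSpace (EuclideanSpace ℝ (Fin n)) M]
variable [RiemannianBundle (fun x : M ↦ TangentSpace (𝓡 n) x)]
variable {f g : M → ℝ}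

theorem norm_grad_le {x : M} {K : ℝ} (hK : 0 ≤ K) {D : TangentSpace (𝓡 n) x →L[ℝ] ℝ}
    (hD : HasMFDerivAt (𝓡 n) 𝓘(ℝ, ℝ) f x D) (h : ∀ w, |D w| ≤ K * ‖w‖) : ‖grad n f x‖ ≤ K := by
  have : CompleteSpace (TangentSpace (𝓡 n) x) := FiniteDimensional.complete ℝ _
  have e : grad n f x = (InnerProductSpace.toDual ℝ (TangentSpace (𝓡 n) x)).symm D :=
    congrArg (InnerProductSpace.toDual ℝ (TangentSpace (𝓡 n) x)).symm hD.mfderiv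
  rw [e, LinearIsometryEquiv.norm_map]
  exact D.opNorm_le_bound hK h

theorem grad_mul {x : M} (hf : MDifferentiableAt (𝓡 n) 𝓘(ℝ, ℝ) f x)
    (hg : MDifferentiableAt (𝓡 n) 𝓘(ℝ, ℝ) g x) :
    grad n (fun y ↦ f y * g y) x = f x • grad n g x + g x • grad n f x := by
  have : CompleteSpace (TangentSpace (𝓡 n) x) := FiniteDimensional.complete ℝ _
  let T := (InnerProductSpace.toDual ℝ (TangentSpace (𝓡 n) x)).symm
  let Df : TangentSpace (𝓡 n) x →L[ℝ] ℝ := mfderiv (𝓡 n) 𝓘(ℝ, ℝ) f x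
  let Dg : TangentSpace (𝓡 n) x →L[ℝ] ℝ := mfderiv (𝓡 n) 𝓘(ℝ, ℝ) g x
  have h1 : T (f x • Dg + g x • Df) = f x • T Dg + g x • T Df := by
    rw [map_add, map_smulₛₗ, map_smulₛₗ]; rfl
  exact (congrArg T (hf.hasMFDerivAt.mul hg.hasMFDerivAt).mfderiv).trans h1

variable [IsManifold (𝓡 n) ∞ M] [MeasurableSpace M] [BorelSpace M]
  [IsContMDiffRiemannianBundle (𝓡 n) ∞ (EuclideanSpace ℝ (Fin n)) (fun x : M ↦ TangentSpace (𝓡 n) x)]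

theorem grad_sum {ι : Type*} (t : Finset ι) {F : ι → M → ℝ}
    (hF : ∀ i, ContMDiff (𝓡 n) 𝓘(ℝ, ℝ) ∞ (F i)) (x : M) :
    grad n (fun y ↦ ∑ i ∈ t, F i y) x = ∑ i ∈ t, grad n (F i) x := by
  classical
  induction t using Finset.induction_on with
  | empty =>
    simp only [Finset.sum_empty]
    exact grad_eq_zero_of_eventuallyEq 0 (Eventually.of_forall fun _ ↦ rfl)
  | insert i t hi ih =>
    simp only [Finset.sum_insert hi]
    rw [← ih]
    exact grad_add (hF i) (contMDiff_finsetSum fun j _ ↦ hF j) x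

/-- The derivative of the chart is an isometry for `chartNorm`. -/
theorem chartNorm_mfderiv {x₀ x : M} (hx : x ∈ (chartAt (EuclideanSpace ℝ (Fin n)) x₀).source)
    (w : TangentSpace (𝓡 n) x) :
    chartNorm x₀ (extChartAt (𝓡 n) x₀ x)
      (mfderiv (𝓡 n) 𝓘(ℝ, EuclideanSpace ℝ (Fin n)) (extChartAt (𝓡 n) x₀) x w) = ‖w‖ := by
  refine (chartNorm_extChartAt hx _).trans ?_
  rw [← TangentBundle.continuousLinearMapAt_trivializationAt hx]
  exact congrArg norm (Trivialization.symmL_continuousLinearMapAt _ (by simpa using hx) w)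

variable [IsRiemannianManifold (𝓡 n) M]

/-- Near each point, Lipschitz functions are uniformly approximated by smooth functions, the
Lipschitz constant being multiplied by at most `4`: mollify in a chart where the metric is
comparable to a constant one. The neighbourhood does not depend on the function. -/
theorem exists_nhds_smooth_approx (x₀ : M) : ∃ U : Set M, IsOpen U ∧ x₀ ∈ U ∧
    ∀ (L : ℝ≥0) (χ : M → ℝ), LipschitzWith L χ → ∀ ε : ℝ, 0 < ε →
      ∃ c : M → ℝ, ContMDiffOn (𝓡 n) 𝓘(ℝ, ℝ) ∞ c U ∧
        ∀ x ∈ U, |c x - χ x| ≤ ε ∧ ‖grad n c x‖ ≤ 4 * L := by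
  set ψ := extChartAt (𝓡 n) x₀ with hψ
  set u₀ := ψ x₀ with hu₀
  obtain ⟨R, hR, hball⟩ := Metric.nhds_basis_closedBall.mem_iff.1
    (inter_mem ((isOpen_extChartAt_target (I := 𝓡 n) x₀).mem_nhds (mem_extChartAt_target x₀))
      (eventually_chartNorm_le x₀))
  have hsub : ball u₀ (R / 2) ⊆ closedBall u₀ R :=
    ball_subset_closedBall.trans (closedBall_subset_closedBall (by linarith))
  refine ⟨ψ.source ∩ ψ ⁻¹' ball u₀ (R / 2),
    (continuousOn_extChartAt x₀).isOpen_inter_preimage (isOpen_extChartAt_source x₀) isOpen_ball,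
    ⟨mem_extChartAt_source x₀, mem_ball_self (by positivity)⟩, fun L χ hχ ε hε ↦ ?_⟩
  obtain ⟨K, hK⟩ := chartNorm_le x₀ u₀
  set h : EuclideanSpace ℝ (Fin n) → ℝ := (closedBall u₀ R).indicator (χ ∘ ψ.symm) with hh
  have hhi : Integrable h volume := by
    rw [hh, integrable_indicator_iff isClosed_closedBall.measurableSet]
    exact (hχ.continuous.comp_continuousOn ((continuousOn_extChartAt_symm x₀).mono
      fun u hu ↦ (hball hu).1)).integrableOn_compact (isCompact_closedBall u₀ R)
  -- in coordinates `χ` is `2 L`-Lipschitz for the constant norm of the centre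
  have hLip {a b : EuclideanSpace ℝ (Fin n)} (ha : a ∈ closedBall u₀ R)
      (hb : b ∈ closedBall u₀ R) : |h a - h b| ≤ 2 * L * chartNorm x₀ u₀ (b - a) := by
    have hseg := (convex_closedBall u₀ R).segment_subset ha hb
    have h1 := dist_symm_le x₀ (K := 2 * chartNorm x₀ u₀ (b - a))
      (fun u hu ↦ (hball (hseg hu)).1) (fun u hu ↦ ((hball (hseg hu)).2 _).1)
    have h2 := (hχ.dist_le_mul (ψ.symm a) (ψ.symm b)).trans
      (mul_le_mul_of_nonneg_left h1 L.coe_nonneg)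
    rw [hh, indicator_of_mem ha, indicator_of_mem hb, ← Real.dist_eq]
    refine h2.trans (le_of_eq ?_)
    ring
  -- the mollification radius `ρ` keeps the argument in the closed ball of radius `R` and moves the
  -- values of `h` by at most `2 L |K| ρ ≤ ε`
  set ρ : ℝ := min (R / 2) (ε / (2 * L * |K| + 1)) with hρ
  have hρ0 : 0 < ρ := lt_min (by positivity) (by positivity)
  have hρε : 2 * L * |K| * ρ ≤ ε := by
    have h1 : ρ ≤ ε / (2 * L * |K| + 1) := min_le_right _ _
    rw [le_div_iff₀ (by positivity)] at h1
    nlinarith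
  let φ : ContDiffBump (0 : EuclideanSpace ℝ (Fin n)) := ⟨ρ / 2, ρ, by positivity, by linarith⟩
  have hφ : φ.rOut = ρ := rfl
  have hmem {a t : EuclideanSpace ℝ (Fin n)} (ha : a ∈ ball u₀ (R / 2))
      (ht : t ∈ ball (0 : EuclideanSpace ℝ (Fin n)) φ.rOut) : a - t ∈ closedBall u₀ R := by
    rw [mem_ball_iff_norm] at ha
    rw [mem_ball_zero_iff, hφ] at ht
    have h1 : ρ ≤ R / 2 := min_le_left _ _
    rw [mem_closedBall_iff_norm, show a - t - u₀ = (a - u₀) - t by abel]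
    exact (norm_sub_le _ _).trans (by linarith)
  set m := mollify volume φ h with hm
  have hms : ContDiff ℝ ∞ m := contDiff_mollify φ hhi.locallyIntegrable
  have hmLip {a b : EuclideanSpace ℝ (Fin n)} (ha : a ∈ ball u₀ (R / 2))
      (hb : b ∈ ball u₀ (R / 2)) : |m b - m a| ≤ 2 * L * chartNorm x₀ u₀ (a - b) := by
    refine abs_mollify_sub_le φ hhi.locallyIntegrable fun t ht ↦ ?_
    have := hLip (hmem hb ht) (hmem ha ht)
    rwa [sub_sub_sub_cancel_right] at this
  have hmd {a : EuclideanSpace ℝ (Fin n)} (ha : a ∈ ball u₀ (R / 2))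
      (v : EuclideanSpace ℝ (Fin n)) : |fderiv ℝ m a v| ≤ 2 * L * chartNorm x₀ u₀ v := by
    -- the Lipschitz bound along the line through `a` bounds the directional derivative
    have h1 : HasDerivAt (fun t : ℝ ↦ m (a + t • v)) (fderiv ℝ m a v) 0 :=
      ((hms.differentiable (by simp) a).hasFDerivAt.hasLineDerivAt v)
    refine h1.le_of_lip' (mul_nonneg (by positivity) (chartNorm_nonneg _ _ _)) ?_
    have h2 : Tendsto (fun t : ℝ ↦ a + t • v) (𝓝 0) (𝓝 a) := by
      have : Continuous fun t : ℝ ↦ a + t • v := by fun_prop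
      simpa using this.tendsto 0
    filter_upwards [h2.eventually (isOpen_ball.mem_nhds ha)] with t ht
    have h3 := hmLip ha ht
    rw [show a - (a + t • v) = (-t) • v by simp, chartNorm_smul, abs_neg] at h3
    simp only [zero_smul, add_zero, sub_zero, Real.norm_eq_abs]
    linarith
  refine ⟨m ∘ ψ, ?_, fun x hx ↦ ⟨?_, ?_⟩⟩
  · refine hms.contMDiff.comp_contMDiffOn ((contMDiffOn_extChartAt (x := x₀)).mono fun x hx ↦ ?_)
    rw [← extChartAt_source (𝓡 n)]
    exact hx.1
  · have h1 : h (ψ x) = χ x := by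
      rw [hh, indicator_of_mem (hsub hx.2), Function.comp, ψ.left_inv hx.1]
    rw [← h1, ← Real.dist_eq]
    refine ContDiffBump.dist_normed_convolution_le hhi.1 fun u hu ↦ ?_
    rw [mem_ball, dist_eq_norm] at hu
    have hu' : u ∈ closedBall u₀ R := by
      have := hmem hx.2 (t := ψ x - u) (by rw [mem_ball_zero_iff, norm_sub_rev]; exact hu)
      rwa [sub_sub_cancel] at this
    rw [Real.dist_eq, abs_sub_comm]
    refine (hLip (hsub hx.2) hu').trans (le_trans ?_ hρε)
    rw [mul_assoc (2 * (L : ℝ))]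
    refine mul_le_mul_of_nonneg_left ((hK _).trans ?_) (by positivity)
    exact mul_le_mul (le_abs_self K) hu.le (norm_nonneg _) (abs_nonneg K)
  · have hxs : x ∈ (chartAt (EuclideanSpace ℝ (Fin n)) x₀).source := by
      rw [← extChartAt_source (𝓡 n)]
      exact hx.1
    refine norm_grad_le (by positivity)
      ((hms.differentiable (by simp) (ψ x)).hasFDerivAt.hasMFDerivAt.comp x
        (mdifferentiableAt_extChartAt (I := 𝓡 n) (x := x₀) hxs).hasMFDerivAt) fun w ↦ ?_
    refine (hmd hx.2 (mfderiv (𝓡 n) 𝓘(ℝ, EuclideanSpace ℝ (Fin n)) ψ x w)).trans ?_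
    -- return from the norm of the centre to the norm at `x`, with another factor `2`
    have h3 := ((hball (hsub hx.2)).2
      (mfderiv (𝓡 n) 𝓘(ℝ, EuclideanSpace ℝ (Fin n)) ψ x w)).2
    have h4 := mul_le_mul_of_nonneg_left (h3.trans_eq (congrArg (2 * ·) (chartNorm_mfderiv hxs w)))
      (show (0 : ℝ) ≤ 2 * L by positivity)
    exact h4.trans_eq (by ring)

variable [SecondCountableTopology M]

/-- Lipschitz functions with compact support are uniformly approximated by smooth functions with
compact support whose gradients are bounded in terms of the Lipschitz constant. -/
theorem exists_smooth_approx_of_lipschitzWith {L : ℝ≥0} {χ : M → ℝ} (hχ : LipschitzWith L χ)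
    (hc : HasCompactSupport χ) {ε : ℝ} (hε : 0 < ε) :
    ∃ g : M → ℝ, ContMDiff (𝓡 n) 𝓘(ℝ, ℝ) ∞ g ∧ HasCompactSupport g ∧
      ∀ x, |g x - χ x| ≤ ε ∧ ‖grad n g x‖ ≤ 4 * L + ε := by
  choose U hU hxU hUc using exists_nhds_smooth_approx (n := n) (M := M)
  obtain ⟨t, ρ, hρ, hρc, hρs, hρ0, hρle, hρ1⟩ := exists_finite_smooth_partition (n := n) hc U hU hxU
  choose B hB0 hB using fun i ↦ exists_norm_grad_le (hρ i) (hρc i)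
  set A : ℝ := ∑ i ∈ t, B i + 1 with hA
  have hA0 : 0 ≤ ∑ i ∈ t, B i := Finset.sum_nonneg fun i _ ↦ hB0 i
  -- accuracy of the local approximations, which also controls the terms `(cᵢ - χ) ∇ρᵢ`
  set δ : ℝ := ε / A with hδ
  have hδ0 : 0 < δ := by positivity
  have hδε : δ ≤ ε := div_le_self hε.le (by linarith)
  have hδA : (∑ i ∈ t, B i) * δ ≤ ε := by
    rw [hδ, mul_div_assoc', div_le_iff₀ (by positivity)]
    nlinarith
  choose c hcs hcb using fun i ↦ hUc i L χ hχ δ hδ0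
  have hloc (i) (x) : x ∈ U i ∨ ρ i =ᶠ[𝓝 x] fun _ ↦ 0 := by
    by_cases hx : x ∈ tsupport (ρ i)
    · exact Or.inl (hρs i hx)
    · exact Or.inr (notMem_tsupport_iff_eventuallyEq.1 hx)
  have hs (i) : ContMDiff (𝓡 n) 𝓘(ℝ, ℝ) ∞ (fun x ↦ ρ i x * c i x) := by
    intro x
    rcases hloc i x with hx | hx
    · exact (hρ i x).mul ((hcs i).contMDiffAt ((hU i).mem_nhds hx))
    · refine contMDiffAt_const (c := (0 : ℝ)) |>.congr_of_eventuallyEq ?_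
      filter_upwards [hx] with y hy
      rw [hy, zero_mul]
  have hval (i) (x) : |ρ i x * (c i x - χ x)| ≤ ρ i x * δ := by
    rw [abs_mul, abs_of_nonneg (hρ0 i x)]
    rcases hloc i x with hx | hx
    · exact mul_le_mul_of_nonneg_left (hcb i x hx).1 (hρ0 i x)
    · rw [hx.self_of_nhds]; simp
  have hgrad (i) (x) : grad n (fun y ↦ ρ i y * c i y) x =
      ρ i x • grad n (c i) x + c i x • grad n (ρ i) x := by
    rcases hloc i x with hx | hx
    · exact grad_mul ((hρ i).mdifferentiable (by simp) x)
        (((hcs i).contMDiffAt ((hU i).mem_nhds hx)).mdifferentiableAt (by simp))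
    · have h1 : (fun y ↦ ρ i y * c i y) =ᶠ[𝓝 x] fun _ ↦ 0 := by
        filter_upwards [hx] with y hy
        rw [hy, zero_mul]
      rw [grad_eq_zero_of_eventuallyEq 0 h1, grad_eq_zero_of_eventuallyEq 0 hx, hx.self_of_nhds,
        zero_smul, smul_zero, add_zero]
  have hχ0 (x) (hx : x ∉ tsupport χ) : χ x = 0 := image_eq_zero_of_notMem_tsupport hx
  refine ⟨fun x ↦ ∑ i ∈ t, ρ i x * c i x, contMDiff_finsetSum fun i _ ↦ hs i, ?_,
    fun x ↦ ⟨?_, ?_⟩⟩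
  · refine HasCompactSupport.of_support_subset_isCompact
      (t.isCompact_biUnion fun i _ ↦ (hρc i).isCompact) fun x hx ↦ ?_
    obtain ⟨i, hi, h⟩ := Finset.exists_ne_zero_of_sum_ne_zero hx
    exact mem_iUnion₂.2 ⟨i, hi, subset_tsupport _ (left_ne_zero_of_mul h)⟩
  · have e : ∑ i ∈ t, ρ i x * c i x - χ x = ∑ i ∈ t, ρ i x * (c i x - χ x) := by
      simp only [mul_sub, Finset.sum_sub_distrib, ← Finset.sum_mul]
      by_cases hx : x ∈ tsupport χ
      · rw [(hρ1 x hx).self_of_nhds, one_mul]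
      · rw [hχ0 x hx, mul_zero]
    rw [e]
    refine (Finset.abs_sum_le_sum_abs _ _).trans ((Finset.sum_le_sum fun i _ ↦ hval i x).trans ?_)
    rw [← Finset.sum_mul]
    exact (mul_le_of_le_one_left hδ0.le (hρle x)).trans hδε
  · -- the gradients of the `ρᵢ` add up to zero where `χ` does not vanish
    have hz : χ x • ∑ i ∈ t, grad n (ρ i) x = 0 := by
      by_cases hx : x ∈ tsupport χ
      · rw [← grad_sum t hρ, grad_eq_zero_of_eventuallyEq 1 (hρ1 x hx), smul_zero]
      · rw [hχ0 x hx, zero_smul]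
    have e : grad n (fun y ↦ ∑ i ∈ t, ρ i y * c i y) x =
        ∑ i ∈ t, (ρ i x • grad n (c i) x + (c i x - χ x) • grad n (ρ i) x) := by
      rw [grad_sum t hs, ← sub_zero (∑ i ∈ t, grad n (fun y ↦ ρ i y * c i y) x), ← hz,
        Finset.smul_sum, ← Finset.sum_sub_distrib]
      refine Finset.sum_congr rfl fun i _ ↦ ?_
      rw [hgrad, sub_smul, add_sub_assoc]
    have hterm (i) : ‖ρ i x • grad n (c i) x + (c i x - χ x) • grad n (ρ i) x‖ ≤
        ρ i x * (4 * L) + B i * δ := by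
      refine (norm_add_le _ _).trans ?_
      rw [norm_smul, norm_smul, Real.norm_of_nonneg (hρ0 i x), Real.norm_eq_abs]
      rcases hloc i x with hx | hx
      · refine add_le_add (mul_le_mul_of_nonneg_left (hcb i x hx).2 (hρ0 i x)) ?_
        rw [mul_comm (B i)]
        exact mul_le_mul (hcb i x hx).1 (hB i x) (norm_nonneg _) hδ0.le
      · rw [hx.self_of_nhds, grad_eq_zero_of_eventuallyEq 0 hx, norm_zero]
        have := mul_nonneg (hB0 i) hδ0.le
        simpa using this
    rw [e]
    refine (norm_sum_le _ _).trans ((Finset.sum_le_sum fun i _ ↦ hterm i).trans ?_)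
    rw [Finset.sum_add_distrib, ← Finset.sum_mul, ← Finset.sum_mul]
    exact add_le_add (mul_le_of_le_one_left (by positivity) (hρle x)) hδA

end SmoothApproximation

/-! ### Cutoffs and density of the test functions -/

section Density
open Filter Metric

variable {n : ℕ} {M : Type*} [MetricSpace M] [ChartedSpace (EuclideanSpace ℝ (Fin n)) M]
variable [RiemannianBundle (fun x : M ↦ TangentSpace (𝓡 n) x)]
variable [IsManifold (𝓡 n) ∞ M] [MeasurableSpace M] [BorelSpace M]
  [IsContMDiffRiemannianBundle (𝓡 n) ∞ (EuclideanSpace ℝ (Fin n)) (fun x : M ↦ TangentSpace (𝓡 n) x)]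
variable [IsRiemannianManifold (𝓡 n) M] [SecondCountableTopology M] [CompleteSpace M]
variable {f : M → ℝ} {G : ∀ x : M, TangentSpace (𝓡 n) x} {V : M → ℝ} {p : ℝ≥0∞}

variable (n M) in
/-- On a complete manifold there are smooth functions with compact support which tend to `1` and
whose gradients tend to `0` uniformly. -/
theorem exists_smooth_cutoff : ∃ χ : ℕ → M → ℝ, (∀ j, ContMDiff (𝓡 n) 𝓘(ℝ, ℝ) ∞ (χ j)) ∧
    (∀ j, HasCompactSupport (χ j)) ∧ (∀ j x, |χ j x| ≤ 2) ∧
    (∀ j x, ‖grad n (χ j) x‖ ≤ 5 / ((j : ℝ) + 1)) ∧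
    ∀ x, Tendsto (fun j ↦ χ j x) atTop (𝓝 1) := by
  rcases isEmpty_or_nonempty M with hM | ⟨⟨o⟩⟩
  · exact ⟨fun _ _ ↦ 0, fun _ ↦ contMDiff_const, fun _ ↦ HasCompactSupport.zero,
      fun _ x ↦ isEmptyElim x, fun _ x ↦ isEmptyElim x, fun x ↦ isEmptyElim x⟩
  have : ProperSpace M := properSpace_of_complete n M
  -- the Lipschitz cutoffs to be smoothed
  set κ : ℕ → M → ℝ := fun j x ↦ max 0 (1 - dist o x / ((j : ℝ) + 1)) with hκ
  have hε (j : ℕ) : (0 : ℝ) < 1 / ((j : ℝ) + 1) := by positivity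
  have hL (j : ℕ) : LipschitzWith (1 / ((j : ℝ≥0) + 1)) (κ j) := by
    refine LipschitzWith.of_dist_le_mul fun x y ↦ ?_
    rw [Real.dist_eq]
    refine (abs_max_sub_max_le_max _ _ _ _).trans (max_le (by simp; positivity) ?_)
    rw [show 1 - dist o x / ((j : ℝ) + 1) - (1 - dist o y / ((j : ℝ) + 1)) =
      1 / ((j : ℝ) + 1) * (dist o y - dist o x) by ring, abs_mul, abs_of_pos (hε j)]
    push_cast
    refine mul_le_mul_of_nonneg_left ?_ (hε j).le
    rw [dist_comm o y, dist_comm o x, dist_comm x y]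
    exact abs_dist_sub_le y x o
  have hc (j : ℕ) : HasCompactSupport (κ j) := by
    refine HasCompactSupport.of_support_subset_isCompact (isCompact_closedBall o ((j : ℝ) + 1))
      fun x hx ↦ ?_
    by_contra h
    rw [mem_closedBall', not_le] at h
    refine hx (max_eq_left ?_)
    rw [sub_nonpos, le_div_iff₀ (by positivity), one_mul]
    exact h.le
  choose χ hs hsc hb using fun j ↦ exists_smooth_approx_of_lipschitzWith (n := n) (hL j) (hc j) (hε j)
  have hκ0 (j x) : 0 ≤ κ j x := le_max_left _ _
  have hκ1 (j x) : κ j x ≤ 1 := max_le zero_le_one (by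
    have : 0 ≤ dist o x / ((j : ℝ) + 1) := by positivity
    linarith)
  refine ⟨χ, hs, hsc, fun j x ↦ ?_, fun j x ↦ ?_, fun x ↦ ?_⟩
  · have h1 := abs_le.1 (hb j x).1
    have h2 : 1 / ((j : ℝ) + 1) ≤ 1 := by
      rw [div_le_one (by positivity)]
      linarith [(Nat.cast_nonneg j : (0 : ℝ) ≤ j)]
    rw [abs_le]
    constructor <;> linarith [hκ0 j x, hκ1 j x]
  · refine (hb j x).2.trans (le_of_eq ?_)
    push_cast
    ring
  · have hlim : Tendsto (fun j : ℕ ↦ (1 + dist o x) * (1 / ((j : ℝ) + 1))) atTop (𝓝 0) := by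
      simpa using tendsto_one_div_add_atTop_nhds_zero_nat.const_mul (1 + dist o x)
    rw [tendsto_iff_dist_tendsto_zero]
    refine squeeze_zero (fun _ ↦ dist_nonneg) (fun j ↦ ?_) hlim
    have h1 := abs_le.1 (hb j x).1
    have h2 : 1 - dist o x / ((j : ℝ) + 1) ≤ κ j x := le_max_right _ _
    rw [Real.dist_eq, add_mul, one_mul, mul_one_div, abs_le]
    have h3 : 0 ≤ dist o x / ((j : ℝ) + 1) := by positivity
    constructor <;> linarith [hκ1 j x]

/-- The products of `f` with the cutoffs `χ j` converge to `f` in `H¹_{p,V}`. -/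
theorem tendsto_sobolevNorm_smul_sub (hp1 : 1 ≤ p) (hp : p ≠ ⊤) (hw : IsWeakGradient f G)
    (hm : MemSobolev V p f G) {χ : ℕ → M → ℝ} (hχ : ∀ j, ContMDiff (𝓡 n) 𝓘(ℝ, ℝ) ∞ (χ j))
    (hχ2 : ∀ j x, |χ j x| ≤ 2) (hχg : ∀ j x, ‖grad n (χ j) x‖ ≤ 5 / ((j : ℝ) + 1))
    (hlim : ∀ x, Tendsto (fun j ↦ χ j x) atTop (𝓝 1)) :
    Tendsto (fun j ↦ sobolevNorm V p (fun x ↦ χ j x * f x - f x)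
      (fun x ↦ (χ j x • G x + f x • grad n (χ j) x) - G x)) atTop (𝓝 0) := by
  have hp0 : p ≠ 0 := (zero_lt_one.trans_le hp1).ne'
  have hχm (j) : AEStronglyMeasurable (χ j) (riemannianMeasure n M) :=
    (hχ j).continuous.aestronglyMeasurable
  have hχ3 (j x) : |χ j x - 1| ≤ 3 := by
    have := abs_le.1 (hχ2 j x)
    rw [abs_le]; constructor <;> linarith
  have hlim' (x) : Tendsto (fun j ↦ |χ j x - 1|) atTop (𝓝 0) := by
    simpa using ((hlim x).sub_const 1).abs
  have h5 (j : ℕ) : 5 / ((j : ℝ) + 1) ≤ 5 := div_le_self (by norm_num)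
    (by linarith [(Nat.cast_nonneg j : (0 : ℝ) ≤ j)])
  have hlim5 : Tendsto (fun j : ℕ ↦ 5 / ((j : ℝ) + 1)) atTop (𝓝 0) := by
    simpa [div_eq_mul_inv] using tendsto_one_div_add_atTop_nhds_zero_nat.const_mul (5 : ℝ)
  have hgrad (j x) : ‖(χ j x • G x + f x • grad n (χ j) x) - G x‖ ≤
      |χ j x - 1| * ‖G x‖ + ‖f x‖ * (5 / ((j : ℝ) + 1)) := by
    rw [show (χ j x • G x + f x • grad n (χ j) x) - G x =
      (χ j x - 1) • G x + f x • grad n (χ j) x by rw [sub_smul, one_smul]; abel]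
    refine (norm_add_le _ _).trans ?_
    rw [norm_smul, norm_smul, Real.norm_eq_abs (χ j x - 1)]
    exact add_le_add le_rfl (mul_le_mul_of_nonneg_left (hχg j x) (norm_nonneg _))
  -- the terms without gradient, for `a = f` and `a = V f`
  have scalar {a : M → ℝ} (ha : MemLp a p (riemannianMeasure n M)) {F : ℕ → M → ℝ}
      (hF : ∀ j x, F j x = (χ j x - 1) * a x) :
      Tendsto (fun j ↦ eLpNorm (F j) p (riemannianMeasure n M)) atTop (𝓝 0) := by
    have hF' (j) : F j = fun x ↦ (χ j x - 1) * a x := funext (hF j)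
    simp only [hF']
    refine tendsto_eLpNorm_zero_of_dominated hp0 hp (ha.norm.const_mul 3)
      (fun j ↦ ((hχm j).sub aestronglyMeasurable_const).mul ha.1)
      (fun j ↦ Eventually.of_forall fun x ↦ ?_) (Eventually.of_forall fun x ↦ ?_)
    · rw [abs_mul]
      exact mul_le_mul_of_nonneg_right (hχ3 j x) (abs_nonneg _)
    · simpa using ((hlim x).sub_const 1).mul_const (a x)
  refine tendsto_sobolevNorm_zero (scalar hm.memLp fun j x ↦ by ring) ?_
    (scalar hm.memLp_mul fun j x ↦ by ring)
  refine tendsto_eLpNorm_zero_of_dominated hp0 hp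
    ((hm.memLp_grad.const_mul 3).add (hm.memLp.norm.mul_const 5))
    (fun j ↦ ((hw.smooth_mul (hχ j)).sub hw).aestronglyMeasurable_norm)
    (fun j ↦ Eventually.of_forall fun x ↦ ?_) (Eventually.of_forall fun x ↦ ?_)
  · rw [abs_of_nonneg (norm_nonneg _)]
    exact (hgrad j x).trans (add_le_add (mul_le_mul_of_nonneg_right (hχ3 j x) (norm_nonneg _))
      (mul_le_mul_of_nonneg_left (h5 j) (norm_nonneg _)))
  · refine squeeze_zero (fun _ ↦ norm_nonneg _) (fun j ↦ hgrad j x) ?_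
    simpa using ((hlim' x).mul_const ‖G x‖).add (hlim5.const_mul ‖f x‖)

variable [Fact (1 ≤ p)]

/-- Smooth functions with compact support are dense in `H¹_{p,V}`. -/
theorem testSubmodule_topologicalClosure_eq_top (hp : p ≠ ⊤)
    (hV : ∀ S : Set M, IsCompact S → MemLp V p ((riemannianMeasure n M).restrict S)) :
    (testSubmodule n V p).topologicalClosure = ⊤ := by
  refine eq_top_iff.2 fun h _ ↦ ?_
  have hw := h.isWeakGradient
  have hm := h.memSobolev
  obtain ⟨χ, hs, hc, h2, hg, hlim⟩ := exists_smooth_cutoff n M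
  have hm' (j : ℕ) := MemSobolev.smooth_mul (B := 5) hw hm (hs j)
    (fun x ↦ (h2 j x).trans (by norm_num)) (fun x ↦ (hg j x).trans (div_le_self (by norm_num)
      (by linarith [(Nat.cast_nonneg j : (0 : ℝ) ≤ j)])))
  set u : ℕ → SobolevH n V p := fun j ↦ SobolevH.mk (hw.smooth_mul (hs j)) (hm' j) with hu
  refine (Submodule.isClosed_topologicalClosure _).mem_of_tendsto (f := u) (b := atTop) ?_
    (Eventually.of_forall fun j ↦ ?_)
  · rw [tendsto_iff_norm_sub_tendsto_zero]
    refine (tendsto_sobolevNorm_smul_sub Fact.out hp hw hm hs h2 hg hlim).congr fun j ↦ ?_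
    exact (SobolevH.norm_sub_eq (SobolevH.coeFn_mk _ _) (hw.smooth_mul (hs j))
      (EventuallyEq.refl _ _) hw).symm
  · exact smul_mem_closure_of_hasCompactSupport hp hV hw hm (hs j) (hc j) (SobolevH.coeFn_mk _ _)

variable (n V p) in
/-- The inclusion of `E¹_{p,V}` in `H¹_{p,V}`. -/
def SmoothSobolev.toSobolevH : SmoothSobolev n V p →ₗ[ℝ] SobolevH n V p where
  toFun f := SobolevH.mk (isWeakGradient_grad f.contMDiff) f.memSobolev
  map_add' f g := by
    refine SobolevH.ext_ae ((SobolevH.coeFn_mk _ _).trans ?_)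
    rw [map_add, map_add]
    exact (((SobolevH.coeFn_mk _ _).add (SobolevH.coeFn_mk _ _)).symm.trans
      (Lp.coeFn_add _ _).symm)
  map_smul' c f := by
    refine SobolevH.ext_ae ((SobolevH.coeFn_mk _ _).trans ?_)
    rw [map_smul, RingHom.id_apply, map_smul]
    exact (((SobolevH.coeFn_mk _ _).const_smul c).symm.trans (Lp.coeFn_smul _ _).symm)

theorem SmoothSobolev.coeFn_toSobolevH (f : SmoothSobolev n V p) :
    (SmoothSobolev.toSobolevH n V p f).toLp =ᵐ[riemannianMeasure n M] f.toFun :=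
  SobolevH.coeFn_mk (isWeakGradient_grad f.contMDiff) f.memSobolev

theorem SmoothSobolev.norm_toSobolevH (f : SmoothSobolev n V p) :
    ‖SmoothSobolev.toSobolevH n V p f‖ = ‖f‖ :=
  SobolevH.norm_eq f.coeFn_toSobolevH (isWeakGradient_grad f.contMDiff)

theorem SmoothSobolev.denseRange_toSobolevH (hp : p ≠ ⊤)
    (hV : ∀ S : Set M, IsCompact S → MemLp V p ((riemannianMeasure n M).restrict S)) :
    DenseRange (SmoothSobolev.toSobolevH n V p) := by
  refine Dense.mono ?_ ((Submodule.dense_iff_topologicalClosure_eq_top).2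
    (testSubmodule_topologicalClosure_eq_top (n := n) (M := M) hp hV))
  rintro h ⟨φ, hφ, hc, e⟩
  let f : SmoothSobolev n V p := ⟨φ, hφ, memSobolev_of_hasCompactSupport hV hφ hc⟩
  exact ⟨f, SobolevH.ext_ae (f.coeFn_toSobolevH.trans e.symm)⟩

end Density

end RiemannianSobolev

end

theorem mainTheorem12 {n : ℕ} {M : Type*} [MetricSpace M] [CompleteSpace M]
    [SecondCountableTopology M] [ChartedSpace (EuclideanSpace ℝ (Fin n)) M]
    [IsManifold (𝓡 n) ∞ M] [Bundle.RiemannianBundle (fun x : M ↦ TangentSpace (𝓡 n) x)]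
    [IsContMDiffRiemannianBundle (𝓡 n) ∞ (EuclideanSpace ℝ (Fin n))
      (fun x : M ↦ TangentSpace (𝓡 n) x)]
    [IsRiemannianManifold (𝓡 n) M] [MeasurableSpace M] [BorelSpace M]
    (V : M → ℝ) (q : ℝ) (hV : RiemannianSobolev.IsLocalReverseHolder n q V)
    (p : ℝ≥0∞) [Fact (1 ≤ p)] (hpq : p < ENNReal.ofReal q) :
    ((∀ φ : M → ℝ, ContMDiff (𝓡 n) 𝓘(ℝ, ℝ) ∞ φ → HasCompactSupport φ →
        ∃ h : RiemannianSobolev.SobolevH n V p,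
          h.toLp =ᵐ[RiemannianSobolev.riemannianMeasure n M] φ) ∧
      Dense {h : RiemannianSobolev.SobolevH n V p | ∃ φ : M → ℝ,
        ContMDiff (𝓡 n) 𝓘(ℝ, ℝ) ∞ φ ∧ HasCompactSupport φ ∧
          h.toLp =ᵐ[RiemannianSobolev.riemannianMeasure n M] φ}) ∧
    ∃ Φ : RiemannianSobolev.SobolevW n V p ≃ₗᵢ[ℝ] RiemannianSobolev.SobolevH n V p,
      ∀ f : RiemannianSobolev.SmoothSobolev n V p,
        (Φ (f : RiemannianSobolev.SobolevW n V p)).toLp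
          =ᵐ[RiemannianSobolev.riemannianMeasure n M] f.toFun := by
  have hp : p ≠ ⊤ := (hpq.trans ENNReal.ofReal_lt_top).ne
  have hVp (S : Set M) (hS : IsCompact S) :
      MemLp V p ((RiemannianSobolev.riemannianMeasure n M).restrict S) :=
    hV.memLp Fact.out hpq hS
  have hcomplete : CompleteSpace (RiemannianSobolev.SobolevH n V p) :=
    RiemannianSobolev.SobolevH.completeSpace hp
  refine ⟨⟨fun φ hφ hc ↦ ⟨_, RiemannianSobolev.SobolevH.coeFn_mk
    (RiemannianSobolev.isWeakGradient_grad hφ)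
    (RiemannianSobolev.memSobolev_of_hasCompactSupport hVp hφ hc)⟩,
    Submodule.dense_iff_topologicalClosure_eq_top.2
      (RiemannianSobolev.testSubmodule_topologicalClosure_eq_top hp hVp)⟩, ?_⟩
  -- the isometric inclusions of `E¹_{p,V}` in its completion and in the complete space `H¹_{p,V}`
  -- both have dense range, so the identity of `E¹_{p,V}` extends to an isometry between them
  set e₁ := (UniformSpace.Completion.toComplₗᵢ (𝕜 := ℝ)
    (E := RiemannianSobolev.SmoothSobolev n V p)).toLinearMap
  have h1 : DenseRange e₁ := UniformSpace.Completion.denseRange_coe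
  have h2 := RiemannianSobolev.SmoothSobolev.denseRange_toSobolevH (n := n) (M := M) hp hVp
  have h3 (f : RiemannianSobolev.SmoothSobolev n V p) :
      ‖RiemannianSobolev.SmoothSobolev.toSobolevH n V p f‖ = ‖e₁ f‖ :=
    f.norm_toSobolevH.trans (UniformSpace.Completion.norm_coe f).symm
  refine ⟨(LinearEquiv.refl ℝ _).extendOfIsometry e₁ _ h1 h2 h3, fun f ↦ ?_⟩
  have e := LinearEquiv.extendOfIsometry_eq (LinearEquiv.refl ℝ _) e₁ _ h1 h2 h3 f
  exact Filter.EventuallyEq.trans (Filter.EventuallyEq.of_eq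
    (congrArg (fun h : RiemannianSobolev.SobolevH n V p ↦ (h.toLp : M → ℝ)) e)) f.coeFn_toSobolevH
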